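/- Let $\Bbbk$ be a field of characteristic $0$ and $n\ge 0$. Let $W_n^{\mathrm{pol}}=\{\sum_{i=1}^n f_i\partial_i : f_i\in\Bbbk[x_1,\dots,x_n]\}$ be the Lie algebra of polynomial vector fields, graded by the degree of the coefficients, and for $d\ge 0$ let $L_d\subset W_n^{\mathrm{pol}}$ be the Lie subalgebra of the vector fields all of whose coefficients lie in $(x_1,\dots,x_n)^d$ (so $L_0=W_n^{\mathrm{pol}}$). For a finite-dimensional irreducible representation $V$ of $\mathfrak{gl}_n$ let $\mathcal T_V=\Bbbk[x_1,\dots,x_n]\otimes V$ be the module of polynomial tensor fields of type $V$, with the action $$\Big(\sum_j f_j\partial_j\Big)(g\otimes v)=\sum_j f_j\,\partial_j g\otimes v+\sum_{i,j}(\partial_i f_j)\,g\otimes E_{ij}v ,$$ graded by polynomial degree. Let $\mathcal O_d^{\mathrm{pol}}$ be the category of finitely generated $\mathbb Z$-graded $L_d$-modules that are isomorphic, as graded modules, to a quotient of a graded $L_d$-submodule of a finite direct sum of degree shifts of finite tensor products $\mathcal T_{V_1}\otimes\cdots\otimes\mathcal T_{V_r}$ ($r\ge 0$). Let $\mathfrak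 g\subset W_n^{\mathrm{pol}}$ be a graded Lie subalgebra of finite codimension. Let $d\ge 0$, let $\mathfrak h\subset W_n^{\mathrm{pol}}$ be a Lie subalgebra containing both $\mathfrak g$ and $L_d$ (for example $\mathfrak h=L_d\supset\mathfrak g$, or $\mathfrak h=\mathfrak g\supset L_d$), and let $M$ be an $\mathfrak h$-module whose restriction to $L_d$ belongs to $\mathcal O_d^{\mathrm{pol}}$. Then the Lie algebra homology of $\mathfrak g$ with coefficients in $M$ (the homology of the Chevalley–Eilenberg complex $\Lambda^\bullet\mathfrak g\otimes M$) is finite-dimensional in every degree: $$\dim_{\Bbbk} H_p(\mathfrak g;M)<\infty\qquad\text{for all } p\ge 0 .$$ -/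

import Mathlib

open scoped TensorProduct
/- Endomorphism and matrix algebras are Lie algebras under the commutator. -/
attribute [local instance] LieRing.ofAssociativeRing
noncomputable section

namespace ChevalleyEilenberg

variable {k L M : Type*} [Field k] [LieRing L] [LieAlgebra k L] [AddCommGroup M] [Module k M]

variable (k L) in
/-- The recursion step of `adExt`. -/
def adExtStep : L →ₗ[k] CliffordAlgebra (0 : QuadraticForm k L) × (L →ₗ[k] ExteriorAlgebra k L) →ₗ[k]
    (L →ₗ[k] ExteriorAlgebra k L) :=
  LinearMap.mk₂ k
    (fun y z =>
        (LinearMap.mulRight k z.1 ∘ₗ ExteriorAlgebra.ι k ∘ₗ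
            (LieModule.toEnd k L L : L →ₗ[k] Module.End k L).flip y +
          LinearMap.mulLeft k (ExteriorAlgebra.ι k y) ∘ₗ z.2 : L →ₗ[k] ExteriorAlgebra k L))
      (by intro a b z; ext x; simp [add_mul]; abel)
      (by intro c a z; ext x; simp)
      (by intro a z w; ext x; simp [mul_add]; abel)
      (by intro c a z; ext x; simp)

lemma adExtStep_adExtStep (y : L) (ω : CliffordAlgebra (0 : QuadraticForm k L))
    (ψ : L →ₗ[k] ExteriorAlgebra k L) :
    adExtStep k L y (CliffordAlgebra.ι (0 : QuadraticForm k L) y * ω, adExtStep k L y (ω, ψ)) =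
      (0 : QuadraticForm k L) y • ψ := by
  ext x
  have h1 := ExteriorAlgebra.ι_add_mul_swap (R := k) ⁅x, y⁆ y
  have h2 := ExteriorAlgebra.ι_sq_zero (R := k) y
  have h3 : ExteriorAlgebra.ι k ⁅x, y⁆ * (ExteriorAlgebra.ι k y * ω)
      = - (ExteriorAlgebra.ι k y * (ExteriorAlgebra.ι k ⁅x, y⁆ * ω)) := by
    rw [← mul_assoc, ← mul_assoc, ← neg_mul, eq_neg_of_add_eq_zero_left h1]
  have h4 : ExteriorAlgebra.ι k y * (ExteriorAlgebra.ι k y * ψ x) = 0 := by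
    rw [← mul_assoc, h2, zero_mul]
  change ExteriorAlgebra.ι k ⁅x, y⁆ * (ExteriorAlgebra.ι k y * ω) + ExteriorAlgebra.ι k y *
    (ExteriorAlgebra.ι k ⁅x, y⁆ * ω + ExteriorAlgebra.ι k y * ψ x) = _
  rw [h3, mul_add, h4]
  simp

variable (k) in
/-- `adExt k ω x` is the value at `ω` of the derivation of the exterior algebra of `L` that extends
`y ↦ ⁅x, y⁆`. -/
def adExt : ExteriorAlgebra k L →ₗ[k] L →ₗ[k] ExteriorAlgebra k L :=
  CliffordAlgebra.foldr' (0 : QuadraticForm k L) (adExtStep k L) adExtStep_adExtStep 0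

lemma adExt_one : adExt k (1 : ExteriorAlgebra k L) = 0 := by
  have := CliffordAlgebra.foldr'_algebraMap (0 : QuadraticForm k L) (adExtStep k L)
    adExtStep_adExtStep 0 1
  rw [map_one, smul_zero] at this
  exact this

lemma adExt_ι_mul (x y : L) (ω : ExteriorAlgebra k L) :
    adExt k (ExteriorAlgebra.ι k y * ω) x =
      ExteriorAlgebra.ι k ⁅x, y⁆ * ω + ExteriorAlgebra.ι k y * adExt k ω x :=
  congrArg (fun f => f x) <| CliffordAlgebra.foldr'_ι_mul (0 : QuadraticForm k L) (adExtStep k L)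
    adExtStep_adExtStep 0 y ω

/-- Left multiplication by `x ∈ L` on `⋀ L ⊗ M`. -/
def wedge (x : L) : ExteriorAlgebra k L ⊗[k] M →ₗ[k] ExteriorAlgebra k L ⊗[k] M :=
  (LinearMap.mulLeft k (ExteriorAlgebra.ι k x)).rTensor M

@[simp] lemma wedge_tmul (x : L) (ω : ExteriorAlgebra k L) (m : M) :
    wedge x (ω ⊗ₜ[k] m) = (ExteriorAlgebra.ι k x * ω) ⊗ₜ m := rfl

lemma wedge_add (x y : L) (c : ExteriorAlgebra k L ⊗[k] M) :
    wedge (x + y) c = wedge x c + wedge y c := by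
  induction c with
  | zero => simp
  | tmul a b => simp [add_mul, TensorProduct.add_tmul]
  | add a b ha hb => simp only [map_add, ha, hb]; abel

lemma wedge_smul (r : k) (x : L) (c : ExteriorAlgebra k L ⊗[k] M) :
    wedge (r • x) c = r • wedge x c := by
  induction c with
  | zero => simp
  | tmul a b => simp [TensorProduct.smul_tmul']
  | add a b ha hb => simp only [map_add, ha, hb, smul_add]

lemma wedge_wedge (x : L) (c : ExteriorAlgebra k L ⊗[k] M) : wedge x (wedge x c) = 0 := by
  induction c with
  | zero => simp
  | tmul a b => simp [← mul_assoc]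
  | add a b ha hb => simp only [map_add, ha, hb, add_zero]

/-- The recursion step of `total`. -/
def totalStep (ρ : L →ₗ⁅k⁆ Module.End k M) :
    L →ₗ[k] CliffordAlgebra (0 : QuadraticForm k L) × (M →ₗ[k] ExteriorAlgebra k L ⊗[k] M) →ₗ[k]
      (M →ₗ[k] ExteriorAlgebra k L ⊗[k] M) :=
  LinearMap.mk₂ k
    (fun x z =>
        (TensorProduct.mk k (ExteriorAlgebra k L) M (adExt k z.1 x) +
          TensorProduct.mk k (ExteriorAlgebra k L) M z.1 ∘ₗ ρ x - wedge x ∘ₗ z.2 :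
            M →ₗ[k] ExteriorAlgebra k L ⊗[k] M))
      (by
        intro a b z; ext x
        simp [TensorProduct.tmul_add, wedge_add]
        abel)
      (by
        intro c b z; ext x
        simp [TensorProduct.smul_tmul', wedge_smul, smul_add, smul_sub])
      (by
        intro a b z; ext x
        simp
        abel)
      (by
        intro c b z; ext x
        simp [TensorProduct.smul_tmul', smul_add, smul_sub])

lemma totalStep_totalStep (ρ : L →ₗ⁅k⁆ Module.End k M) (x : L)
    (ω : CliffordAlgebra (0 : QuadraticForm k L)) (φ : M →ₗ[k] ExteriorAlgebra k L ⊗[k] M) :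
    totalStep ρ x (CliffordAlgebra.ι (0 : QuadraticForm k L) x * ω, totalStep ρ x (ω, φ)) =
      (0 : QuadraticForm k L) x • φ := by
  ext m
  change adExt k (ExteriorAlgebra.ι k x * ω) x ⊗ₜ m + (ExteriorAlgebra.ι k x * ω) ⊗ₜ ρ x m -
    wedge x (adExt k ω x ⊗ₜ m + ω ⊗ₜ ρ x m - wedge x (φ m)) = _
  rw [adExt_ι_mul, map_sub, map_add, wedge_wedge]
  simp

/-- The Chevalley–Eilenberg differential on `⋀ L ⊗ M`, given by
`∂(x ∧ ω ⊗ m) = θ_x (ω ⊗ m) - x ∧ ∂(ω ⊗ m)`, where `θ_x` is the action of `x`. -/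
def total (ρ : L →ₗ⁅k⁆ Module.End k M) :
    ExteriorAlgebra k L →ₗ[k] M →ₗ[k] ExteriorAlgebra k L ⊗[k] M :=
  CliffordAlgebra.foldr' (0 : QuadraticForm k L) (totalStep ρ) (totalStep_totalStep ρ) 0

lemma total_one (ρ : L →ₗ⁅k⁆ Module.End k M) : total ρ 1 = 0 := by
  have := CliffordAlgebra.foldr'_algebraMap (0 : QuadraticForm k L) (totalStep ρ)
    (totalStep_totalStep ρ) 0 1
  rw [map_one, smul_zero] at this
  exact this

lemma total_ι_mul (ρ : L →ₗ⁅k⁆ Module.End k M) (x : L) (ω : ExteriorAlgebra k L) (m : M) :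
    total ρ (ExteriorAlgebra.ι k x * ω) m = adExt k ω x ⊗ₜ m + ω ⊗ₜ ρ x m -
      wedge x (total ρ ω m) :=
  congrArg (fun f => f m) <| CliffordAlgebra.foldr'_ι_mul (0 : QuadraticForm k L) (totalStep ρ)
    (totalStep_totalStep ρ) 0 x ω

lemma ιMulti_cons {p : ℕ} (a : L) (v : Fin p → L) :
    ExteriorAlgebra.ιMulti k (p + 1) (Fin.cons a v : Fin (p + 1) → L) =
      ExteriorAlgebra.ι k a * ExteriorAlgebra.ιMulti k p v := by
  rw [ExteriorAlgebra.ιMulti_succ_apply]; rfl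

lemma exists_cons {A : Type*} {p : ℕ} (x : Fin (p + 1) → A) :
    ∃ (a : A) (v : Fin p → A), x = (Fin.cons a v : Fin (p + 1) → A) :=
  ⟨x 0, Fin.tail x, (Fin.cons_self_tail x).symm⟩

lemma adExt_ιMulti {p : ℕ} (x : Fin p → L) (y : L) :
    adExt k (ExteriorAlgebra.ιMulti k p x) y =
      ∑ j, ExteriorAlgebra.ιMulti k p (Function.update x j ⁅y, x j⁆) := by
  induction p with
  | zero => simp [adExt_one]
  | succ p ih =>
    obtain ⟨a, v, rfl⟩ := exists_cons x
    rw [ιMulti_cons, adExt_ι_mul, ih, Fin.sum_univ_succ, Finset.mul_sum]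
    simp only [Fin.cons_zero, Fin.cons_succ, Fin.update_cons_zero, ← Fin.cons_update, ιMulti_cons]

variable (k L M) in
/-- The `p`-chains `⋀ᵖ L ⊗ M` of the Lie algebra `L` with coefficients in `M`. -/
def Chains (p : ℕ) : Type _ := ⋀[k]^p L ⊗[k] M

instance (p : ℕ) : AddCommGroup (Chains k L M p) :=
  inferInstanceAs (AddCommGroup (⋀[k]^p L ⊗[k] M))

instance (p : ℕ) : Module k (Chains k L M p) :=
  inferInstanceAs (Module k (⋀[k]^p L ⊗[k] M))

variable (k) in
/-- The chain `x₁ ∧ ⋯ ∧ xₚ ⊗ m`. -/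
def chain {p : ℕ} (x : Fin p → L) (m : M) : Chains k L M p :=
  exteriorPower.ιMulti k p x ⊗ₜ[k] m

variable (k L M) in
/-- The inclusion of the `p`-chains in `⋀ L ⊗ M`. -/
def incl (p : ℕ) : Chains k L M p →ₗ[k] ExteriorAlgebra k L ⊗[k] M :=
  (Submodule.subtype (⋀[k]^p L)).rTensor M

lemma incl_chain {p : ℕ} (x : Fin p → L) (m : M) :
    incl k L M p (chain k x m) = ExteriorAlgebra.ιMulti k p x ⊗ₜ m := rfl

lemma incl_injective (p : ℕ) : Function.Injective (incl k L M p) :=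
  Module.Flat.rTensor_preserves_injective_linearMap (M := M) _
    (Submodule.subtype_injective (⋀[k]^p L))

/-- The value of the Chevalley–Eilenberg differential at `x₀ ∧ ⋯ ∧ xₚ ⊗ m`. -/
def boundaryFormula (ρ : L →ₗ⁅k⁆ Module.End k M) {p : ℕ} (x : Fin (p + 1) → L) (m : M) :
    Chains k L M p :=
  ∑ i : Fin (p + 1), (-1 : k) ^ (i : ℕ) •
    (chain k (i.removeNth x) (ρ (x i) m) +
      ∑ j ∈ Finset.Ioi i,
        chain k (i.removeNth (Function.update x j ⁅x i, x j⁆)) m)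

lemma total_ιMulti (ρ : L →ₗ⁅k⁆ Module.End k M) {p : ℕ} (x : Fin (p + 1) → L) (m : M) :
    total ρ (ExteriorAlgebra.ιMulti k (p + 1) x) m =
      incl k L M p (boundaryFormula ρ x m) := by
  have key : ∀ {p : ℕ} (x : Fin (p + 1) → L),
     incl k L M p (boundaryFormula ρ x m) =
       ∑ i : Fin (p + 1), (-1 : k) ^ (i : ℕ) •
        (ExteriorAlgebra.ιMulti k p (i.removeNth x) ⊗ₜ[k] ρ (x i) m +
      ∑ j ∈ Finset.Ioi i,
        ExteriorAlgebra.ιMulti k p (i.removeNth (Function.update x j ⁅x i, x j⁆)) ⊗ₜ[k] m) := by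
    intro p x
    simp [boundaryFormula, incl_chain]
  rw [key]
  induction p with
  | zero =>
    obtain ⟨a, v, rfl⟩ := exists_cons x
    rw [ιMulti_cons, total_ι_mul]
    simp [adExt_one, total_one]
  | succ p ih =>
    obtain ⟨a, v, rfl⟩ := exists_cons x
    rw [ιMulti_cons, total_ι_mul, ih, Fin.sum_univ_succ (n := p + 1), adExt_ιMulti]
    have hr (i : Fin (p + 1)) (w : Fin (p + 1) → L) :
        i.succ.removeNth (Fin.cons a w : Fin (p + 2) → L) =
        (Fin.cons a (i.removeNth w) : Fin (p + 1) → L) :=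
      Fin.cons_comp_succ_succAbove ..
    simp only [Fin.sum_Ioi_zero, Fin.sum_Ioi_succ, Fin.cons_zero, Fin.cons_succ,
      ← Fin.cons_update, hr, ιMulti_cons, Fin.removeNth_zero, Fin.tail_cons]
    rw [map_sum, sub_eq_add_neg, ← Finset.sum_neg_distrib, TensorProduct.sum_tmul]
    congr 1
    · rw [add_comm]; simp
    · refine Finset.sum_congr rfl fun i _ => ?_
      simp only [map_smul, map_add, map_sum, wedge_tmul, Fin.val_succ, pow_succ, mul_neg, mul_one,
        neg_smul]

/-- `boundaryFormula` as an alternating map in `x`. -/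
def boundaryAlternating (ρ : L →ₗ⁅k⁆ Module.End k M) (p : ℕ) :
    L [⋀^Fin (p + 1)]→ₗ[k] (M →ₗ[k] Chains k L M p) where
  toFun x :=
    { toFun := fun m => boundaryFormula ρ x m
      map_add' := fun a b => incl_injective p <| by
        simp only [map_add, ← total_ιMulti]
      map_smul' := fun c b => incl_injective p <| by
        simp only [map_smul, ← total_ιMulti, RingHom.id_apply] }
  map_update_add' x i a b := LinearMap.ext fun m => incl_injective p <| by
    simp only [LinearMap.coe_mk, AddHom.coe_mk, LinearMap.add_apply, map_add, ← total_ιMulti]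
    rw [AlternatingMap.map_update_add]
    simp
  map_update_smul' x i c a := LinearMap.ext fun m => incl_injective p <| by
    simp only [LinearMap.coe_mk, AddHom.coe_mk, LinearMap.smul_apply, map_smul, ← total_ιMulti]
    rw [AlternatingMap.map_update_smul]
    simp
  map_eq_zero_of_eq' x i j h hij := LinearMap.ext fun m => incl_injective p <| by
    simp only [LinearMap.coe_mk, AddHom.coe_mk, LinearMap.zero_apply, map_zero, ← total_ιMulti]
    rw [AlternatingMap.map_eq_zero_of_eq _ _ h hij]
    simp

/-- The Chevalley–Eilenberg differential `⋀ᵖ⁺¹ L ⊗ M → ⋀ᵖ L ⊗ M`,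
`∂ (x₀ ∧ ⋯ ∧ xₚ ⊗ m) = ∑ᵢ (-1)ⁱ x₀ ∧ ⋯ x̂ᵢ ⋯ ∧ xₚ ⊗ xᵢ m
  + ∑_{i < j} (-1)ⁱ x₀ ∧ ⋯ x̂ᵢ ⋯ ∧ [xᵢ, xⱼ] ∧ ⋯ ∧ xₚ ⊗ m`,
where `[xᵢ, xⱼ]` stands at the place of `xⱼ`. Moving it to the front gives the usual second sum
`∑_{i < j} (-1)^{i + j + 1} [xᵢ, xⱼ] ∧ x₀ ∧ ⋯ x̂ᵢ ⋯ x̂ⱼ ⋯ ∧ xₚ ⊗ m`. -/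
def d (ρ : L →ₗ⁅k⁆ Module.End k M) (p : ℕ) : Chains k L M (p + 1) →ₗ[k] Chains k L M p :=
  TensorProduct.lift
    (exteriorPower.alternatingMapLinearEquiv (N := M →ₗ[k] Chains k L M p) (boundaryAlternating ρ p))

lemma d_chain (ρ : L →ₗ⁅k⁆ Module.End k M) {p : ℕ} (x : Fin (p + 1) → L) (m : M) :
    d ρ p (chain k x m) =
      ∑ i : Fin (p + 1), (-1 : k) ^ (i : ℕ) •
        (chain k (i.removeNth x) (ρ (x i) m) +
          ∑ j ∈ Finset.Ioi i,
            chain k (i.removeNth (Function.update x j ⁅x i, x j⁆)) m) := by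
  rw [d, chain]
  erw [TensorProduct.lift.tmul]
  rw [exteriorPower.alternatingMapLinearEquiv_apply_ιMulti]
  rfl

/-! ### The differential squares to zero -/

/-- The action of `x ∈ L` on `⋀ L ⊗ M`. -/
def theta (ρ : L →ₗ⁅k⁆ Module.End k M) (x : L) :
    ExteriorAlgebra k L ⊗[k] M →ₗ[k] ExteriorAlgebra k L ⊗[k] M :=
  ((adExt k).flip x).rTensor M + (ρ x).lTensor _

lemma theta_tmul (ρ : L →ₗ⁅k⁆ Module.End k M) (x : L) (ω : ExteriorAlgebra k L) (m : M) :
    theta ρ x (ω ⊗ₜ m) = adExt k ω x ⊗ₜ m + ω ⊗ₜ ρ x m := rfl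

lemma theta_wedge (ρ : L →ₗ⁅k⁆ Module.End k M) (x y : L) (c : ExteriorAlgebra k L ⊗[k] M) :
    theta ρ x (wedge y c) = wedge ⁅x, y⁆ c + wedge y (theta ρ x c) := by
  induction c with
  | zero => simp
  | tmul a b => simp [theta_tmul, adExt_ι_mul, TensorProduct.add_tmul, add_assoc]
  | add a b ha hb => simp only [map_add, ha, hb]; abel

/-- An element of `⋀ L ⊗ M` is a sum of terms `x₁ ∧ ⋯ ∧ xₚ ⊗ m`. -/
lemma wedge_induction {P : ExteriorAlgebra k L ⊗[k] M → Prop} (c : ExteriorAlgebra k L ⊗[k] M)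
    (one : ∀ m, P (1 ⊗ₜ m)) (add : ∀ a b, P a → P b → P (a + b))
    (wedge : ∀ x a, P a → P (wedge x a)) : P c := by
  induction c with
  | zero => simpa using one 0
  | add a b ha hb => exact add a b ha hb
  | tmul ω m =>
    induction ω using CliffordAlgebra.left_induction with
    | algebraMap r =>
      rw [Algebra.algebraMap_eq_smul_one, TensorProduct.smul_tmul]
      exact one _
    | add x y hx hy => rw [TensorProduct.add_tmul]; exact add _ _ hx hy
    | ι_mul x y hx => exact wedge y _ hx

lemma theta_lie (ρ : L →ₗ⁅k⁆ Module.End k M) (x y : L) (c : ExteriorAlgebra k L ⊗[k] M) :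
    theta ρ ⁅x, y⁆ c = theta ρ x (theta ρ y c) - theta ρ y (theta ρ x c) := by
  induction c using wedge_induction with
  | one m => simp [theta_tmul, adExt_one, Ring.lie_def, TensorProduct.tmul_sub]
  | add a b ha hb => simp only [map_add, ha, hb]; abel
  | wedge z a ha =>
    simp only [theta_wedge, map_add, ha, map_sub]
    have : wedge ⁅⁅x, y⁆, z⁆ a = wedge ⁅x, ⁅y, z⁆⁆ a - wedge ⁅y, ⁅x, z⁆⁆ a := by
      rw [lie_lie, eq_sub_iff_add_eq, ← wedge_add]; simp
    rw [this]; abel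

/-- The differential as a map on all of `⋀ L ⊗ M`. -/
def totalD (ρ : L →ₗ⁅k⁆ Module.End k M) :
    ExteriorAlgebra k L ⊗[k] M →ₗ[k] ExteriorAlgebra k L ⊗[k] M :=
  TensorProduct.lift (total ρ)

lemma totalD_one_tmul (ρ : L →ₗ⁅k⁆ Module.End k M) (m : M) : totalD ρ (1 ⊗ₜ m) = 0 := by
  simp [totalD, total_one]

lemma totalD_wedge (ρ : L →ₗ⁅k⁆ Module.End k M) (x : L) (c : ExteriorAlgebra k L ⊗[k] M) :
    totalD ρ (wedge x c) = theta ρ x c - wedge x (totalD ρ c) := by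
  induction c with
  | zero => simp
  | tmul a b => simp [totalD, theta_tmul, total_ι_mul]
  | add a b ha hb => simp only [map_add, ha, hb]; abel

lemma totalD_theta (ρ : L →ₗ⁅k⁆ Module.End k M) (x : L) (c : ExteriorAlgebra k L ⊗[k] M) :
    totalD ρ (theta ρ x c) = theta ρ x (totalD ρ c) := by
  induction c using wedge_induction with
  | one m => simp [theta_tmul, adExt_one, totalD_one_tmul]
  | add a b ha hb => simp only [map_add, ha, hb]
  | wedge z a ha =>
    simp only [theta_wedge, map_add, totalD_wedge, ha, map_sub, theta_lie]; abel

lemma totalD_totalD (ρ : L →ₗ⁅k⁆ Module.End k M) (c : ExteriorAlgebra k L ⊗[k] M) :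
    totalD ρ (totalD ρ c) = 0 := by
  induction c using wedge_induction with
  | one m => simp [totalD_one_tmul]
  | add a b ha hb => simp only [map_add, ha, hb, add_zero]
  | wedge z a ha => simp only [totalD_wedge, map_sub, ha, totalD_theta]; simp

lemma incl_d (ρ : L →ₗ⁅k⁆ Module.End k M) (p : ℕ) (c : Chains k L M (p + 1)) :
    incl k L M p (d ρ p c) =
      totalD ρ (incl k L M (p + 1) c) := by
  suffices h : incl k L M p ∘ₗ d ρ p = totalD ρ ∘ₗ incl k L M (p + 1) from LinearMap.congr_fun h c
  refine TensorProduct.ext (exteriorPower.linearMap_ext (N := M →ₗ[k] ExteriorAlgebra k L ⊗[k] M) ?_)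
  ext x m
  change incl k L M p (d ρ p (chain k x m)) = totalD ρ (incl k L M (p + 1) (chain k x m))
  rw [incl_chain, d_chain]
  exact (total_ιMulti ρ x m).symm

theorem d_d (ρ : L →ₗ⁅k⁆ Module.End k M) (p : ℕ) (c : Chains k L M (p + 2)) :
    d ρ p (d ρ (p + 1) c) = 0 :=
  incl_injective p <| by rw [incl_d, incl_d, totalD_totalD, map_zero]

/-- The cycles of degree `p`. -/
def cycles (ρ : L →ₗ⁅k⁆ Module.End k M) : (p : ℕ) → Submodule k (Chains k L M p)
  | 0 => ⊤
  | p + 1 => LinearMap.ker (d ρ p)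

/-- The boundaries of degree `p`. -/
def boundaries (ρ : L →ₗ⁅k⁆ Module.End k M) (p : ℕ) : Submodule k (Chains k L M p) :=
  LinearMap.range (d ρ p)

/-- The Lie algebra homology `H_p(L; M)`, as the homology of the Chevalley–Eilenberg complex. -/
abbrev Homology (ρ : L →ₗ⁅k⁆ Module.End k M) (p : ℕ) : Type _ :=
  cycles ρ p ⧸ (boundaries ρ p).submoduleOf (cycles ρ p)

end ChevalleyEilenberg

namespace PolyVectorField

open MvPolynomial

section VectorFields

variable (k : Type*) [Field k] (n : ℕ)

/-- The Lie algebra `W_n^pol` of polynomial vector fields `∑ fᵢ ∂ᵢ` on `n`-space, as the derivations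
of `k[x₁, …, xₙ]`; the coefficient `fᵢ` of `D` is `D xᵢ`. -/
abbrev W : Type _ := Derivation k (MvPolynomial (Fin n) k) (MvPolynomial (Fin n) k)

/-- The vector fields whose coefficients are homogeneous of degree `j`, that is `Sʲ V ⊗ V*`.
They have degree `j - 1` as vector fields. -/
def homogeneousFields (j : ℕ) : Submodule k (W k n) where
  carrier := {D | ∀ i, (D (X i)).IsHomogeneous j}
  add_mem' ha hb i := (ha i).add (hb i)
  zero_mem' _ := isHomogeneous_zero _ _ _
  smul_mem' c _ hD i := (homogeneousSubmodule (Fin n) k j).smul_mem c (hD i)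

variable {k n} in
/-- A Lie subalgebra of `W_n^pol` is graded if it is spanned by homogeneous vector fields. -/
def IsGradedSubalgebra (g : LieSubalgebra k (W k n)) : Prop :=
  g.toSubmodule ≤ ⨆ j : ℕ, g.toSubmodule ⊓ homogeneousFields k n j

variable {k n} in
lemma sum_apply {ι : Type*} (s : Finset ι) (D : ι → W k n) (f : MvPolynomial (Fin n) k) :
    (∑ i ∈ s, D i) f = ∑ i ∈ s, D i f := by
  induction s using Finset.cons_induction with
  | empty => simp
  | cons a s ha ih => rw [Finset.sum_cons, Finset.sum_cons, Derivation.add_apply, ih]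

variable {k n} in
lemma apply_eq_sum (D : W k n) (f : MvPolynomial (Fin n) k) :
    D f = ∑ i, D (X i) * pderiv i f := by
  have h : D = ∑ i, D (X i) • (pderiv i : W k n) := by
    refine MvPolynomial.derivation_ext fun j => ?_
    rw [sum_apply, Finset.sum_eq_single j]
    · simp
    · intro i _ hij; simp [pderiv_X_of_ne hij.symm]
    · simp
  conv_lhs => rw [h, sum_apply]
  rfl

/-- The Lie subalgebra `L_d = ⨁_{j ≥ d} Sʲ V ⊗ V*` of the vector fields whose coefficients have only
terms of degree at least `d`, that is lie in `(x₁, …, xₙ)ᵈ`. -/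
def fieldsOfOrder (d : ℕ) : LieSubalgebra k (W k n) where
  carrier := {D | ∀ i, D (X i) ∈ idealOfVars (Fin n) k ^ d}
  add_mem' ha hb i := Ideal.add_mem _ (ha i) (hb i)
  zero_mem' _ := Ideal.zero_mem _
  smul_mem' c _ hD i := Submodule.smul_of_tower_mem _ c (hD i)
  lie_mem' {D E} hD hE i := by
    have key : ∀ {D : W k n}, (∀ i, D (X i) ∈ idealOfVars (Fin n) k ^ d) →
        ∀ f, D f ∈ idealOfVars (Fin n) k ^ d := fun {D} hD f => by
      rw [apply_eq_sum]
      exact Ideal.sum_mem _ fun i _ => Ideal.mul_mem_right _ _ (hD i)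
    rw [Derivation.commutator_apply]
    exact Ideal.sub_mem _ (key hD _) (key hE _)

end VectorFields

section TensorFields

variable {k : Type*} [Field k] {n : ℕ} {V : Type*} [AddCommGroup V] [Module k V]

/-- `∑_{i,j} A_{ij} ⊗ σ (E_{ij})`, for a matrix `A` of polynomials. -/
def matrixMap (σ : Matrix (Fin n) (Fin n) k →ₗ⁅k⁆ Module.End k V)
    (A : Matrix (Fin n) (Fin n) (MvPolynomial (Fin n) k)) :
    Module.End k (MvPolynomial (Fin n) k ⊗[k] V) :=
  ∑ i, ∑ j, TensorProduct.map (LinearMap.mulLeft k (A i j)) (σ (Matrix.single i j 1))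

lemma matrixMap_tmul (σ : Matrix (Fin n) (Fin n) k →ₗ⁅k⁆ Module.End k V)
    (A : Matrix (Fin n) (Fin n) (MvPolynomial (Fin n) k)) (g : MvPolynomial (Fin n) k) (v : V) :
    matrixMap σ A (g ⊗ₜ v) = ∑ i, ∑ j, (A i j * g) ⊗ₜ σ (Matrix.single i j 1) v := by
  simp [matrixMap]

lemma lie_single_single (i j l m : Fin n) :
    (⁅Matrix.single i j (1 : k), Matrix.single l m (1 : k)⁆ : Matrix (Fin n) (Fin n) k) =
      (if j = l then Matrix.single i m 1 else 0) - (if m = i then Matrix.single l j 1 else 0) := by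
  rw [Ring.lie_def]
  split_ifs with h1 h2 h2 <;> simp [*]

lemma matrixMap_lie (σ : Matrix (Fin n) (Fin n) k →ₗ⁅k⁆ Module.End k V)
    (A B : Matrix (Fin n) (Fin n) (MvPolynomial (Fin n) k)) :
    matrixMap σ (A * B - B * A) = matrixMap σ A * matrixMap σ B - matrixMap σ B * matrixMap σ A := by
  refine TensorProduct.ext' fun g v => ?_
  have h1 : ∀ i j l m, σ (Matrix.single i j 1) (σ (Matrix.single l m 1) v) =
      σ (Matrix.single l m 1) (σ (Matrix.single i j 1) v) +
        ((if j = l then σ (Matrix.single i m 1) v else 0) -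
          (if m = i then σ (Matrix.single l j 1) v else 0)) := by
    intro i j l m
    have := LinearMap.congr_fun (σ.map_lie (Matrix.single i j 1) (Matrix.single l m 1)) v
    rw [lie_single_single, Ring.lie_def] at this
    rw [← sub_eq_iff_eq_add']
    refine Eq.trans (this.symm) ?_
    split_ifs <;> simp
  have hAB : matrixMap σ A (matrixMap σ B (g ⊗ₜ v)) = ∑ l, ∑ m, ∑ i, ∑ j,
      (A i j * (B l m * g)) ⊗ₜ[k] σ (Matrix.single i j 1) (σ (Matrix.single l m 1) v) := by
    simp only [matrixMap_tmul, map_sum]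
  have hBA : matrixMap σ B (matrixMap σ A (g ⊗ₜ v)) = ∑ l, ∑ m, ∑ i, ∑ j,
      (A i j * (B l m * g)) ⊗ₜ[k] σ (Matrix.single l m 1) (σ (Matrix.single i j 1) v) := by
    simp only [matrixMap_tmul, map_sum]
    simp_rw [← Finset.sum_product', Finset.univ_product_univ]
    refine Fintype.sum_equiv
      ⟨fun x => (x.2.2.1, x.2.2.2, x.1, x.2.1), fun x => (x.2.2.1, x.2.2.2, x.1, x.2.1),
        fun _ => rfl, fun _ => rfl⟩ _ _ fun x => ?_
    simp only [Equiv.coe_fn_mk]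
    rw [mul_left_comm]
  have h2 : ∑ l, ∑ m, ∑ i, ∑ j, (A i j * (B l m * g)) ⊗ₜ[k]
      (if j = l then σ (Matrix.single i m 1) v else 0) = matrixMap σ (A * B) (g ⊗ₜ v) := by
    have : ∀ l m, ∑ i, ∑ j, (A i j * (B l m * g)) ⊗ₜ[k]
      (if j = l then σ (Matrix.single i m 1) v else 0) =
        ∑ i, (A i l * (B l m * g)) ⊗ₜ[k] σ (Matrix.single i m 1) v := fun l m =>
      Finset.sum_congr rfl fun i _ => by
        rw [Finset.sum_eq_single l (fun j _ hj => by simp [hj]) (by simp), if_pos rfl]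
    simp_rw [this, matrixMap_tmul, Matrix.mul_apply, Finset.sum_mul, TensorProduct.sum_tmul]
    rw [Finset.sum_comm]
    simp_rw [Finset.sum_comm (s := Finset.univ) (t := Finset.univ) (f := fun l i =>
      (A i l * (B l _ * g)) ⊗ₜ[k] σ (Matrix.single i _ 1) v)]
    rw [Finset.sum_comm]
    simp only [mul_assoc]
  have h3 : ∑ l, ∑ m, ∑ i, ∑ j, (A i j * (B l m * g)) ⊗ₜ[k]
      (if m = i then σ (Matrix.single l j 1) v else 0) = matrixMap σ (B * A) (g ⊗ₜ v) := by
    have : ∀ l m, ∑ i, ∑ j, (A i j * (B l m * g)) ⊗ₜ[k]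
      (if m = i then σ (Matrix.single l j 1) v else 0) =
        ∑ j, (B l m * (A m j * g)) ⊗ₜ[k] σ (Matrix.single l j 1) v := fun l m => by
      rw [Finset.sum_eq_single m (fun i _ hi => by simp [hi.symm]) (by simp)]
      simp only [if_true, mul_left_comm]
    simp_rw [this, matrixMap_tmul, Matrix.mul_apply, Finset.sum_mul, TensorProduct.sum_tmul]
    refine Finset.sum_congr rfl fun l _ => ?_
    rw [Finset.sum_comm]
    simp only [mul_assoc]
  have hsub : matrixMap σ (A * B - B * A) (g ⊗ₜ v) =
      matrixMap σ (A * B) (g ⊗ₜ v) - matrixMap σ (B * A) (g ⊗ₜ v) := by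
    simp [matrixMap_tmul, sub_mul, TensorProduct.sub_tmul, Finset.sum_sub_distrib]
  change matrixMap σ (A * B - B * A) (g ⊗ₜ v) =
    matrixMap σ A (matrixMap σ B (g ⊗ₜ v)) - matrixMap σ B (matrixMap σ A (g ⊗ₜ v))
  rw [hsub, hAB, hBA, ← h2, ← h3]
  simp only [← Finset.sum_sub_distrib]
  refine Finset.sum_congr rfl fun l _ => Finset.sum_congr rfl fun m _ =>
    Finset.sum_congr rfl fun i _ => Finset.sum_congr rfl fun j _ => ?_
  rw [h1, TensorProduct.tmul_add, TensorProduct.tmul_sub, add_sub_cancel_left]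

/-- The action of `D = ∑ fⱼ ∂ⱼ` on the tensor fields `k[x₁, …, xₙ] ⊗ V`, for a representation `σ` of
`gl_n` on `V`, as a linear map:
`D (g ⊗ v) = D g ⊗ v + ∑_{i,j} (∂ᵢ fⱼ) g ⊗ E_{ij} v`. -/
def tensorFieldMap (σ : Matrix (Fin n) (Fin n) k →ₗ⁅k⁆ Module.End k V) (D : W k n) :
    Module.End k (MvPolynomial (Fin n) k ⊗[k] V) :=
  (D : MvPolynomial (Fin n) k →ₗ[k] MvPolynomial (Fin n) k).rTensor V +
    ∑ i, ∑ j, TensorProduct.map (LinearMap.mulLeft k (pderiv i (D (X j))))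
      (σ (Matrix.single i j 1))

lemma tensorFieldMap_tmul (σ : Matrix (Fin n) (Fin n) k →ₗ⁅k⁆ Module.End k V) (D : W k n)
    (g : MvPolynomial (Fin n) k) (v : V) :
    tensorFieldMap σ D (g ⊗ₜ v) = D g ⊗ₜ v +
      ∑ i, ∑ j, (pderiv i (D (X j)) * g) ⊗ₜ σ (Matrix.single i j 1) v := by
  simp [tensorFieldMap]

lemma pderiv_apply (D : W k n) (i : Fin n) (f : MvPolynomial (Fin n) k) :
    pderiv i (D f) = D (pderiv i f) + ∑ j, pderiv i (D (X j)) * pderiv j f := by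
  have h := apply_eq_sum ⁅(pderiv i : W k n), D⁆ f
  simp only [Derivation.commutator_apply] at h
  rw [sub_eq_iff_eq_add'] at h
  rw [h]
  congr 1
  refine Finset.sum_congr rfl fun j _ => ?_
  have : D (pderiv i (X j)) = 0 := by
    rw [pderiv_X, Pi.single_apply]; split_ifs <;> simp
  rw [this, sub_zero]

lemma rTensor_matrixMap (σ : Matrix (Fin n) (Fin n) k →ₗ⁅k⁆ Module.End k V) (D : W k n)
    (A : Matrix (Fin n) (Fin n) (MvPolynomial (Fin n) k)) (g : MvPolynomial (Fin n) k) (v : V) :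
    (D : MvPolynomial (Fin n) k →ₗ[k] MvPolynomial (Fin n) k).rTensor V (matrixMap σ A (g ⊗ₜ v)) =
      matrixMap σ A (D g ⊗ₜ v) + matrixMap σ (A.map D) (g ⊗ₜ v) := by
  rw [matrixMap_tmul, matrixMap_tmul, matrixMap_tmul, map_sum, ← Finset.sum_add_distrib]
  refine Finset.sum_congr rfl fun i _ => ?_
  rw [map_sum, ← Finset.sum_add_distrib]
  refine Finset.sum_congr rfl fun j _ => ?_
  rw [← TensorProduct.add_tmul, LinearMap.rTensor_tmul, Derivation.coeFn_coe, Derivation.leibniz,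
    smul_eq_mul, smul_eq_mul, Matrix.map_apply, mul_comm g]

lemma tensorFieldMap_lie (σ : Matrix (Fin n) (Fin n) k →ₗ⁅k⁆ Module.End k V) (D E : W k n) :
    tensorFieldMap σ ⁅D, E⁆ = ⁅tensorFieldMap σ D, tensorFieldMap σ E⁆ := by
  let J : W k n → Matrix (Fin n) (Fin n) (MvPolynomial (Fin n) k) :=
    fun D => .of fun i j => pderiv i (D (X j))
  have hJ : J ⁅D, E⁆ = (J E).map D - (J D).map E + (J D * J E - J E * J D) := by
    ext i j : 1
    simp only [J, Matrix.of_apply, Matrix.add_apply, Matrix.sub_apply, Matrix.map_apply,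
      Matrix.mul_apply]
    rw [Derivation.commutator_apply, map_sub, pderiv_apply D i (E (X j)),
      pderiv_apply E i (D (X j))]
    abel
  have hadd : ∀ A B, matrixMap σ (A + B) = matrixMap σ A + matrixMap σ B := by
    intro A B; ext g v
    simp [matrixMap_tmul, add_mul, TensorProduct.add_tmul, Finset.sum_add_distrib]
  have hsub : ∀ A B, matrixMap σ (A - B) = matrixMap σ A - matrixMap σ B := by
    intro A B; ext g v
    simp [matrixMap_tmul, sub_mul, TensorProduct.sub_tmul, Finset.sum_sub_distrib]
  have hD : ∀ D, tensorFieldMap σ D =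
      (D : MvPolynomial (Fin n) k →ₗ[k] MvPolynomial (Fin n) k).rTensor V + matrixMap σ (J D) :=
    fun D => rfl
  change tensorFieldMap σ ⁅D, E⁆ = tensorFieldMap σ D * tensorFieldMap σ E -
    tensorFieldMap σ E * tensorFieldMap σ D
  rw [hD ⁅D, E⁆, hJ, hadd, hsub, matrixMap_lie, hD D, hD E]
  refine TensorProduct.ext' fun g v => ?_
  simp only [LinearMap.add_apply, LinearMap.sub_apply, Module.End.mul_apply, map_add,
    rTensor_matrixMap, LinearMap.rTensor_tmul, Derivation.coeFn_coe, Derivation.commutator_apply,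
    TensorProduct.sub_tmul]
  abel

/-- The `W_n^pol`-module `k[x₁, …, xₙ] ⊗ V` of polynomial tensor fields of type `V`. -/
def tensorFieldRep (σ : Matrix (Fin n) (Fin n) k →ₗ⁅k⁆ Module.End k V) :
    W k n →ₗ⁅k⁆ Module.End k (MvPolynomial (Fin n) k ⊗[k] V) where
  toFun := tensorFieldMap σ
  map_add' D E := by
    ext g v
    simp [tensorFieldMap_tmul, TensorProduct.add_tmul, add_mul, Finset.sum_add_distrib]
    abel
  map_smul' c D := by
    ext g v
    simp [tensorFieldMap_tmul, TensorProduct.smul_tmul', Finset.smul_sum]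
  map_lie' := tensorFieldMap_lie σ _ _

end TensorFields

section TensorProducts

variable {k L : Type*} [Field k] [LieRing L] [LieAlgebra k L] {ι : Type*} [DecidableEq ι]
  {T : ι → Type*} [∀ i, AddCommGroup (T i)] [∀ i, Module k (T i)]

/-- `1 ⊗ ⋯ ⊗ f ⊗ ⋯ ⊗ 1`, with `f` at the place `i`. -/
def actAt (i : ι) (f : Module.End k (T i)) : Module.End k (⨂[k] i, T i) :=
  PiTensorProduct.map (Function.update (fun j => (1 : Module.End k (T j))) i f)

lemma actAt_mul (i : ι) (f g : Module.End k (T i)) :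
    actAt i f * actAt i g = actAt i (f * g) := by
  rw [actAt, actAt, actAt, ← PiTensorProduct.map_mul]
  congr 1; ext j : 1
  by_cases h : j = i
  · subst h; simp
  · simp [h]

lemma actAt_comm {i j : ι} (hij : i ≠ j) (f : Module.End k (T i)) (g : Module.End k (T j)) :
    actAt i f * actAt j g = actAt j g * actAt i f := by
  rw [actAt, actAt, ← PiTensorProduct.map_mul, ← PiTensorProduct.map_mul]
  congr 1; ext l : 1
  by_cases h : l = i
  · subst h; simp [hij]
  · simp [h]

/-- The tensor product of representations of a Lie algebra: `x` acts as
`∑ᵢ 1 ⊗ ⋯ ⊗ x ⊗ ⋯ ⊗ 1`, with `x` at the place `i`. -/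
def tensorRep [Fintype ι] (τ : ∀ i, L →ₗ⁅k⁆ Module.End k (T i)) :
    L →ₗ⁅k⁆ Module.End k (⨂[k] i, T i) where
  toFun x := ∑ i, actAt i (τ i x)
  map_add' x y := by
    simp only [actAt, map_add, PiTensorProduct.map_update_add, Finset.sum_add_distrib]
  map_smul' c x := by
    simp only [actAt, map_smul, PiTensorProduct.map_update_smul, Finset.smul_sum, RingHom.id_apply]
  map_lie' {x y} := by
    have hsub (i : ι) (f g : Module.End k (T i)) : actAt i (f - g) = actAt i f - actAt i g := by
      rw [eq_sub_iff_add_eq, actAt, actAt, actAt, ← PiTensorProduct.map_update_add, sub_add_cancel]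
    simp only [LieHom.map_lie, Ring.lie_def, hsub, ← actAt_mul, Finset.sum_mul_sum]
    rw [Finset.sum_comm (f := fun i j => actAt i (τ i y) * actAt j (τ j x)),
      ← Finset.sum_sub_distrib]
    refine Finset.sum_congr rfl fun i _ => ?_
    rw [← Finset.sum_sub_distrib, Finset.sum_eq_single i]
    · intro j _ hji; rw [actAt_comm hji, sub_self]
    · simp

end TensorProducts

section CategoryO

variable (k : Type*) [Field k] (n : ℕ)

/-- A finite-dimensional irreducible representation of `gl_n`, on a space `k^dim`. -/
structure GlIrrep where
  dim : ℕ
  rep : Matrix (Fin n) (Fin n) k →ₗ⁅k⁆ Module.End k (Fin dim → k)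
  dim_pos : 0 < dim
  irreducible : ∀ S : Submodule k (Fin dim → k),
    (∀ A, ∀ v ∈ S, rep A v ∈ S) → S = ⊥ ∨ S = ⊤

variable {k n}

/-- The space `k[x₁, …, xₙ] ⊗ V` of the module of tensor fields `𝒯_V`. -/
def TensorField (V : GlIrrep k n) : Type _ := MvPolynomial (Fin n) k ⊗[k] (Fin V.dim → k)

instance (V : GlIrrep k n) : AddCommGroup (TensorField V) :=
  inferInstanceAs (AddCommGroup (MvPolynomial (Fin n) k ⊗[k] (Fin V.dim → k)))

instance (V : GlIrrep k n) : Module k (TensorField V) :=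
  inferInstanceAs (Module k (MvPolynomial (Fin n) k ⊗[k] (Fin V.dim → k)))

/-- The action of `W_n^pol` on `𝒯_V`. -/
def TensorField.rep (V : GlIrrep k n) : W k n →ₗ⁅k⁆ Module.End k (TensorField V) :=
  tensorFieldRep V.rep

/-- The tensor fields with homogeneous polynomial coefficients of degree `e`. -/
def TensorField.grade (V : GlIrrep k n) (e : ℕ) : Submodule k (TensorField V) :=
  Submodule.span k {t | ∃ g : MvPolynomial (Fin n) k, ∃ v, g.IsHomogeneous e ∧ t = g ⊗ₜ[k] v}

/-- The tensor product `𝒯_{V 1} ⊗ ⋯ ⊗ 𝒯_{V r}`. -/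
def TensorProd {r : ℕ} (V : Fin r → GlIrrep k n) : Type _ := ⨂[k] i, TensorField (V i)

instance {r : ℕ} (V : Fin r → GlIrrep k n) : AddCommGroup (TensorProd V) :=
  inferInstanceAs (AddCommGroup (⨂[k] i, TensorField (V i)))

instance {r : ℕ} (V : Fin r → GlIrrep k n) : Module k (TensorProd V) :=
  inferInstanceAs (Module k (⨂[k] i, TensorField (V i)))

/-- The elements of degree `e ∈ ℤ` of a tensor product of modules of tensor fields, for the sum of
the polynomial degrees of the factors. -/
def TensorProd.grade {r : ℕ} (V : Fin r → GlIrrep k n) (e : ℤ) : Submodule k (TensorProd V) :=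
  Submodule.span k {t | ∃ (a : Fin r → ℕ) (x : ∀ i, TensorField (V i)),
    (∀ i, x i ∈ TensorField.grade (V i) (a i)) ∧ ((∑ i, a i : ℕ) : ℤ) = e ∧
      t = PiTensorProduct.tprod k x}

/-- The action of `W_n^pol` on `𝒯_{V 1} ⊗ ⋯ ⊗ 𝒯_{V r}`. -/
def TensorProd.rep {r : ℕ} (V : Fin r → GlIrrep k n) :
    W k n →ₗ⁅k⁆ Module.End k (TensorProd V) :=
  tensorRep fun i => TensorField.rep (V i)

variable (k n) in
/-- The data of a finite direct sum of finite tensor products of modules of tensor fields, the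
grading of each summand being shifted by an integer. -/
structure SumOfTensorProds where
  size : ℕ
  length : Fin size → ℕ
  factor : ∀ s, Fin (length s) → GlIrrep k n
  shift : Fin size → ℤ

namespace SumOfTensorProds

/-- The underlying space of the (finite) direct sum. -/
abbrev Space (T : SumOfTensorProds k n) : Type _ := ∀ s, TensorProd (T.factor s)

/-- The elements of degree `e` of the direct sum. -/
def grade (T : SumOfTensorProds k n) (e : ℤ) : Submodule k T.Space :=
  Submodule.pi Set.univ fun s => TensorProd.grade (T.factor s) (e - T.shift s)

/-- The action of a vector field on the direct sum. -/
def act (T : SumOfTensorProds k n) (D : W k n) : Module.End k T.Space :=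
  LinearMap.pi fun s => TensorProd.rep (T.factor s) D ∘ₗ LinearMap.proj s

end SumOfTensorProds

variable {M : Type*} [AddCommGroup M] [Module k M]

/-- The category `𝒪_d^pol` of `L_d`-modules: `M` is finitely generated, graded, and is the image
under a homomorphism of graded `L_d`-modules of a graded `L_d`-submodule `A` of a finite direct sum
of (shifted) finite tensor products of modules of tensor fields. -/
structure IsInCategoryO (d : ℕ) (ρ : fieldsOfOrder k n d →ₗ⁅k⁆ Module.End k M) : Prop where
  finitely_generated : ∃ S : Finset M, ∀ N : Submodule k M,
    (∀ D, ∀ m ∈ N, ρ D m ∈ N) → (S : Set M) ⊆ N → N = ⊤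
  graded_subquotient : ∃ 𝓜 : ℤ → Submodule k M, DirectSum.IsInternal 𝓜 ∧
    (∀ (j : ℕ) (D : fieldsOfOrder k n d), (D : W k n) ∈ homogeneousFields k n j →
      ∀ e, ∀ m ∈ 𝓜 e, ρ D m ∈ 𝓜 (e + (j - 1))) ∧
    ∃ (T : SumOfTensorProds k n) (A : Submodule k T.Space)
      (hA : ∀ (D : fieldsOfOrder k n d), ∀ a ∈ A, T.act D a ∈ A) (φ : A →ₗ[k] M),
      A ≤ ⨆ e : ℤ, A ⊓ T.grade e ∧
      Function.Surjective φ ∧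
      (∀ (e : ℤ) (a : A), (a : T.Space) ∈ T.grade e → φ a ∈ 𝓜 e) ∧
      ∀ (D : fieldsOfOrder k n d) (a : A), φ ⟨T.act D a, hA D a a.2⟩ = ρ D (φ a)

end CategoryO

end PolyVectorField

end

/-! Cartan's formula `totalD_wedge` says that the action of `x ∈ 𝔤` on chains is the anticommutator
of the differential with `x ∧ ·`. Hence `𝔤` maps cycles to boundaries. If the chains are noetherian
under the action of some family of elements of `𝔤`, then the cycles are generated under this family
by finitely many cycles, and the classes of these cycles span the homology
(`finiteDimensional_homology`). The family used is `x ^ β E` with `E` the Euler field and `|β| ≥ e`.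
For large `e` these fields lie in `𝔤`, because a graded subalgebra of finite codimension contains
all homogeneous fields of large degree.

The `p`-chains are a subquotient of `W ⊗ ⋯ ⊗ W ⊗ M`, and `W` is itself a module of tensor fields
(for the dual of the standard representation). Everything thus reduces to the module `k[(𝔸ⁿ)ʳ] ⊗ V`,
where `V` is finite-dimensional with `r` commuting actions of `gl_n` (`noeth_modelAct`).

The heart is the scalar case `noeth_act`. There `T` is a finitely generated module over the
coordinate ring of `r` points of `𝔸ⁿ`, with Euler operators `E i`, and `x ^ β E` acts as `∑ᵢ xᵢ ^ β
(E i + λᵢ |β|)`. A polynomial `F` on `(𝔸ⁿ)ʳ` encodes a combination of `r`-fold products of such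
operators. Expanding gives a sum over all maps from the `r` factors to the `r` points. If `F` is
symmetric and vanishes to high order wherever a linear form `ℓ` takes equal values at two points,
only the permutations survive, and the result is multiplication by `F` up to Euler eigenvalues
(`eulProd_smul_mem`). Composing two such operators and comparing leading coefficients in an exponent
removes most of the eigenvalues (`sum_smul_mem_of_act_mem`), and a differential operator argument
removes the rest. So, for each element of a stable subspace, its multiples by all symmetric
polynomials times a suitable power of `f_ℓ = ∏ ℓ(xᵢ) ∏ (ℓ(xᵢ) - ℓ(xⱼ))` lie in this subspace
(`exists_sepPoly_pow_smul_mem`).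

The common zeros of all the `f_ℓ` are the configurations with a point at the origin or with two
equal points. Since symmetric polynomials form a noetherian ring, the Artin–Rees lemma reduces the
claim to the quotients of `T` by powers of the ideals of these loci (`noeth_act_of_relNoeth_locus`).
Powers are reduced to first powers by a filtration (`relNoeth_locus_pow`), and on a locus there is
one point fewer, so induction on `r` applies (`relNoeth_locus`).

For general `V`, put `A_a = ∑_b x_b E_ab` at each point. The relation `[A_a, A_b] = x_b A_a - x_a
A_b` makes the right-hand side nilpotent, and over an algebraically closed field the only
eigenvalues of `A_a` are scalar multiples of `x_a`. A finite dévissage then leads to subquotients on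
which `A_a = λ x_a`, which is the scalar case (`IsFieldOps.noeth_fullAct`). Noetherianity descends
from the algebraic closure to `k` (`Noeth.descend`). -/

/-! ### Subspaces stable under a family of operators -/

namespace StableNoetherian

variable {I K : Type*} [Field K] {T : Type*} [AddCommGroup T] [Module K T]
  {T' : Type*} [AddCommGroup T'] [Module K T'] {T'' : Type*} [AddCommGroup T''] [Module K T'']

/-- `N` is stable under all the operators `ρ i`. -/
def Stable (ρ : I → Module.End K T) (N : Submodule K T) : Prop := ∀ i, ∀ t ∈ N, ρ i t ∈ N

/-- The smallest stable subspace that contains `S`. -/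
def gen (ρ : I → Module.End K T) (S : Set T) : Submodule K T :=
  sInf {N | Stable ρ N ∧ S ⊆ N}

/-- Every stable subspace between `A` and `B` is finitely generated modulo `A`. -/
def RelNoeth (ρ : I → Module.End K T) (A B : Submodule K T) : Prop :=
  ∀ N, Stable ρ N → N ≤ B → ∃ S : Finset T, (S : Set T) ⊆ N ∧ N ≤ A ⊔ gen ρ S

/-- Every stable subspace is finitely generated. -/
def Noeth (ρ : I → Module.End K T) : Prop := RelNoeth ρ ⊥ ⊤

variable {ρ : I → Module.End K T} {ρ' : I → Module.End K T'}

lemma stable_gen (S : Set T) : Stable ρ (gen ρ S) := by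
  intro i t ht
  simp only [gen, Submodule.mem_sInf] at ht ⊢
  exact fun N hN => hN.1 i t (ht N hN)

lemma subset_gen (S : Set T) : S ⊆ gen ρ S := by
  intro t ht
  simp only [gen, SetLike.mem_coe, Submodule.mem_sInf]
  exact fun N hN => hN.2 ht

lemma gen_le {S : Set T} {N : Submodule K T} (hN : Stable ρ N) (h : S ⊆ N) : gen ρ S ≤ N :=
  sInf_le ⟨hN, h⟩

lemma gen_mono {S S' : Set T} (h : S ⊆ S') : gen ρ S ≤ gen ρ S' :=
  gen_le (stable_gen _) (h.trans (subset_gen _))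

lemma Stable.sup {A B : Submodule K T} (hA : Stable ρ A) (hB : Stable ρ B) : Stable ρ (A ⊔ B) := by
  intro i t ht
  obtain ⟨a, ha, b, hb, rfl⟩ := Submodule.mem_sup.1 ht
  rw [map_add]
  exact Submodule.add_mem_sup (hA i a ha) (hB i b hb)

lemma Stable.inf {A B : Submodule K T} (hA : Stable ρ A) (hB : Stable ρ B) : Stable ρ (A ⊓ B) :=
  fun i t ht => ⟨hA i t ht.1, hB i t ht.2⟩

lemma stable_bot : Stable ρ ⊥ := fun i t ht => by
  rw [Submodule.mem_bot] at ht ⊢; rw [ht, map_zero]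

lemma Stable.map {A : Submodule K T} (hA : Stable ρ A) {φ : T →ₗ[K] T'}
    (hφ : ∀ i t, φ (ρ i t) = ρ' i (φ t)) : Stable ρ' (A.map φ) := by
  rintro i _ ⟨t, ht, rfl⟩
  exact ⟨ρ i t, hA i t ht, hφ i t⟩

lemma Stable.comap {A : Submodule K T'} (hA : Stable ρ' A) {φ : T →ₗ[K] T'}
    (hφ : ∀ i t, φ (ρ i t) = ρ' i (φ t)) : Stable ρ (A.comap φ) := by
  intro i t ht
  rw [Submodule.mem_comap] at ht ⊢
  rw [hφ]
  exact hA i _ ht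

lemma RelNoeth.mono {A A' B B' : Submodule K T} (h : RelNoeth ρ A B) (hA : A ≤ A') (hB : B' ≤ B) :
    RelNoeth ρ A' B' := by
  intro N hN h2
  obtain ⟨S, hS, hN'⟩ := h N hN (h2.trans hB)
  exact ⟨S, hS, hN'.trans (sup_le_sup_right hA _)⟩

lemma relNoeth_self (A : Submodule K T) : RelNoeth ρ A A :=
  fun _ _ h => ⟨∅, by simp, h.trans le_sup_left⟩

/-- This is the modular law, as `gen ρ S` lies in `N`. -/
lemma le_inf_sup_gen {A N : Submodule K T} {S : Set T} (hN : Stable ρ N) (hS : S ⊆ N)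
    (h : N ≤ A ⊔ gen ρ S) : N ≤ (N ⊓ A) ⊔ gen ρ S := by
  have h2 : gen ρ S ≤ N := gen_le hN hS
  intro t ht
  obtain ⟨a, ha, b, hb, rfl⟩ := Submodule.mem_sup.1 (h ht)
  exact Submodule.add_mem_sup ⟨(Submodule.add_mem_iff_left _ (h2 hb)).1 ht, ha⟩ hb

lemma gen_union [DecidableEq T] (S S' : Finset T) :
    gen ρ (S : Set T) ⊔ gen ρ (S' : Set T) ≤ gen ρ ((S ∪ S' : Finset T) : Set T) :=
  sup_le (gen_mono (by simp)) (gen_mono (by simp))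

lemma RelNoeth.trans {A B C : Submodule K T} (h1 : RelNoeth ρ A B) (h2 : RelNoeth ρ B C)
    (hB : Stable ρ B) : RelNoeth ρ A C := by
  classical
  intro N hN hNC
  obtain ⟨S, hS, h⟩ := h2 N hN hNC
  obtain ⟨S', hS', h'⟩ := h1 (N ⊓ B) (hN.inf hB) inf_le_right
  refine ⟨S' ∪ S, ?_, (le_inf_sup_gen hN hS h).trans ?_⟩
  · rw [Finset.coe_union]
    exact Set.union_subset (hS'.trans inf_le_left) hS
  · refine sup_le (h'.trans ?_) ?_
    · exact sup_le_sup_left (gen_mono (by simp)) _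
    · exact (gen_mono (by simp)).trans le_sup_right

/-- Generators of `N` modulo `A` leave the remainder `N ⊓ A`, and generators of this remainder
modulo `B` complete them. -/
lemma RelNoeth.inf {A B C : Submodule K T} (h1 : RelNoeth ρ A C) (h2 : RelNoeth ρ B C)
    (hA : Stable ρ A) : RelNoeth ρ (A ⊓ B) C := by
  classical
  intro N hN hNC
  obtain ⟨S, hS, h⟩ := h1 N hN hNC
  obtain ⟨S', hS', h'⟩ := h2 (N ⊓ A) (hN.inf hA) (inf_le_left.trans hNC)
  refine ⟨S' ∪ S, ?_, (le_inf_sup_gen hN hS h).trans ?_⟩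
  · rw [Finset.coe_union]
    exact Set.union_subset (hS'.trans inf_le_left) hS
  · refine sup_le ((le_inf_sup_gen (hN.inf hA) hS' h').trans ?_) ?_
    · exact sup_le_sup (inf_le_inf_right _ inf_le_right) (gen_mono (by simp))
    · exact (gen_mono (by simp)).trans le_sup_right

lemma relNoeth_finset_inf {κ : Type*} (s : Finset κ) (A : κ → Submodule K T)
    (hA : ∀ p ∈ s, Stable ρ (A p)) (h : ∀ p ∈ s, RelNoeth ρ (A p) ⊤) :
    RelNoeth ρ (s.inf A) ⊤ := by
  induction s using Finset.cons_induction with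
  | empty => exact relNoeth_self _
  | cons p s hp ih =>
    rw [Finset.inf_cons]
    exact (h p (by simp)).inf (ih (fun q hq => hA q (by simp [hq])) fun q hq => h q (by simp [hq]))
      (hA p (by simp))

/-- It suffices to test subspaces that contain `A`: generators of `A ⊔ N` can be corrected by
elements of `A` so as to lie in `N`. -/
lemma RelNoeth.of_ge {A B : Submodule K T} (hA : Stable ρ A) (hAB : A ≤ B)
    (h : ∀ N, Stable ρ N → A ≤ N → N ≤ B → ∃ S : Finset T, (S : Set T) ⊆ N ∧ N ≤ A ⊔ gen ρ S) :
    RelNoeth ρ A B := by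
  classical
  intro N hN hNB
  obtain ⟨S, hS, h'⟩ := h (A ⊔ N) (hA.sup hN) le_sup_left (sup_le hAB hNB)
  have h1 : ∀ s : T, ∃ t ∈ N, s ∈ S → s - t ∈ A := fun s => by
    by_cases hs : s ∈ S
    · obtain ⟨a, ha, b, hb, hab⟩ := Submodule.mem_sup.1 (hS hs)
      exact ⟨b, hb, fun _ => by rw [← hab]; simpa using ha⟩
    · exact ⟨0, N.zero_mem, fun h => absurd h hs⟩
  choose f hf hf' using h1
  refine ⟨S.image f, ?_, le_sup_right.trans (h'.trans ?_)⟩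
  · intro t ht
    obtain ⟨s, _, rfl⟩ := Finset.mem_image.1 (Finset.mem_coe.1 ht)
    exact hf s
  · refine sup_le le_sup_left (gen_le (hA.sup (stable_gen _)) fun s hs => ?_)
    rw [← sub_add_cancel s (f s)]
    exact Submodule.add_mem_sup (hf' s hs)
      (subset_gen _ (Finset.mem_coe.2 (Finset.mem_image_of_mem f hs)))

/-- The quotient `(A ⊔ range φ) / A` is an image of `T' / A'`. The map needs to be equivariant only
modulo `A`, which permits multiplication by a polynomial as `φ`. -/
lemma RelNoeth.sup_range {A' : Submodule K T'} {A : Submodule K T} (h : RelNoeth ρ' A' ⊤)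
    (φ : T' →ₗ[K] T) (hφ : ∀ i t, φ (ρ' i t) - ρ i (φ t) ∈ A) (hA : Stable ρ A)
    (hAA : A'.map φ ≤ A) : RelNoeth ρ A (A ⊔ LinearMap.range φ) := by
  classical
  refine RelNoeth.of_ge hA le_sup_left fun N hN hAN hNB => ?_
  have hst : Stable ρ' (N.comap φ) := fun i t ht => by
    rw [Submodule.mem_comap] at ht ⊢
    have := N.add_mem (hAN (hφ i t)) (hN i _ ht)
    simpa using this
  obtain ⟨S, hS, h'⟩ := h (N.comap φ) hst le_top
  refine ⟨S.image φ, ?_, ?_⟩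
  · intro t ht
    obtain ⟨s, hs, rfl⟩ := Finset.mem_image.1 (Finset.mem_coe.1 ht)
    exact hS hs
  · have hgen : gen ρ' (S : Set T') ≤ (A ⊔ gen ρ ((S.image φ : Finset T) : Set T)).comap φ := by
      refine gen_le (fun i t ht => ?_) fun s hs => ?_
      · rw [Submodule.mem_comap] at ht ⊢
        have := Submodule.add_mem _ (Submodule.mem_sup_left (hφ i t) :
          _ ∈ A ⊔ gen ρ ((S.image φ : Finset T) : Set T)) ((hA.sup (stable_gen _)) i _ ht)
        simpa using this
      · exact Submodule.mem_sup_right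
          (subset_gen _ (Finset.mem_coe.2 (Finset.mem_image_of_mem φ hs)))
    intro t ht
    obtain ⟨a, ha, _, ⟨b, rfl⟩, rfl⟩ := Submodule.mem_sup.1 (hNB ht)
    have hb : b ∈ N.comap φ := (Submodule.add_mem_iff_right _ (hAN ha)).1 ht
    obtain ⟨c, hc, e, he, rfl⟩ := Submodule.mem_sup.1 (h' hb)
    rw [map_add]
    refine Submodule.add_mem _ (Submodule.mem_sup_left ha) (Submodule.add_mem _ ?_ (hgen he))
    exact Submodule.mem_sup_left (hAA ⟨c, hc, rfl⟩)

lemma Noeth.of_surjective (h : Noeth ρ') (φ : T' →ₗ[K] T) (hφ : ∀ i t, φ (ρ' i t) = ρ i (φ t))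
    (hs : Function.Surjective φ) : Noeth ρ := by
  have := RelNoeth.sup_range (A := ⊥) (ρ := ρ) h φ (by simp [hφ]) stable_bot (by simp)
  rwa [LinearMap.range_eq_top.2 hs, sup_top_eq] at this

/-- The quotient of `T` by the preimage of `A'` embeds in `T' / A'`. -/
lemma RelNoeth.comap {A' : Submodule K T'} (h : RelNoeth ρ' A' ⊤) (φ : T →ₗ[K] T')
    (hφ : ∀ i t, φ (ρ i t) = ρ' i (φ t)) : RelNoeth ρ (A'.comap φ) ⊤ := by
  classical
  intro N hN _
  obtain ⟨S, hS, h'⟩ := h (N.map φ) (hN.map hφ) le_top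
  have h1 : ∀ s : T', ∃ t, s ∈ S → t ∈ N ∧ φ t = s := fun s => by
    by_cases hs : s ∈ S
    · obtain ⟨t, ht, hts⟩ := hS hs
      exact ⟨t, fun _ => ⟨ht, hts⟩⟩
    · exact ⟨0, fun h => absurd h hs⟩
  choose f hf using h1
  refine ⟨S.image f, ?_, fun t ht => ?_⟩
  · intro t ht
    obtain ⟨s, hs, rfl⟩ := Finset.mem_image.1 (Finset.mem_coe.1 ht)
    exact (hf s hs).1
  · have hgen : gen ρ' (S : Set T') ≤ (gen ρ ((S.image f : Finset T) : Set T)).map φ :=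
      gen_le ((stable_gen _).map hφ) fun s hs =>
        ⟨f s, subset_gen _ (Finset.mem_coe.2 (Finset.mem_image_of_mem f hs)), (hf s hs).2⟩
    obtain ⟨a, ha, b, hb, hab⟩ := Submodule.mem_sup.1 (h' ⟨t, ht, rfl⟩)
    obtain ⟨c, hc, rfl⟩ := hgen hb
    rw [← sub_add_cancel t c]
    refine Submodule.add_mem_sup ?_ hc
    rw [Submodule.mem_comap, map_sub, ← hab, add_sub_cancel_right]
    exact ha

lemma Noeth.of_injective (h : Noeth ρ') (φ : T →ₗ[K] T') (hφ : ∀ i t, φ (ρ i t) = ρ' i (φ t))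
    (hi : Function.Injective φ) : Noeth ρ := by
  have := RelNoeth.comap h φ hφ
  rwa [show (⊥ : Submodule K T').comap φ = ⊥ from LinearMap.ker_eq_bot.2 hi] at this

/-- The kernels of the projections intersect in zero. -/
lemma Noeth.pi {m : ℕ} {T : Fin m → Type*} [∀ s, AddCommGroup (T s)] [∀ s, Module K (T s)]
    {ρ : ∀ s, I → Module.End K (T s)} (h : ∀ s, Noeth (ρ s)) :
    Noeth fun i => (LinearMap.pi fun s => ρ s i ∘ₗ LinearMap.proj s : Module.End K (∀ s, T s)) := by
  have key : ∀ s, RelNoeth (fun i => (LinearMap.pi fun s => ρ s i ∘ₗ LinearMap.proj s :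
      Module.End K (∀ s, T s))) (LinearMap.ker (LinearMap.proj s : (∀ s, T s) →ₗ[K] T s)) ⊤ :=
    fun s => RelNoeth.comap (h s) (LinearMap.proj s) (by simp)
  refine (relNoeth_finset_inf Finset.univ _ (fun s _ => ?_) fun s _ => key s).mono ?_ le_rfl
  · exact Stable.comap (stable_bot (ρ := ρ s)) (by simp)
  · intro t ht
    rw [Submodule.mem_finsetInf] at ht
    ext s
    exact ht s (by simp)

end StableNoetherian

/-! ### Several copies of affine space -/

namespace MultiPoly

open MvPolynomial StableNoetherian

variable {K : Type*} [Field K] {r n : ℕ}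

/-- The degree of a monomial in the `i`-th group of variables. -/
noncomputable def deg (i : Fin r) (m : Fin r × Fin n →₀ ℕ) : ℕ := (m.curry i).degree

lemma deg_eq_sum (i : Fin r) (m : Fin r × Fin n →₀ ℕ) : deg i m = ∑ a, m (i, a) := by
  simp [deg, Finsupp.degree_eq_sum]

variable (K r n) in
/-- The coordinate ring of the product of `r` copies of affine `n`-space. -/
abbrev Ring' : Type _ := MvPolynomial (Fin r × Fin n) K

/-- The Euler derivation in the `i`-th group of variables. -/
noncomputable def eul (i : Fin r) : Derivation K (Ring' K r n) (Ring' K r n) :=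
  mkDerivation K fun p => if p.1 = i then X p else 0

lemma eul_X (i j : Fin r) (a : Fin n) :
    eul i (X (j, a) : Ring' K r n) = if j = i then X (j, a) else 0 := by
  rw [eul, mkDerivation_X]

/-- An Euler derivation is diagonal on monomials. -/
lemma eul_monomial (i : Fin r) (m : Fin r × Fin n →₀ ℕ) (c : K) :
    eul i (monomial m c) = (deg i m : K) • monomial m c := by
  induction m using Finsupp.induction_linear generalizing c with
  | zero =>
    rw [deg_eq_sum, ← C_apply, eul,
      show (C c : Ring' K r n) = algebraMap K _ c from rfl, Derivation.map_algebraMap]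
    simp
  | add f g hf hg =>
    have h : (monomial (f + g) c : Ring' K r n) = monomial f c * monomial g 1 := by
      rw [monomial_mul, mul_one]
    rw [h, Derivation.leibniz, hf, hg]
    simp only [deg_eq_sum, Finsupp.add_apply, Finset.sum_add_distrib, smul_eq_mul, Nat.cast_add,
      add_smul, mul_smul_comm]
    rw [mul_comm (monomial g 1)]
    exact add_comm _ _
  | single p k =>
    have h : (monomial (Finsupp.single p k) c : Ring' K r n) = c • X p ^ k := by
      rw [X_pow_eq_monomial, smul_monomial, smul_eq_mul, mul_one]
    rw [h, Derivation.map_smul, Derivation.leibniz_pow, eul, mkDerivation_X, deg_eq_sum]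
    obtain ⟨j, b⟩ := p
    by_cases hj : j = i
    · subst hj
      have hs : ∑ a, (Finsupp.single (j, b) k : Fin r × Fin n →₀ ℕ) (j, a) = k := by
        rw [Finset.sum_eq_single b]
        · simp
        · intro a _ ha; simp [ha.symm]
        · simp
      rw [hs, if_pos rfl, smul_comm, ← Nat.cast_smul_eq_nsmul K]
      rcases k with _ | k
      · simp
      · rw [smul_eq_mul, Nat.add_sub_cancel, ← pow_succ]
    · have hs : ∑ a, (Finsupp.single (j, b) k : Fin r × Fin n →₀ ℕ) (i, a) = 0 :=
        Finset.sum_eq_zero fun a _ => by simp [hj]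
      rw [hs, if_neg hj]
      simp

/-- The monomial `x ^ β` in the `i`-th group of variables. -/
noncomputable def slot (i : Fin r) (β : Fin n →₀ ℕ) : Ring' K r n :=
  rename (Prod.mk i) (monomial β 1)

lemma slot_eq (i : Fin r) (β : Fin n →₀ ℕ) :
    (slot i β : Ring' K r n) = monomial (β.mapDomain (Prod.mk i)) 1 := by
  rw [slot, rename_monomial]

lemma deg_mapDomain (i j : Fin r) (β : Fin n →₀ ℕ) :
    deg j (β.mapDomain (Prod.mk i)) = if j = i then β.degree else 0 := by
  rw [deg_eq_sum]
  split_ifs with h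
  · subst h
    rw [Finsupp.degree_eq_sum]
    exact Finset.sum_congr rfl fun a _ => Finsupp.mapDomain_apply (Prod.mk_right_injective j) _ _
  · exact Finset.sum_eq_zero fun a _ => Finsupp.mapDomain_of_notMem_range _ _ (by
      rintro ⟨b, hb⟩; exact h (congrArg Prod.fst hb).symm)

lemma eul_slot (i j : Fin r) (β : Fin n →₀ ℕ) :
    eul j (slot i β : Ring' K r n) = (if j = i then (β.degree : K) else 0) • slot i β := by
  rw [slot_eq, eul_monomial, deg_mapDomain]
  split_ifs <;> simp

/-- A monomial in `r` groups of variables is read as a list of `r` exponents (slots), and `τ`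
assigns each slot to a point. This dictionary turns polynomials into combinations of `r`-fold
products of operators. -/
lemma rename_monomial_eq_prod (τ : Fin r → Fin r) (m : Fin r × Fin n →₀ ℕ) :
    rename (Prod.map τ id) (monomial m (1 : K)) = ∏ s, slot (τ s) (m.curry s) := by
  have h : (monomial m (1 : K)) = ∏ p : Fin r × Fin n, X p ^ m p := by
    rw [monomial_eq, C_1, one_mul, Finsupp.prod_fintype _ _ (by simp)]
  rw [h, map_prod, Fintype.prod_prod_type]
  refine Finset.prod_congr rfl fun s _ => ?_
  rw [slot, monomial_eq, C_1, one_mul, Finsupp.prod_fintype _ _ (by simp), map_prod]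
  refine Finset.prod_congr rfl fun a _ => ?_
  simp [Finsupp.curry_apply]

/-- The operator on polynomials that multiplies the monomial `m` by `w m`. -/
noncomputable def diag (w : (Fin r × Fin n →₀ ℕ) → K) : Ring' K r n →ₗ[K] Ring' K r n :=
  (basisMonomials (Fin r × Fin n) K).constr K fun m => monomial m (w m)

lemma diag_monomial (w : (Fin r × Fin n →₀ ℕ) → K) (m : Fin r × Fin n →₀ ℕ) (c : K) :
    diag w (monomial m c) = w m • monomial m c := by
  have h : (monomial m c : Ring' K r n) = c • basisMonomials (Fin r × Fin n) K m := by
    rw [coe_basisMonomials, smul_monomial, smul_eq_mul, mul_one]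
  rw [h, map_smul, diag, Module.Basis.constr_basis, coe_basisMonomials, smul_monomial, smul_monomial,
    smul_monomial]
  simp [mul_comm]

lemma linearMap_ext_monomial {M : Type*} [AddCommGroup M] [Module K M] {f g : Ring' K r n →ₗ[K] M}
    (h : ∀ m, f (monomial m 1) = g (monomial m 1)) : f = g :=
  (basisMonomials (Fin r × Fin n) K).ext fun m => by simpa using h m

lemma sum_support_smul {M : Type*} [AddCommGroup M] [Module K M] (f : Ring' K r n →ₗ[K] M)
    (F : Ring' K r n) : f F = ∑ m ∈ F.support, coeff m F • f (monomial m 1) := by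
  conv_lhs => rw [F.as_sum, map_sum]
  refine Finset.sum_congr rfl fun m _ => ?_
  rw [← map_smul, smul_monomial, smul_eq_mul, mul_one]

lemma ofFn_prod_sum {A : Type*} [Semiring A] {m : ℕ} (a : Fin m → Fin r → A) :
    (List.ofFn fun s => ∑ i, a s i).prod =
      ∑ τ : Fin m → Fin r, (List.ofFn fun s => a s (τ s)).prod := by
  induction m with
  | zero => simp
  | succ m ih =>
    rw [List.ofFn_succ, List.prod_cons, ih, Finset.sum_mul_sum,
      ← Equiv.sum_comp (Fin.consEquiv fun _ => Fin r), Fintype.sum_prod_type]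
    simp [Fin.consEquiv, List.ofFn_succ]

lemma ofFn_prod_apply_eigen {M : Type*} [AddCommGroup M] [Module K M] {m : ℕ}
    (f : Fin m → Module.End K M) (c : Fin m → K) (v : M) (h : ∀ s, f s v = c s • v) :
    (List.ofFn f).prod v = (∏ s, c s) • v := by
  induction m with
  | zero => simp
  | succ m ih =>
    rw [List.ofFn_succ, List.prod_cons, Module.End.mul_apply, ih _ (fun s => c s.succ)
      (fun s => h s.succ), map_smul, h, Fin.prod_univ_succ, smul_smul, mul_comm]

/-- A product of first order operators maps multiples of `δ ^ (l + p)` to multiples of `δ ^ p`. -/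
lemma ofFn_prod_dvd {A : Type*} [CommRing A] [Algebra K A] {m : ℕ} (c : Fin m → K)
    (D : Fin m → Derivation K A A) (δ : A) (p : ℕ) (h : A) :
    δ ^ p ∣ (List.ofFn fun s => (c s • 1 + (D s : A →ₗ[K] A) : Module.End K A)).prod
      (δ ^ (m + p) * h) := by
  induction m generalizing p with
  | zero => simp
  | succ m ih =>
    -- The inner `m` factors leave a power `p + 1`, and the outermost one lowers it by at most one.
    obtain ⟨g, hg⟩ := ih (fun s => c s.succ) (fun s => D s.succ) (p + 1)
    rw [List.ofFn_succ, List.prod_cons, Module.End.mul_apply, show m + 1 + p = m + (p + 1) by ring,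
      hg, LinearMap.add_apply, LinearMap.smul_apply, Module.End.one_apply, Derivation.coeFn_coe,
      Derivation.leibniz, Derivation.leibniz_pow]
    refine dvd_add ?_ (dvd_add ?_ ?_)
    · rw [pow_succ, mul_assoc]
      exact (Dvd.intro _ rfl : δ ^ p ∣ δ ^ p * (δ * g)).trans ⟨c 0 • 1, by simp⟩
    · rw [pow_succ, smul_eq_mul, mul_assoc]; exact Dvd.intro _ rfl
    · rw [Nat.add_sub_cancel, smul_eq_mul, nsmul_eq_mul, smul_eq_mul]
      exact ⟨g * ((p + 1 : ℕ) * D 0 δ), by ring⟩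

section Action

variable {T : Type*} [AddCommGroup T] [Module K T] [Module (Ring' K r n) T]
  [IsScalarTower K (Ring' K r n) T]

/-- The action of `x ^ β` times the Euler field through the `i`-th copy of affine space. -/
noncomputable def term (E : Fin r → Module.End K T) (lam : Fin r → K) (i : Fin r)
    (β : Fin n →₀ ℕ) : Module.End K T :=
  Algebra.lsmul K K T (slot i β : Ring' K r n) * (E i + (lam i * (β.degree : K)) • 1)

/-- The action of `x ^ β` times the Euler field. -/
noncomputable def act (E : Fin r → Module.End K T) (lam : Fin r → K) (β : Fin n →₀ ℕ) :
    Module.End K T :=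
  ∑ i, term E lam i β

lemma term_apply (E : Fin r → Module.End K T) (lam : Fin r → K) (i : Fin r) (β : Fin n →₀ ℕ)
    (t : T) : term E lam i β t =
      (slot i β : Ring' K r n) • (E i t + (lam i * (β.degree : K)) • t) := rfl

lemma act_apply (E : Fin r → Module.End K T) (lam : Fin r → K) (β : Fin n →₀ ℕ) (t : T) :
    act E lam β t = ∑ i, (slot i β : Ring' K r n) • (E i t + (lam i * (β.degree : K)) • t) := by
  rw [act, LinearMap.sum_apply]; rfl

variable (n) in
/-- The operators `E i` are of Euler type. -/
def IsEuler (E : Fin r → Module.End K T) : Prop :=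
  ∀ i (f : Ring' K r n) t, E i (f • t) = eul i f • t + f • E i t

variable {E : Fin r → Module.End K T} {lam : Fin r → K}

lemma smul_smul_comm' (c : K) (f : Ring' K r n) (t : T) : f • c • t = c • f • t := by
  rw [← smul_one_smul (Ring' K r n) c t, ← smul_one_smul (Ring' K r n) c (f • t), smul_smul,
    smul_smul, mul_comm]

lemma IsEuler.apply_monomial (hE : IsEuler n E) {ε : Fin r → K} {t : T}
    (ht : ∀ i, E i t = ε i • t) (i : Fin r) (m : Fin r × Fin n →₀ ℕ) (c : K) :
    E i ((monomial m c : Ring' K r n) • t) =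
      (ε i + deg i m) • (monomial m c : Ring' K r n) • t := by
  rw [hE, ht, eul_monomial, smul_assoc, add_smul, smul_smul_comm', add_comm]

/-- The last factor of the product acts first. When the factor `s` acts, the vector has already been
multiplied by the monomials of the factors `s' > s`; those assigned to the same point `τ s` have
raised the Euler eigenvalue by their degrees. -/
lemma term_prod_eigen (hE : IsEuler n E) {ε : Fin r → K} {t : T}
    (ht : ∀ i, E i t = ε i • t) {m : ℕ} (τ : Fin m → Fin r) (γ : Fin m → (Fin n →₀ ℕ)) :
    (List.ofFn fun s => term E lam (τ s) (γ s)).prod t =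
      (∏ s, (ε (τ s) + ∑ s' with s < s' ∧ τ s' = τ s, ((γ s').degree : K) +
        lam (τ s) * (γ s).degree)) • (∏ s, slot (τ s) (γ s) : Ring' K r n) • t := by
  induction m with
  | zero => simp
  | succ m ih =>
    have hprod : ∀ i, eul i (∏ s : Fin m, slot (τ s.succ) (γ s.succ) : Ring' K r n) =
        (∑ s' with τ (Fin.succ s') = i, ((γ s'.succ).degree : K)) •
          (∏ s : Fin m, slot (τ s.succ) (γ s.succ) : Ring' K r n) := by
      intro i
      have : ∀ u : Finset (Fin m), eul i (∏ s ∈ u, slot (τ s.succ) (γ s.succ) : Ring' K r n) =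
        (∑ s' ∈ u with τ (Fin.succ s') = i, ((γ s'.succ).degree : K)) •
          (∏ s ∈ u, slot (τ s.succ) (γ s.succ) : Ring' K r n) := by
        intro u
        induction u using Finset.cons_induction with
        | empty => simp
        | cons s u hs ih =>
          rw [Finset.prod_cons, Derivation.leibniz, ih, eul_slot, Finset.filter_cons]
          split_ifs with h1 h2 h2
          · rw [Finset.sum_cons, add_smul, smul_eq_mul, smul_eq_mul, mul_smul_comm, mul_smul_comm,
              add_comm, mul_comm (slot _ _)]
          · exact absurd h1.symm h2
          · exact absurd h2.symm h1
          · rw [zero_smul, smul_zero, add_zero, smul_eq_mul, mul_smul_comm]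
      exact this Finset.univ
    rw [List.ofFn_succ, List.prod_cons, Module.End.mul_apply, ih, map_smul, term_apply, hE, ht,
      hprod, Fin.prod_univ_succ, Fin.prod_univ_succ (f := fun s => slot (τ s) (γ s)), mul_smul,
      mul_smul]
    have h0 : ∑ s' : Fin (m + 1) with 0 < s' ∧ τ s' = τ 0, ((γ s').degree : K) =
        ∑ s' : Fin m with τ s'.succ = τ 0, ((γ s'.succ).degree : K) := by
      rw [Finset.sum_filter, Finset.sum_filter, Fin.sum_univ_succ]
      simp
    have h1 : ∀ s : Fin m, ∑ s' : Fin (m + 1) with s.succ < s' ∧ τ s' = τ s.succ,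
        ((γ s').degree : K) =
        ∑ s' : Fin m with s < s' ∧ τ s'.succ = τ s.succ, ((γ s'.succ).degree : K) := by
      intro s
      rw [Finset.sum_filter, Finset.sum_filter, Fin.sum_univ_succ]
      simp
    rw [h0]
    rw [show (∏ s : Fin m, (ε (τ s.succ) + ∑ s' with s.succ < s' ∧ τ s' = τ s.succ,
        ((γ s').degree : K) + lam (τ s.succ) * (γ s.succ).degree)) =
      ∏ s : Fin m, (ε (τ s.succ) + ∑ s' : Fin m with s < s' ∧ τ s'.succ = τ s.succ,
        ((γ s'.succ).degree : K) + lam (τ s.succ) * (γ s.succ).degree) from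
      Finset.prod_congr rfl fun s _ => by rw [h1]]
    generalize (∏ s : Fin m, (ε (τ s.succ) + ∑ s' : Fin m with s < s' ∧ τ s'.succ = τ s.succ,
        ((γ s'.succ).degree : K) + lam (τ s.succ) * (γ s.succ).degree)) = W
    generalize (∏ s : Fin m, slot (τ s.succ) (γ s.succ) : Ring' K r n) = Q
    generalize (∑ s' : Fin m with τ s'.succ = τ 0, ((γ s'.succ).degree : K)) = d
    simp only [add_smul, smul_add, smul_smul_comm', smul_assoc, mul_smul]
    simp only [smul_comm W]
    abel

end Action

end MultiPoly

/-! ### Products of `r` operators and symmetric polynomials that vanish on diagonals -/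

namespace MultiPoly

open MvPolynomial StableNoetherian

variable {K : Type*} [Field K] {r n : ℕ}

variable (K r n) in
/-- The polynomials that are symmetric under permutations of the `r` copies of affine space. -/
noncomputable def inv : Subalgebra K (Ring' K r n) :=
  ⨅ σ : Equiv.Perm (Fin r), AlgHom.equalizer (rename (Prod.map σ id)) (AlgHom.id K (Ring' K r n))

lemma mem_inv {F : Ring' K r n} :
    F ∈ inv K r n ↔ ∀ σ : Equiv.Perm (Fin r), rename (Prod.map σ id) F = F := by
  simp [inv, Algebra.mem_iInf]

/-- The linear form `ℓ` in the `i`-th group of variables. -/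
noncomputable def lin (l : Fin n → K) (i : Fin r) : Ring' K r n := ∑ a, l a • X (i, a)

lemma rename_lin (l : Fin n → K) (i : Fin r) (τ : Fin r → Fin r) :
    rename (Prod.map τ id) (lin l i) = lin l (τ i) := by
  simp [lin, map_sum]

lemma eul_lin (l : Fin n → K) (i j : Fin r) :
    eul i (lin l j) = if j = i then lin l j else 0 := by
  simp only [lin, map_sum, Derivation.map_smul, eul_X]
  split_ifs <;> simp

/-- The product of the operators `ε i + lam i * eul i`. -/
noncomputable def eulProd (ε lam : Fin r → K) : Ring' K r n →ₗ[K] Ring' K r n :=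
  diag fun m => ∏ i, (ε i + lam i * deg i m)

/-- The first order operator in the variables of the slot `s` that describes the action of the
`s`-th factor of a product of vector fields, when each slot is assigned to a copy of affine space. -/
noncomputable def slotOp (ε lam : Fin r → K) (τ : Fin r → Fin r) (s : Fin r) :
    Module.End K (Ring' K r n) :=
  ε (τ s) • 1 + ((∑ s' with s < s' ∧ τ s' = τ s, eul s' + lam (τ s) • eul s :
    Derivation K (Ring' K r n) (Ring' K r n)) : Ring' K r n →ₗ[K] Ring' K r n)

lemma derivation_sum_apply {κ A : Type*} [CommRing A] [Algebra K A] (s : Finset κ)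
    (D : κ → Derivation K A A) (f : A) : (∑ i ∈ s, D i) f = ∑ i ∈ s, D i f := by
  induction s using Finset.cons_induction with
  | empty => simp
  | cons a s ha ih => rw [Finset.sum_cons, Finset.sum_cons, Derivation.add_apply, ih]

lemma slotOp_monomial (ε lam : Fin r → K) (τ : Fin r → Fin r) (s : Fin r)
    (m : Fin r × Fin n →₀ ℕ) (c : K) : slotOp ε lam τ s (monomial m c) =
      (ε (τ s) + ∑ s' with s < s' ∧ τ s' = τ s, (deg s' m : K) + lam (τ s) * deg s m) •
        monomial m c := by
  rw [slotOp, LinearMap.add_apply, LinearMap.smul_apply, Module.End.one_apply,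
    Derivation.coeFn_coe, Derivation.add_apply, derivation_sum_apply, Derivation.smul_apply,
    eul_monomial, add_smul, add_smul, Finset.sum_smul, mul_smul, add_assoc]
  simp only [eul_monomial]

section Action

variable {T : Type*} [AddCommGroup T] [Module K T] [Module (Ring' K r n) T]
  [IsScalarTower K (Ring' K r n) T] {E : Fin r → Module.End K T} {lam : Fin r → K}

/-- The scalars in `term_prod_eigen` are eigenvalues of the first order operators `slotOp` on the
monomial `m`, taken before the slots are collapsed by `τ`. In this form the identity extends
linearly from monomials to polynomials. -/
lemma act_prod_eigen (hE : IsEuler n E) {ε : Fin r → K} {t : T}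
    (ht : ∀ i, E i t = ε i • t) (m : Fin r × Fin n →₀ ℕ) :
    (List.ofFn fun s : Fin r => act E lam (m.curry s)).prod t =
      ∑ τ : Fin r → Fin r, rename (Prod.map τ id)
        ((List.ofFn (slotOp ε lam τ)).prod (monomial m (1 : K))) • t := by
  simp only [act]
  rw [ofFn_prod_sum, LinearMap.sum_apply]
  refine Finset.sum_congr rfl fun τ _ => ?_
  rw [term_prod_eigen hE ht, ofFn_prod_apply_eigen _ _ _ fun s => slotOp_monomial ε lam τ s m 1,
    map_smul, rename_monomial_eq_prod, smul_assoc]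
  rfl

/-- The `r` first order operators lower the order of vanishing by at most `r`, so that one factor
`lin l s - lin l s'` survives. It becomes zero when both slots are sent to the same point. -/
lemma rename_slotOp_of_not_injective (ε lam : Fin r → K) {τ : Fin r → Fin r} {s s' : Fin r}
    (hτ : τ s = τ s') {F : Ring' K r n} {l : Fin n → K}
    (hF : (lin l s - lin l s') ^ (r + 1) ∣ F) :
    rename (Prod.map τ id) ((List.ofFn (slotOp ε lam τ)).prod F) = 0 := by
  obtain ⟨h, rfl⟩ := hF
  obtain ⟨g, hg⟩ := ofFn_prod_dvd (m := r) (fun s => ε (τ s))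
    (fun s => (∑ s' with s < s' ∧ τ s' = τ s, eul s' + lam (τ s) • eul s :
    Derivation K (Ring' K r n) (Ring' K r n))) (lin l s - lin l s') 1 h
  have : (List.ofFn (slotOp ε lam τ)).prod ((lin l s - lin l s') ^ (r + 1) * h) = _ := hg
  rw [this, map_mul, map_pow, map_sub, rename_lin, rename_lin, hτ, sub_self, pow_one, zero_mul]

/-- For a permutation no two slots share a point, so the sum over `s'` in `slotOp` is empty and only
the Euler operator of the slot itself remains. -/
lemma rename_slotOp_perm (ε lam : Fin r → K) (σ : Equiv.Perm (Fin r)) (F : Ring' K r n) :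
    rename (Prod.map σ id) ((List.ofFn (slotOp ε lam σ)).prod F) =
      eulProd ε lam (rename (Prod.map σ id) F) := by
  suffices h : (rename (Prod.map σ id) : Ring' K r n →ₐ[K] Ring' K r n).toLinearMap ∘ₗ
      (List.ofFn (slotOp ε lam σ)).prod = eulProd ε lam ∘ₗ
        (rename (Prod.map σ id) : Ring' K r n →ₐ[K] Ring' K r n).toLinearMap from
    LinearMap.congr_fun h F
  refine linearMap_ext_monomial fun m => ?_
  rw [LinearMap.comp_apply, LinearMap.comp_apply, AlgHom.toLinearMap_apply,
    AlgHom.toLinearMap_apply, ofFn_prod_apply_eigen _ _ _ fun s => slotOp_monomial ε lam σ s m 1,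
    map_smul, rename_monomial, eulProd, diag_monomial]
  congr 1
  rw [← Equiv.prod_comp σ fun i => ε i + lam i * (deg i (m.mapDomain (Prod.map σ id)) : K)]
  refine Finset.prod_congr rfl fun s _ => ?_
  have h1 : ∑ s' with s < s' ∧ σ s' = σ s, (deg s' m : K) = 0 := by
    refine Finset.sum_eq_zero fun s' hs' => ?_
    rw [Finset.mem_filter] at hs'
    exact absurd (σ.injective hs'.2.2) hs'.2.1.ne'
  have h2 : deg (σ s) (m.mapDomain (Prod.map σ id)) = deg s m := by
    rw [deg_eq_sum, deg_eq_sum]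
    refine Finset.sum_congr rfl fun a _ => ?_
    exact Finsupp.mapDomain_apply (σ.injective.prodMap Function.injective_id) m (s, a)
  rw [h1, add_zero, h2]

/-- The monomials of `F` have degree at least `e` in each group of variables. -/
def HasOrder (e : ℕ) (F : Ring' K r n) : Prop := ∀ m ∈ F.support, ∀ i, e ≤ deg i m

/-- The combination of `r`-fold products encoded by `F` preserves `N`. The terms of non-injective
assignments vanish, and the `r!` permutations contribute equally because `F` is symmetric. As `N`
need not be stable under the `E i`, its elements are treated as sums of joint eigenvectors that need
not lie in `N` individually. -/
lemma eulProd_smul_mem [CharZero K] (hE : IsEuler n E) {e : ℕ} {N : Submodule K T}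
    (hN : Stable (fun β : {β : Fin n →₀ ℕ // e ≤ β.degree} => act E lam β.1) N)
    {κ : Type*} (s : Finset κ) (ε : κ → Fin r → K) (u : κ → T)
    (hu : ∀ k ∈ s, ∀ i, E i (u k) = ε k i • u k) (huN : ∑ k ∈ s, u k ∈ N)
    {F : Ring' K r n} (hF : F ∈ inv K r n) (hFe : HasOrder e F) (l : Fin n → K)
    (hFl : ∀ i j, i ≠ j → (lin l i - lin l j) ^ (r + 1) ∣ F) :
    ∑ k ∈ s, eulProd (ε k) lam F • u k ∈ N := by
  classical
  -- By `HasOrder`, every slot of `m` has degree at least `e`, so each factor is one of the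
  -- operators that preserve `N`.
  have hmem : ∀ m ∈ F.support, ∀ t ∈ N,
      (List.ofFn fun s : Fin r => act E lam (m.curry s)).prod t ∈ N := by
    intro m hm t ht
    have : ∀ (q : ℕ) (f : Fin q → Module.End K T), (∀ s, ∀ t ∈ N, f s t ∈ N) →
        (List.ofFn f).prod t ∈ N := by
      intro q
      induction q with
      | zero => intro f _; simpa using ht
      | succ q ih =>
        intro f hf
        rw [List.ofFn_succ, List.prod_cons]
        exact hf 0 _ (ih _ fun s => hf s.succ)
    exact this r _ fun s t ht => hN ⟨m.curry s, hFe m hm s⟩ t ht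
  have h1 : ∑ m ∈ F.support, coeff m F •
      (List.ofFn fun s : Fin r => act E lam (m.curry s)).prod (∑ k ∈ s, u k) ∈ N :=
    N.sum_mem fun m hm => N.smul_mem _ (hmem m hm _ huN)
  have h2 : ∑ m ∈ F.support, coeff m F •
      (List.ofFn fun s : Fin r => act E lam (m.curry s)).prod (∑ k ∈ s, u k) =
      ∑ k ∈ s, ∑ τ : Fin r → Fin r,
        rename (Prod.map τ id) ((List.ofFn (slotOp (ε k) lam τ)).prod F) • u k := by
    simp only [map_sum, Finset.smul_sum]
    rw [Finset.sum_comm]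
    refine Finset.sum_congr rfl fun k hk => ?_
    have h3 : ∀ τ : Fin r → Fin r,
        rename (Prod.map τ id) ((List.ofFn (slotOp (ε k) lam τ)).prod F) • u k =
        ∑ m ∈ F.support, coeff m F • (rename (Prod.map τ id)
          ((List.ofFn (slotOp (ε k) lam τ)).prod (monomial m (1 : K))) • u k) := by
      intro τ
      exact sum_support_smul (((Algebra.lsmul K K T).toLinearMap.flip (u k)) ∘ₗ
        (rename (Prod.map τ id) : Ring' K r n →ₐ[K] Ring' K r n).toLinearMap ∘ₗ
          (List.ofFn (slotOp (ε k) lam τ)).prod) F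
    simp only [h3]
    rw [Finset.sum_comm]
    refine Finset.sum_congr rfl fun m _ => ?_
    rw [act_prod_eigen hE (hu k hk), Finset.smul_sum]
  -- The sum over all maps reduces to the permutations, hence the factor `r!`, which is invertible
  -- in characteristic zero.
  have h4 : ∀ k, ∑ τ : Fin r → Fin r,
      rename (Prod.map τ id) ((List.ofFn (slotOp (ε k) lam τ)).prod F) • u k =
      (r.factorial : K) • (eulProd (ε k) lam F • u k) := by
    intro k
    have h5 : ∑ τ : Fin r → Fin r,
      rename (Prod.map τ id) ((List.ofFn (slotOp (ε k) lam τ)).prod F) • u k =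
        ∑ σ : Equiv.Perm (Fin r), eulProd (ε k) lam F • u k := by
      symm
      refine Finset.sum_of_injOn (fun σ : Equiv.Perm (Fin r) => (σ : Fin r → Fin r))
        (fun σ _ σ' _ h => DFunLike.coe_injective h) (by simp) ?_ ?_
      · intro τ _ hτ
        have : ¬ Function.Injective τ := fun h => hτ
          ⟨Equiv.ofBijective τ (Finite.injective_iff_bijective.1 h), by simp, rfl⟩
        simp only [Function.Injective, not_forall] at this
        obtain ⟨i, j, hij, hne⟩ := this
        rw [rename_slotOp_of_not_injective _ _ hij (hFl i j hne), zero_smul]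
      · intro σ _
        rw [rename_slotOp_perm, mem_inv.1 hF]
    rw [h5, Finset.sum_const, Finset.card_univ, Fintype.card_perm, Fintype.card_fin,
      Nat.cast_smul_eq_nsmul]
  rw [h2] at h1
  simp only [h4, ← Finset.smul_sum] at h1
  exact (Submodule.smul_mem_iff _ (Nat.cast_ne_zero.2 r.factorial_ne_zero)).1 h1

end Action

end MultiPoly

/-! ### Elimination of the Euler eigenvalues by leading coefficients -/

namespace MultiPoly

open MvPolynomial StableNoetherian

variable {K : Type*} [Field K] {r n : ℕ}

/-- By Lagrange interpolation at `0, …, D`, the coefficient of degree `D` is a fixed linear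
combination of the values. -/
lemma sum_coeff_smul_mem [CharZero K] {T : Type*} [AddCommGroup T] [Module K T] {κ : Type*}
    (s : Finset κ) (P : κ → Polynomial K) (w : κ → T) (N : Submodule K T) (D : ℕ)
    (hP : ∀ k ∈ s, (P k).natDegree ≤ D)
    (h : ∀ b : ℕ, b ≤ D → ∑ k ∈ s, (P k).eval (b : K) • w k ∈ N) :
    ∑ k ∈ s, (P k).coeff D • w k ∈ N := by
  have hinj : Set.InjOn (fun b : ℕ => (b : K)) (Finset.range (D + 1) : Finset ℕ) :=
    fun _ _ _ _ h => Nat.cast_injective h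
  have h1 : ∀ k ∈ s, (P k).coeff D = ∑ b ∈ Finset.range (D + 1), (P k).eval (b : K) *
      (Lagrange.basis (Finset.range (D + 1)) (fun b : ℕ => (b : K)) b).coeff D := by
    intro k hk
    have hdeg : (P k).degree < ((Finset.range (D + 1)).card : WithBot ℕ) := by
      rw [Finset.card_range]
      refine lt_of_le_of_lt Polynomial.degree_le_natDegree ?_
      exact_mod_cast Nat.lt_succ_of_le (hP k hk)
    have := congrArg (fun p => Polynomial.coeff p D) (Lagrange.eq_interpolate hinj hdeg)
    simpa [Lagrange.interpolate_apply, Polynomial.finsetSum_coeff] using this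
  have h2 : ∑ k ∈ s, (P k).coeff D • w k = ∑ b ∈ Finset.range (D + 1),
      (Lagrange.basis (Finset.range (D + 1)) (fun b : ℕ => (b : K)) b).coeff D •
        ∑ k ∈ s, (P k).eval (b : K) • w k := by
    simp only [Finset.smul_sum]
    rw [Finset.sum_comm]
    refine Finset.sum_congr rfl fun k hk => ?_
    rw [h1 k hk, Finset.sum_smul]
    exact Finset.sum_congr rfl fun b _ => by rw [smul_smul, mul_comm]
  rw [h2]
  exact N.sum_mem fun b hb => N.smul_mem _ (h b (by simpa [Nat.lt_succ_iff] using hb))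

lemma coeff_prod_sum_of_natDegree_le {κ : Type*} (s : Finset κ) (p : κ → Polynomial K) (d : κ → ℕ)
    (h : ∀ i ∈ s, (p i).natDegree ≤ d i) :
    (∏ i ∈ s, p i).natDegree ≤ ∑ i ∈ s, d i ∧
      (∏ i ∈ s, p i).coeff (∑ i ∈ s, d i) = ∏ i ∈ s, (p i).coeff (d i) := by
  induction s using Finset.cons_induction with
  | empty => simp
  | cons a s ha ih =>
    obtain ⟨h1, h2⟩ := ih fun i hi => h i (by simp [hi])
    have h3 := h a (by simp)
    rw [Finset.prod_cons, Finset.sum_cons, Finset.prod_cons]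
    exact ⟨Polynomial.natDegree_mul_le.trans (add_le_add h3 h1),
      by rw [Polynomial.coeff_mul_add_eq_of_natDegree_le h3 h1, h2]⟩

/-- The operator `eulProd` is a product of first order operators in the `eul i`, so it is diagonal
on every joint eigenvector, in particular on a monomial times a power of `linProd`. -/
lemma eulProd_of_eul (ε lam d : Fin r → K) {h : Ring' K r n} (hd : ∀ i, eul i h = d i • h) :
    eulProd ε lam h = (∏ i, (ε i + lam i * d i)) • h := by
  have h1 : (eulProd ε lam : Module.End K (Ring' K r n)) = (List.ofFn fun i => (ε i • 1 + lam i •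
      ((eul i : Derivation K (Ring' K r n) (Ring' K r n)) : Ring' K r n →ₗ[K] Ring' K r n) :
        Module.End K (Ring' K r n))).prod := by
    refine linearMap_ext_monomial fun m => ?_
    rw [eulProd, diag_monomial, ofFn_prod_apply_eigen _ (fun i => ε i + lam i * deg i m)]
    intro i
    simp [eul_monomial, add_smul, mul_smul]
  rw [h1, ofFn_prod_apply_eigen]
  intro i
  simp [hd, add_smul, mul_smul]

lemma coeff_eul (i : Fin r) (F : Ring' K r n) (m : Fin r × Fin n →₀ ℕ) :
    coeff m (eul i F) = deg i m * coeff m F := by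
  classical
  have h : ((eul i : Derivation K (Ring' K r n) (Ring' K r n)) : Ring' K r n →ₗ[K] Ring' K r n) =
      diag fun m => (deg i m : K) :=
    linearMap_ext_monomial fun m => by rw [diag_monomial, Derivation.coeFn_coe, eul_monomial]
  have h2 : (lcoeff K m ∘ₗ diag fun m => (deg i m : K)) = (deg i m : K) • lcoeff K m := by
    refine linearMap_ext_monomial fun m' => ?_
    rw [LinearMap.comp_apply, diag_monomial]
    simp only [map_smul, LinearMap.smul_apply, lcoeff_apply, coeff_monomial, smul_eq_mul]
    split_ifs with h
    · rw [h]
    · simp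
  have h3 := LinearMap.congr_fun h2 F
  rw [← h] at h3
  simpa using h3

/-- In characteristic zero the Euler eigenvalue `e` forces every monomial of `g` to have degree `e`
in each group. -/
lemma HasOrder.mul_of_eul [CharZero K] {e : ℕ} {g : Ring' K r n}
    (hg : ∀ i, eul i g = (e : K) • g) (h : Ring' K r n) : HasOrder e (g * h) := by
  classical
  intro m hm i
  obtain ⟨m1, h1, m2, _, rfl⟩ := Finset.mem_add.1 (support_mul _ _ hm)
  have h3 : deg i m1 = e := by
    have := coeff_eul i g m1
    rw [hg, coeff_smul, smul_eq_mul] at this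
    exact_mod_cast (mul_right_cancel₀ (mem_support_iff.1 h1) this).symm
  rw [deg_eq_sum] at h3 ⊢
  simp only [Finsupp.add_apply, Finset.sum_add_distrib]
  omega

variable (r) in
/-- The product of the values of a linear form. -/
noncomputable def linProd (l : Fin n → K) : Ring' K r n := ∏ i, lin l i

variable (r) in
/-- The discriminant of the values of a linear form. -/
noncomputable def linDisc (l : Fin n → K) : Ring' K r n :=
  ∏ p : Fin r × Fin r with p.1 ≠ p.2, (lin l p.1 - lin l p.2)

lemma linProd_mem (l : Fin n → K) : linProd r l ∈ inv K r n := by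
  rw [mem_inv]
  intro σ
  rw [linProd, map_prod]
  simp only [rename_lin]
  exact Equiv.prod_comp σ fun i => lin l i

lemma linDisc_mem (l : Fin n → K) : linDisc r l ∈ inv K r n := by
  rw [mem_inv]
  intro σ
  rw [linDisc, map_prod]
  simp only [rename_lin, map_sub]
  refine Finset.prod_bij (fun p _ => (σ p.1, σ p.2)) ?_ ?_ ?_ ?_
  · simp
  · rintro ⟨a, b⟩ _ ⟨c, d⟩ _ h
    simpa using h
  · rintro ⟨a, b⟩ h
    exact ⟨(σ.symm a, σ.symm b), by simpa using h, by simp⟩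
  · simp

lemma sub_dvd_linDisc (l : Fin n → K) {i j : Fin r} (h : i ≠ j) :
    (lin l i - lin l j : Ring' K r n) ∣ linDisc r l :=
  Finset.dvd_prod_of_mem (fun p : Fin r × Fin r => (lin l p.1 - lin l p.2 : Ring' K r n))
    (a := (i, j)) (by simpa using h)

lemma eul_linProd (l : Fin n → K) (i : Fin r) : eul i (linProd r l) = linProd r l := by
  have : ∀ s : Finset (Fin r), eul i (∏ j ∈ s, lin l j : Ring' K r n) =
      if i ∈ s then ∏ j ∈ s, lin l j else 0 := by
    intro s
    induction s using Finset.cons_induction with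
    | empty => simp
    | cons a s ha ih =>
      rw [Finset.prod_cons, Derivation.leibniz, ih, eul_lin]
      by_cases h1 : a = i
      · subst h1; simp [ha, mul_comm]
      · simp [h1, Ne.symm h1]
  rw [linProd, this, if_pos (Finset.mem_univ _)]

lemma eul_linProd_pow (l : Fin n → K) (i : Fin r) (b : ℕ) :
    eul i (linProd r l ^ b) = (b : K) • linProd r l ^ b := by
  rw [Derivation.leibniz_pow, eul_linProd]
  rcases b with _ | b
  · simp
  · rw [Nat.add_sub_cancel, smul_eq_mul, ← pow_succ, Nat.cast_smul_eq_nsmul]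

lemma eul_mul_of_eul {i : Fin r} {c d : K} {f g : Ring' K r n} (hf : eul i f = c • f)
    (hg : eul i g = d • g) : eul i (f * g) = (c + d) • (f * g) := by
  rw [Derivation.leibniz, hf, hg, smul_eq_mul, smul_eq_mul, mul_smul_comm, mul_smul_comm, mul_comm g,
    ← add_smul, add_comm]

section Action

variable {T : Type*} [AddCommGroup T] [Module K T] [Module (Ring' K r n) T]
  [IsScalarTower K (Ring' K r n) T] {E : Fin r → Module.End K T} {lam : Fin r → K}

lemma IsEuler.apply_smul (hE : IsEuler n E) {ε : Fin r → K} {t : T} {i : Fin r}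
    (ht : E i t = ε i • t) {h : Ring' K r n} {d : K} (hd : eul i h = d • h) :
    E i (h • t) = (ε i + d) • h • t := by
  rw [hE, ht, hd, smul_assoc, add_smul, smul_smul_comm', add_comm]

open Classical in
-- Apply `eulProd_smul_mem` twice, with `Q * p ^ b` and then with `G * Q * p ^ (2 * r - b)`, where
-- `p = linProd r l`. The product of the two polynomials does not depend on `b`, while the Euler
-- scalars are polynomials in `b`. Their leading coefficient is the same for all monomials: a
-- nonzero constant (as `lam i ≠ 1`) times the eigenvalues `ε i` with `lam i = 0`. Extracting this
-- coefficient leaves the plain product of the two polynomials.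
lemma sum_smul_mem_of_act_mem [CharZero K] (hE : IsEuler n E) {e : ℕ} {N : Submodule K T}
    (hN : Stable (fun β : {β : Fin n →₀ ℕ // e ≤ β.degree} => act E lam β.1) N)
    {κ : Type*} (s : Finset κ) (ε : κ → Fin r → K) (u : κ → T)
    (hu : ∀ k ∈ s, ∀ i, E i (u k) = ε k i • u k) (huN : ∑ k ∈ s, u k ∈ N)
    (hlam : ∀ i, lam i ≠ 1) {G : Ring' K r n} (hG : G ∈ inv K r n) (l : Fin n → K) :
    ∑ k ∈ s, (∏ i, if lam i = 0 then ε k i else 1) •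
      (G * (linProd r l ^ e * linDisc r l ^ (r + 1)) * (linProd r l ^ e * linDisc r l ^ (r + 1)) *
        linProd r l ^ (2 * r) : Ring' K r n) • u k ∈ N := by
  set Q : Ring' K r n := linProd r l ^ e * linDisc r l ^ (r + 1) with hQ
  have hgood : ∀ H ∈ inv K r n, ∀ b : ℕ, H * Q * linProd r l ^ b ∈ inv K r n ∧
      HasOrder e (H * Q * linProd r l ^ b) ∧
      ∀ i j, i ≠ j → (lin l i - lin l j) ^ (r + 1) ∣ H * Q * linProd r l ^ b := by
    intro H hH b
    refine ⟨mul_mem (mul_mem hH (mul_mem (pow_mem (linProd_mem l) _) (pow_mem (linDisc_mem l) _)))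
      (pow_mem (linProd_mem l) _), ?_, fun i j hij => ?_⟩
    · rw [hQ, show H * (linProd r l ^ e * linDisc r l ^ (r + 1)) * linProd r l ^ b =
        linProd r l ^ e * (H * linDisc r l ^ (r + 1) * linProd r l ^ b) by ring]
      exact HasOrder.mul_of_eul (fun i => eul_linProd_pow l i e) _
    · exact ((pow_dvd_pow_of_dvd (sub_dvd_linDisc l hij) _).mul_left _).mul_left _ |>.mul_right _
  have hexp : ∀ (ε : Fin r → K) (F : Ring' K r n) (b : ℕ), eulProd ε lam (F * linProd r l ^ b) =
      ∑ m ∈ F.support, (coeff m F * ∏ i, (ε i + lam i * (deg i m + b))) •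
        (monomial m (1 : K) * linProd r l ^ b) := by
    intro ε F b
    have h1 : eulProd ε lam (F * linProd r l ^ b) =
        (eulProd ε lam ∘ₗ LinearMap.mulRight K (linProd r l ^ b)) F := rfl
    rw [h1, sum_support_smul]
    refine Finset.sum_congr rfl fun m _ => ?_
    rw [LinearMap.comp_apply, LinearMap.mulRight_apply, eulProd_of_eul (d := fun i => (deg i m + b : K)),
      smul_smul]
    exact fun i => eul_mul_of_eul (eul_monomial i m 1) (eul_linProd_pow l i b)
  let S' := (s ×ˢ Q.support) ×ˢ (G * Q).support
  -- For each `i`, the first factor is the scalar of the second application, with slope `1 - lam i`: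
  -- the Euler eigenvalue has grown by `b`, while the exponent of `linProd` is `2 * r - b`. The
  -- second factor is the scalar of the first application, with slope `lam i`.
  let P : (κ × (Fin r × Fin n →₀ ℕ)) × (Fin r × Fin n →₀ ℕ) → Polynomial K := fun k =>
    ∏ i, ((Polynomial.C (ε k.1.1 i + deg i k.1.2 + lam i * (deg i k.2 + (2 * r : ℕ))) +
      Polynomial.C (1 - lam i) * Polynomial.X) *
        (Polynomial.C (ε k.1.1 i + lam i * deg i k.1.2) + Polynomial.C (lam i) * Polynomial.X))
  let w : (κ × (Fin r × Fin n →₀ ℕ)) × (Fin r × Fin n →₀ ℕ) → T := fun k =>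
    (coeff k.2 (G * Q) * coeff k.1.2 Q) • (monomial k.2 (1 : K) * monomial k.1.2 (1 : K) *
      linProd r l ^ (2 * r)) • u k.1.1
  -- For `lam i = 0` the second factor is the constant `ε i`, so the pair has degree one instead of
  -- two. The total degree is at most `2 * r`, and hence `2 * r - b` is not truncated for the values
  -- of `b` in use.
  let dd : Fin r → ℕ := fun i => 1 + if lam i = 0 then 0 else 1
  have hlin : ∀ c d : K, (Polynomial.C c + Polynomial.C d * Polynomial.X).natDegree ≤ 1 :=
    fun c d => by compute_degree
  have hP : ∀ k, (P k).natDegree ≤ ∑ i, dd i ∧ (P k).coeff (∑ i, dd i) =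
      ∏ i, ((1 - lam i) * if lam i = 0 then ε k.1.1 i else lam i) := by
    intro k
    have h1 : ∀ i, ((Polynomial.C (ε k.1.1 i + lam i * deg i k.1.2) +
        Polynomial.C (lam i) * Polynomial.X)).natDegree ≤ if lam i = 0 then 0 else 1 := by
      intro i
      split_ifs with h
      · simp [h]
      · exact hlin _ _
    obtain ⟨h2, h3⟩ := coeff_prod_sum_of_natDegree_le Finset.univ (fun i =>
      ((Polynomial.C (ε k.1.1 i + deg i k.1.2 + lam i * (deg i k.2 + (2 * r : ℕ))) +
      Polynomial.C (1 - lam i) * Polynomial.X) *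
        (Polynomial.C (ε k.1.1 i + lam i * deg i k.1.2) + Polynomial.C (lam i) * Polynomial.X)))
      dd fun i _ => Polynomial.natDegree_mul_le.trans (add_le_add (hlin _ _) (h1 i))
    refine ⟨h2, h3.trans (Finset.prod_congr rfl fun i _ => ?_)⟩
    rw [Polynomial.coeff_mul_add_eq_of_natDegree_le (hlin _ _) (h1 i)]
    split_ifs with h
    · simp [h]
    · simp
  have hmain : ∀ b : ℕ, b ≤ ∑ i, dd i → ∑ k ∈ S', (P k).eval (b : K) • w k ∈ N := by
    intro b hb
    have hb' : b ≤ 2 * r := by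
      refine hb.trans ((Finset.sum_le_card_nsmul _ _ 2 fun i _ => ?_).trans (by simp [mul_comm]))
      simp only [dd]; split_ifs <;> omega
    obtain ⟨g1, g2, g3⟩ := hgood 1 (one_mem _) b
    rw [one_mul] at g1 g2 g3
    have h1 := eulProd_smul_mem hE hN s ε u hu huN g1 g2 l g3
    simp only [hexp, Finset.sum_smul] at h1
    rw [← Finset.sum_product'] at h1
    obtain ⟨g1, g2, g3⟩ := hgood G hG (2 * r - b)
    have h2 := eulProd_smul_mem hE hN (s ×ˢ Q.support)
      (fun k i => ε k.1 i + (deg i k.2 + b)) _ (fun k hk i => by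
        rw [smul_assoc, map_smul, hE.apply_smul (hu k.1 (Finset.mem_product.1 hk).1 i)
          (eul_mul_of_eul (eul_monomial i k.2 1) (eul_linProd_pow l i b)), smul_comm]) h1 g1 g2 l g3
    simp only [hexp, Finset.sum_smul] at h2
    rw [← Finset.sum_product'] at h2
    convert h2 using 1
    refine Finset.sum_congr rfl fun k _ => ?_
    simp only [w, P]
    rw [smul_assoc, smul_assoc, smul_smul_comm', smul_smul (M := K), smul_smul (M := K),
      smul_smul (M := Ring' K r n)]
    congr 1
    · rw [Polynomial.eval_prod]
      simp only [Polynomial.eval_mul, Polynomial.eval_add, Polynomial.eval_C, Polynomial.eval_X]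
      rw [Finset.prod_mul_distrib]
      have e1 : ∏ i, (ε k.1.1 i + deg i k.1.2 + lam i * (deg i k.2 + ((2 * r : ℕ) : K)) +
          (1 - lam i) * b) =
          ∏ i, (ε k.1.1 i + (deg i k.1.2 + b) + lam i * (deg i k.2 + ((2 * r - b : ℕ) : K))) := by
        refine Finset.prod_congr rfl fun i _ => ?_
        rw [Nat.cast_sub hb']; ring
      have e2 : ∏ i, (ε k.1.1 i + lam i * deg i k.1.2 + lam i * (b : K)) =
          ∏ i, (ε k.1.1 i + lam i * (deg i k.1.2 + b)) :=
        Finset.prod_congr rfl fun i _ => by ring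
      rw [e1, e2]
      ring
    · congr 1
      rw [show 2 * r = (2 * r - b) + b by omega, pow_add]
      simp only [Nat.add_sub_cancel]
      ring
  have hfin := sum_coeff_smul_mem S' P w N (∑ i, dd i) (fun k _ => (hP k).1) hmain
  simp only [hP] at hfin
  -- The first product on the right is a nonzero constant independent of `k` and can be divided out.
  have hsplit : ∀ k, ∏ i, ((1 - lam i) * if lam i = 0 then ε k i else lam i) =
      (∏ i, ((1 - lam i) * if lam i = 0 then 1 else lam i)) *
        ∏ i, if lam i = 0 then ε k i else 1 := by
    intro k
    rw [← Finset.prod_mul_distrib]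
    refine Finset.prod_congr rfl fun i _ => ?_
    split_ifs <;> ring
  have hc : (∏ i, ((1 - lam i) * if lam i = 0 then 1 else lam i)) ≠ 0 := by
    refine Finset.prod_ne_zero_iff.2 fun i _ => mul_ne_zero (sub_ne_zero.2 (hlam i).symm) ?_
    split_ifs with h
    · exact one_ne_zero
    · exact h
  simp only [hsplit, mul_smul, ← Finset.smul_sum] at hfin
  have hfin := (Submodule.smul_mem_iff _ hc).1 hfin
  convert hfin using 1
  simp only [S', w]
  rw [Finset.sum_product, Finset.sum_product]
  refine Finset.sum_congr rfl fun k _ => ?_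
  simp only [← Finset.smul_sum]
  congr 1
  simp only [mul_smul]
  have hs : ∀ (F : Ring' K r n) (x : T), F • x =
      ∑ m ∈ F.support, coeff m F • (monomial m (1 : K) : Ring' K r n) • x := fun F x =>
    sum_support_smul ((Algebra.lsmul K K T).toLinearMap.flip x) F
  rw [← mul_smul, hs (G * Q)]
  simp only [hs Q, Finset.smul_sum]
  rw [Finset.sum_comm]
  refine Finset.sum_congr rfl fun m _ => Finset.sum_congr rfl fun m' _ => ?_
  simp only [smul_smul_comm']

end Action

end MultiPoly

/-! ### Differential operators of finite order and the remaining eigenvalues -/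

namespace MultiPoly

open MvPolynomial StableNoetherian

/-- The commutator with `m`. -/
def commWith {K A : Type*} [Field K] [Ring A] [Algebra K A] (m : A) : Module.End K A :=
  LinearMap.mulRight K m - LinearMap.mulLeft K m

section Order

variable {K A : Type*} [Field K] [Ring A] [Algebra K A] (m : A)

lemma commWith_apply (x : A) : commWith (K := K) m x = x * m - m * x := rfl

/-- The commutator is a derivation, so every term of the Leibniz expansion of its power `p + q`
kills one of the factors. -/
lemma commWith_pow_mul (p q : ℕ) (x y : A) (hx : (commWith (K := K) m ^ p) x = 0)
    (hy : (commWith (K := K) m ^ q) y = 0) : (commWith (K := K) m ^ (p + q)) (x * y) = 0 := by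
  induction h : p + q generalizing p q x y with
  | zero =>
    obtain rfl : p = 0 := by omega
    simp only [pow_zero, Module.End.one_apply] at hx ⊢
    rw [hx, zero_mul]
  | succ s ih =>
    rcases p with _ | p
    · rw [pow_zero, Module.End.one_apply] at hx
      rw [hx, zero_mul, map_zero]
    rcases q with _ | q
    · rw [pow_zero, Module.End.one_apply] at hy
      rw [hy, mul_zero, map_zero]
    have h1 : commWith (K := K) m (x * y) = commWith (K := K) m x * y + x * commWith (K := K) m y := by
      simp only [commWith_apply]; noncomm_ring
    rw [pow_succ, Module.End.mul_apply, h1, map_add,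
      ih p (q + 1) _ _ (by rwa [pow_succ] at hx) hy (by omega),
      ih (p + 1) q _ _ hx (by rwa [pow_succ] at hy) (by omega), add_zero]

/-- Each factor behaves as a differential operator of order at most one. The exponent is a crude
bound: two for each factor, and one for the empty product. -/
lemma commWith_pow_ofFn_prod {r : ℕ} (f : Fin r → A) (h : ∀ i, (commWith (K := K) m ^ 2) (f i) = 0) :
    (commWith (K := K) m ^ (2 * r + 1)) (List.ofFn f).prod = 0 := by
  induction r with
  | zero => simp [commWith_apply]
  | succ r ih =>
    rw [List.ofFn_succ, List.prod_cons, show 2 * (r + 1) + 1 = 2 + (2 * r + 1) by ring]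
    exact commWith_pow_mul m _ _ _ _ (h 0) (ih _ fun i => h i.succ)

lemma commWith_pow_apply (q : ℕ) (x : A) : (commWith (K := K) m ^ q) x =
    ∑ j ∈ Finset.range (q + 1), ((-1) ^ (q - j) * (q.choose j : K)) • (m ^ (q - j) * x * m ^ j) := by
  have hc : Commute (LinearMap.mulRight K m) (-LinearMap.mulLeft K m) := by
    refine Commute.neg_right ?_
    ext x; simp [mul_assoc]
  have hR : ∀ j : ℕ, ∀ x, (LinearMap.mulRight K m ^ j) x = x * m ^ j := fun j x => by
    rw [LinearMap.pow_mulRight]; rfl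
  have hL : ∀ j : ℕ, ∀ x, ((-LinearMap.mulLeft K m) ^ j) x = (-1 : K) ^ j • (m ^ j * x) :=
    fun j x => by
      rw [← neg_one_smul K, smul_pow, LinearMap.pow_mulLeft]; rfl
  rw [commWith, sub_eq_add_neg, hc.add_pow, LinearMap.sum_apply]
  refine Finset.sum_congr rfl fun j _ => ?_
  have hn : ((q.choose j : ℕ) : Module.End K A) x = (q.choose j : K) • x := by
    rw [Nat.cast_smul_eq_nsmul K]
    exact Module.End.natCast_apply _ _
  rw [Module.End.mul_apply, Module.End.mul_apply, hR, hL, hn, mul_smul_comm, smul_smul,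
    smul_mul_assoc]

end Order

variable {K : Type*} [Field K] {r n : ℕ}

section Action

variable {T : Type*} [AddCommGroup T] [Module K T] [Module (Ring' K r n) T]
  [IsScalarTower K (Ring' K r n) T] {E : Fin r → Module.End K T} {lam : Fin r → K}

/-- The span of the joint eigenvectors all of whose eigenvalues satisfy `p`. -/
def eigenSpan (E : Fin r → Module.End K T) (p : Fin r → K → Prop) : Submodule K T :=
  Submodule.span K {t | ∃ ε : Fin r → K, (∀ i, p i (ε i)) ∧ ∀ i, E i t = ε i • t}

lemma exists_eigen_sum {p : Fin r → K → Prop} {u : T} (hu : u ∈ eigenSpan E p) :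
    ∃ (m : ℕ) (ε : Fin m → Fin r → K) (w : Fin m → T), (∀ k i, p i (ε k i)) ∧
      (∀ k i, E i (w k) = ε k i • w k) ∧ ∑ k, w k = u := by
  obtain ⟨m, c, g, rfl⟩ := Submodule.mem_span_set'.1 hu
  choose ε h1 h2 using fun k => (g k).2
  exact ⟨m, ε, fun k => c k • (g k : T), h1, fun k i => by rw [map_smul, h2, smul_comm], rfl⟩

open Classical in
/-- The product of the operators `E i` with `lam i = 0`. -/
noncomputable def eulerProd (E : Fin r → Module.End K T) (lam : Fin r → K) : Module.End K T :=
  (List.ofFn fun i => if lam i = 0 then E i else 1).prod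

open Classical in
lemma eulerProd_apply {ε : Fin r → K} {t : T} (ht : ∀ i, E i t = ε i • t) :
    eulerProd E lam t = (∏ i, if lam i = 0 then ε i else 1) • t := by
  rw [eulerProd, ofFn_prod_apply_eigen]
  intro i
  split_ifs
  · exact ht i
  · simp

variable (r) in
/-- The invariant polynomial that vanishes where a linear form does not separate points. -/
noncomputable def sepPoly (l : Fin n → K) : Ring' K r n := linProd r l * linDisc r l

lemma sepPoly_mem (l : Fin n → K) : sepPoly r l ∈ inv K r n :=
  mul_mem (linProd_mem l) (linDisc_mem l)

lemma smul_eulerProd_mem [CharZero K] (hE : IsEuler n E) {e : ℕ} {N : Submodule K T}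
    (hN : Stable (fun β : {β : Fin n →₀ ℕ // e ≤ β.degree} => act E lam β.1) N)
    (hspan : eigenSpan E (fun _ x => x ≠ 0) = ⊤)
    (hlam : ∀ i, lam i ≠ 1) {G : Ring' K r n} (hG : G ∈ inv K r n) (l : Fin n → K) {u : T}
    (hu : u ∈ N) : (G * sepPoly r l ^ (2 * e + 2 * r + 2)) • eulerProd E lam u ∈ N := by
  classical
  obtain ⟨m, ε, w, _, h2, rfl⟩ := exists_eigen_sum (hspan ▸ Submodule.mem_top : u ∈ eigenSpan E _)
  -- The additional factors `linProd ^ 2` and `linDisc ^ (2 * e)` bring both exponents to `2 * e + 2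
  -- * r + 2`, so that a power of `sepPoly` results.
  have := sum_smul_mem_of_act_mem hE hN Finset.univ ε w (fun k _ => h2 k) hu hlam
    (mul_mem hG (mul_mem (pow_mem (linProd_mem l) 2) (pow_mem (linDisc_mem l) (2 * e)))) l
  rw [map_sum, Finset.smul_sum]
  convert this using 2 with k
  rw [eulerProd_apply (h2 k), smul_smul_comm']
  congr 2
  rw [sepPoly]; ring

/-- This is the binomial expansion of the vanishing iterated commutator of `eulerProd` with
multiplication by `φ`. It expresses `φ ^ (2 * r + 1) • eulerProd E lam t` through the terms with `j
≥ 1`, in which `eulerProd` is applied to multiples of `φ • t`. -/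
lemma eulerProd_order (hE : IsEuler n E) (φ : Ring' K r n) (t : T) :
    ∑ j ∈ Finset.range (2 * r + 2), ((-1) ^ (2 * r + 1 - j) * ((2 * r + 1).choose j : K)) •
      (φ ^ (2 * r + 1 - j) • eulerProd E lam (φ ^ j • t)) = 0 := by
  classical
  have h := commWith_pow_ofFn_prod (K := K) (Algebra.lsmul K K T φ)
    (fun i => if lam i = 0 then E i else 1) (fun i => by
      rw [pow_two, Module.End.mul_apply]
      split_ifs
      · have : commWith (K := K) (Algebra.lsmul K K T φ) (E i) = Algebra.lsmul K K T (eul i φ) := by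
          ext t
          simp [commWith_apply, hE i φ t]
        rw [this, commWith_apply, ← map_mul, ← map_mul, mul_comm, sub_self]
      · simp [commWith_apply])
  rw [commWith_pow_apply] at h
  have h2 := LinearMap.congr_fun h t
  rw [LinearMap.sum_apply] at h2
  simpa [← map_pow, eulerProd] using h2

/-- By `smul_eulerProd_mem` the conclusion holds for `eulerProd E lam u`. The elements with the
desired property form a subspace stable under `eulerProd`. Since the eigenvalues occurring in `u`
are nonzero, `u` is a polynomial in `eulerProd` applied to `eulerProd E lam u`. -/
lemma exists_sepPoly_pow_smul_mem [CharZero K] (hE : IsEuler n E) {e : ℕ} {N : Submodule K T}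
    (hN : Stable (fun β : {β : Fin n →₀ ℕ // e ≤ β.degree} => act E lam β.1) N)
    (hspan : eigenSpan E (fun _ x => x ≠ 0) = ⊤)
    (hlam : ∀ i, lam i ≠ 1) (l : Fin n → K) {u : T} (hu : u ∈ N) :
    ∃ c : ℕ, ∀ G ∈ inv K r n, (G * sepPoly r l ^ c) • u ∈ N := by
  classical
  set f := sepPoly r l with hf
  have hfm : ∀ c : ℕ, f ^ c ∈ inv K r n := fun c => pow_mem (sepPoly_mem l) c
  let X' : Submodule K T :=
    { carrier := {t | ∃ c : ℕ, ∀ G ∈ inv K r n, (G * f ^ c) • t ∈ N}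
      zero_mem' := ⟨0, fun G _ => by simp⟩
      add_mem' := by
        rintro a b ⟨c, hc⟩ ⟨d, hd⟩
        refine ⟨c + d, fun G hG => ?_⟩
        rw [smul_add]
        refine N.add_mem ?_ ?_
        · have := hc (G * f ^ d) (mul_mem hG (hfm _))
          rwa [mul_assoc, ← pow_add, add_comm d] at this
        · have := hd (G * f ^ c) (mul_mem hG (hfm _))
          rwa [mul_assoc, ← pow_add] at this
      smul_mem' := by
        rintro x t ⟨c, hc⟩
        exact ⟨c, fun G hG => by rw [smul_smul_comm']; exact N.smul_mem _ (hc G hG)⟩ }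
  -- In `eulerProd_order` with `φ = f ^ c`, the vectors `φ ^ j • t` with `j ≥ 1` lie in `N`, so
  -- `smul_eulerProd_mem` controls all terms except the one with `j = 0`.
  have hB : ∀ t ∈ X', eulerProd E lam t ∈ X' := by
    rintro t ⟨c, hc⟩
    refine ⟨(2 * e + 2 * r + 2) + c * (2 * r + 1), fun G hG => ?_⟩
    have h := eulerProd_order (lam := lam) hE (f ^ c) t
    rw [Finset.sum_range_succ', add_eq_zero_iff_eq_neg'] at h
    simp only [Nat.sub_zero, Nat.choose_zero_right, Nat.cast_one, mul_one, pow_zero, one_smul] at h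
    have h1 : (G * f ^ (2 * e + 2 * r + 2)) •
      ((-1 : K) ^ (2 * r + 1) • (f ^ c) ^ (2 * r + 1) • eulerProd E lam t) ∈ N := by
      rw [h, smul_neg, Finset.smul_sum]
      refine N.neg_mem (N.sum_mem fun j _ => ?_)
      rw [smul_smul_comm', smul_smul]
      refine N.smul_mem _ ?_
      rw [mul_right_comm]
      refine smul_eulerProd_mem hE hN hspan hlam (mul_mem hG ?_) l ?_
      · exact pow_mem (hfm _) _
      · have := hc ((f ^ c) ^ j) (pow_mem (hfm _) _)
        rwa [← pow_succ] at this
    rw [smul_smul_comm', Submodule.smul_mem_iff _ (by simp), smul_smul, ← pow_mul, mul_assoc,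
      ← pow_add] at h1
    exact h1
  have hBu : eulerProd E lam u ∈ X' :=
    ⟨_, fun G hG => smul_eulerProd_mem hE hN hspan hlam hG l hu⟩
  obtain ⟨m, ε, w, h1, h2, hw⟩ := exists_eigen_sum (hspan ▸ Submodule.mem_top : u ∈ eigenSpan E _)
  let b : Fin m → K := fun k => ∏ i, if lam i = 0 then ε k i else 1
  have hb : ∀ k, b k ≠ 0 := fun k => Finset.prod_ne_zero_iff.2 fun i _ => by
    split_ifs
    · exact h1 k i
    · exact one_ne_zero
  -- This polynomial in `eulerProd` annihilates `u` and has constant coefficient `1`; solving for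
  -- `u` exhibits it as an element of `X'`.
  let p : Polynomial K := ∏ k, (1 - Polynomial.C (b k)⁻¹ * Polynomial.X)
  have hp0 : p.coeff 0 = 1 := by
    rw [Polynomial.coeff_zero_eq_eval_zero, Polynomial.eval_prod]; simp
  have hpu : Polynomial.aeval (eulerProd E lam) p u = 0 := by
    rw [← hw, map_sum]
    refine Finset.sum_eq_zero fun k _ => ?_
    rw [Module.End.aeval_apply_of_mem_apply_eq_smul (μ := b k)]
    · rw [Polynomial.eval_prod, Finset.prod_eq_zero (Finset.mem_univ k), zero_smul]
      simp [hb k]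
    · exact eulerProd_apply (h2 k)
  have hinv : ∀ (q : Polynomial K), ∀ t ∈ X', Polynomial.aeval (eulerProd E lam) q t ∈ X' := by
    intro q t ht
    induction q using Polynomial.induction_on' with
    | add p q hp hq => rw [map_add]; exact X'.add_mem hp hq
    | monomial j c =>
      rw [Polynomial.aeval_monomial, Module.End.mul_apply, Module.algebraMap_end_apply]
      refine X'.smul_mem _ ?_
      clear hBu hpu
      induction j with
      | zero => simpa
      | succ j ih => rw [pow_succ', Module.End.mul_apply]; exact hB _ ih
  rw [← Polynomial.divX_mul_X_add p, hp0, map_add, map_mul, Polynomial.aeval_X, map_one, map_one,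
    LinearMap.add_apply, Module.End.mul_apply, Module.End.one_apply] at hpu
  have : u ∈ X' := by
    rw [eq_neg_of_add_eq_zero_right hpu]
    exact X'.neg_mem (hinv _ _ hBu)
  exact this

end Action

end MultiPoly

/-! ### Symmetric polynomials, degenerate configurations, and reduction to them -/

namespace MultiPoly

open MvPolynomial StableNoetherian

variable {K : Type*} [Field K] {r n : ℕ}

/-- The coordinate `X (i, a)` is a root of the monic polynomial `∏ j, (T - X (j, a))`, whose
coefficients are symmetric. -/
instance finite_inv : Module.Finite (inv K r n) (Ring' K r n) := by
  have h1 : Algebra.FiniteType (inv K r n) (Ring' K r n) :=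
    Algebra.FiniteType.of_restrictScalars_finiteType K _ _
  have h2 : Algebra.IsIntegral (inv K r n) (Ring' K r n) := by
    have hX : ∀ p : Fin r × Fin n, IsIntegral (inv K r n) (X p : Ring' K r n) := by
      rintro ⟨i, a⟩
      let P : Polynomial (Ring' K r n) := ∏ j, (Polynomial.X - Polynomial.C (X (j, a)))
      have hP : P ∈ Polynomial.lifts (algebraMap (inv K r n) (Ring' K r n)) := by
        rw [Polynomial.lifts_iff_coeff_lifts]
        intro m
        suffices h : P.coeff m ∈ inv K r n from ⟨⟨_, h⟩, rfl⟩
        rw [mem_inv]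
        intro σ
        have : P.map ((rename (Prod.map σ id) : Ring' K r n →ₐ[K] Ring' K r n) : _ →+* _) = P := by
          simp only [P, Polynomial.map_prod, Polynomial.map_sub, Polynomial.map_X,
            Polynomial.map_C, RingHom.coe_coe, rename_X, Prod.map_apply, id]
          exact Equiv.prod_comp σ fun j => (Polynomial.X - Polynomial.C (X (j, a) : Ring' K r n))
        conv_rhs => rw [← this]
        rw [Polynomial.coeff_map]; rfl
      have hPm : P.Monic := Polynomial.monic_prod_of_monic _ _ fun j _ => Polynomial.monic_X_sub_C _
      obtain ⟨q, hq, _, hqm⟩ := Polynomial.lifts_and_natDegree_eq_and_monic hP hPm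
      refine ⟨q, hqm, ?_⟩
      rw [← Polynomial.eval_map, hq, Polynomial.eval_prod]
      exact Finset.prod_eq_zero (Finset.mem_univ i) (by simp)
    refine ⟨fun f => ?_⟩
    induction f using MvPolynomial.induction_on with
    | C c => exact isIntegral_algebraMap (R := inv K r n) (x := algebraMap K _ c)
    | add f g hf hg => exact hf.add hg
    | mul_X f p hf => exact hf.mul (hX p)
  exact Algebra.IsIntegral.finite

/-- By the Artin–Tate lemma the invariants are a finitely generated algebra. -/
instance isNoetherianRing_inv : IsNoetherianRing (inv K r n) := by
  have h := fg_of_fg_of_fg K (inv K r n) (Ring' K r n) (Algebra.FiniteType.out)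
    (Module.Finite.fg_top) (FaithfulSMul.algebraMap_injective _ _)
  have : Algebra.FiniteType K (inv K r n) := ⟨h⟩
  exact Algebra.FiniteType.isNoetherianRing K _

/-- The coordinates of the `i`-th point (relative to the `j`-th one for `p = (i, some j)`). -/
noncomputable def coords (p : Fin r × Option (Fin r)) (a : Fin n) : Ring' K r n :=
  X (p.1, a) - p.2.elim 0 fun j => X (j, a)

variable (K n) in
/-- The ideal of the locus where the `i`-th point is the origin (the `j`-th point for
`p = (i, some j)`). -/
noncomputable def locus (p : Fin r × Option (Fin r)) : Ideal (Ring' K r n) :=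
  Ideal.span (Set.range (coords p))

variable (r) in
/-- The indices of the proper loci. -/
noncomputable def places : Finset (Fin r × Option (Fin r)) :=
  Finset.univ.filter fun p => p.2 ≠ some p.1

lemma sum_smul_coords (l : Fin n → K) (p : Fin r × Option (Fin r)) :
    ∑ a, l a • (coords p a : Ring' K r n) = lin l p.1 - p.2.elim 0 (lin l) := by
  rcases p with ⟨i, _ | j⟩ <;> simp [coords, lin, smul_sub, Finset.sum_sub_distrib]

/-- For every `l` the prime `Q` contains one of the linear factors of `sepPoly r l`. So the
subspaces of those `l` for which the factor at a given place lies in `Q` cover the space of linear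
forms. Over an infinite field one of these finitely many subspaces is everything. -/
lemma exists_locus_le [Infinite K] (Q : Ideal (Ring' K r n)) [hQ : Q.IsPrime]
    (h : ∀ l : Fin n → K, sepPoly r l ∈ Q) : ∃ p ∈ places r, locus K n p ≤ Q := by
  let W : {p // p ∈ places r} → Subspace K (Fin n → K) := fun p =>
    (Q.restrictScalars K).comap (Fintype.linearCombination K (coords p.1))
  have hW : ⋃ p, (W p : Set (Fin n → K)) = Set.univ := by
    refine Set.eq_univ_of_forall fun l => ?_
    simp only [W, Set.mem_iUnion, SetLike.mem_coe, Submodule.mem_comap,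
      Submodule.restrictScalars_mem, Fintype.linearCombination_apply, sum_smul_coords]
    rcases hQ.mem_or_mem (h l) with h | h
    · obtain ⟨i, _, hi⟩ := hQ.prod_mem_iff.1 h
      exact ⟨⟨(i, none), by simp [places]⟩, by simpa using hi⟩
    · obtain ⟨⟨i, j⟩, hij, hi⟩ := hQ.prod_mem_iff.1 h
      exact ⟨⟨(i, some j), by simpa [places, eq_comm] using hij⟩, by simpa using hi⟩
  obtain ⟨p, hp⟩ := Subspace.exists_eq_top_of_iUnion_eq_univ hW
  refine ⟨p.1, p.2, Ideal.span_le.2 ?_⟩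
  rintro _ ⟨a, rfl⟩
  classical
  have : Pi.single a 1 ∈ W p := hp ▸ Submodule.mem_top
  simpa [W, Fintype.linearCombination_apply_single] using this

lemma prod_locus_le_radical [Infinite K] (I : Ideal (Ring' K r n))
    (h : ∀ l : Fin n → K, sepPoly r l ∈ I) : ∏ p ∈ places r, locus K n p ≤ I.radical := by
  rw [Ideal.radical_eq_sInf]
  refine le_sInf fun Q hQ => ?_
  have := hQ.2
  obtain ⟨p, hp, hpQ⟩ := exists_locus_le Q fun l => hQ.1 (h l)
  exact (Ideal.prod_le_inf.trans (Finset.inf_le hp)).trans hpQ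

/-- A version of the Artin–Rees lemma for several ideals. -/
lemma exists_finset_inf_pow_smul_le {S T κ : Type*} [CommRing S] [IsNoetherianRing S]
    [AddCommGroup T] [Module S T] [Module.Finite S T] (s : Finset κ) (J : κ → Ideal S) (q : ℕ) :
    ∃ M : ℕ, s.inf (fun p => J p ^ M • (⊤ : Submodule S T)) ≤
      (∏ p ∈ s, J p) ^ q • (⊤ : Submodule S T) := by
  induction s using Finset.cons_induction with
  | empty => exact ⟨0, by simp [Ideal.top_pow]⟩
  | cons p s hp ih =>
    obtain ⟨M, hM⟩ := ih
    -- The Artin–Rees lemma is applied to `J p` and the submodule already obtained for the other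
    -- ideals.
    obtain ⟨c, hc⟩ := Ideal.exists_pow_inf_eq_pow_smul (J p)
      ((∏ p ∈ s, J p) ^ q • (⊤ : Submodule S T))
    have hmono : ∀ p, ∀ {a b : ℕ}, a ≤ b → J p ^ b • (⊤ : Submodule S T) ≤ J p ^ a • ⊤ :=
      fun p a b h => Submodule.smul_mono_left (Ideal.pow_le_pow_right h)
    refine ⟨max M (q + c), ?_⟩
    rw [Finset.inf_cons, Finset.prod_cons, mul_pow, mul_smul]
    refine (inf_le_inf (hmono p (le_max_right _ _)) ((Finset.inf_mono_fun fun p' _ =>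
      hmono p' (le_max_left _ _)).trans hM)).trans ?_
    rw [hc (q + c) (by omega), Nat.add_sub_cancel]
    exact Submodule.smul_mono le_rfl inf_le_right

section Action

variable {T : Type*} [AddCommGroup T] [Module K T] [Module (Ring' K r n) T]
  [IsScalarTower K (Ring' K r n) T] {E : Fin r → Module.End K T} {lam : Fin r → K}

variable (K r) in
/-- The vector field `x ^ β` times the Euler field, on the product of `r` copies of affine space. -/
noncomputable def vf (β : Fin n →₀ ℕ) : Derivation K (Ring' K r n) (Ring' K r n) :=
  ∑ i, slot (K := K) i β • eul i

lemma vf_apply (β : Fin n →₀ ℕ) (f : Ring' K r n) : vf K r β f = ∑ i, slot i β * eul i f := by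
  rw [vf, derivation_sum_apply]; rfl

lemma vf_X (β : Fin n →₀ ℕ) (i : Fin r) (a : Fin n) :
    vf K r β (X (i, a)) = slot i β * X (i, a) := by
  simp [vf_apply, eul_X]

lemma derivation_mem_pow {A : Type*} [CommRing A] [Algebra K A] (D : Derivation K A A) (J : Ideal A)
    (h : ∀ x ∈ J, D x ∈ J) (M : ℕ) : ∀ x ∈ J ^ M, D x ∈ J ^ M := by
  induction M with
  | zero => simp
  | succ M ih =>
    intro x hx
    rw [pow_succ] at hx ⊢
    refine Submodule.mul_induction_on hx (fun a ha b hb => ?_) fun a b ha hb => ?_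
    · rw [Derivation.leibniz]
      exact add_mem (Ideal.mul_mem_mul ha (h b hb)) (by
        rw [smul_eq_mul, mul_comm b]; exact Ideal.mul_mem_mul (ih a ha) hb)
    · rw [map_add]; exact add_mem ha hb

lemma rename_sub_rename_mem (i j : Fin r) (f : MvPolynomial (Fin n) K) :
    rename (Prod.mk i) f - rename (Prod.mk j) f ∈ locus K n (i, some j) := by
  rw [← Ideal.Quotient.mk_eq_mk_iff_sub_mem]
  have : (Ideal.Quotient.mkₐ K (locus K n (i, some j))).comp (rename (Prod.mk i)) =
      (Ideal.Quotient.mkₐ K (locus K n (i, some j))).comp (rename (Prod.mk j)) := by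
    refine MvPolynomial.algHom_ext fun a => ?_
    simp only [AlgHom.comp_apply, rename_X, Ideal.Quotient.mkₐ_eq_mk]
    rw [Ideal.Quotient.mk_eq_mk_iff_sub_mem]
    exact Ideal.subset_span ⟨a, rfl⟩
  exact AlgHom.congr_fun this f

/-- The field is tangent to the loci: it vanishes at the origin, and it is the same field in every
copy of affine space. -/
lemma vf_mem_locus (p : Fin r × Option (Fin r)) (β : Fin n →₀ ℕ) :
    ∀ x ∈ locus K n p, vf K r β x ∈
      locus K n p := by
  intro x hx
  refine Submodule.span_induction ?_ ?_ ?_ ?_ hx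
  · rintro _ ⟨a, rfl⟩
    have h0 : (coords p a : Ring' K r n) ∈ locus K n p := Ideal.subset_span ⟨a, rfl⟩
    rcases p with ⟨i, _ | j⟩
    · simp only [coords, Option.elim, sub_zero, vf_X] at h0 ⊢
      exact Ideal.mul_mem_left _ _ h0
    · simp only [coords, Option.elim, map_sub, vf_X] at h0 ⊢
      rw [show slot i β * X (i, a) - slot j β * X (j, a) = slot i β * (X (i, a) - X (j, a)) +
        X (j, a) * (slot i β - slot j β : Ring' K r n) by ring]
      exact add_mem (Ideal.mul_mem_left _ _ h0)
        (Ideal.mul_mem_left _ _ (rename_sub_rename_mem i j _))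
  · simp
  · intro x y _ _ hx hy; rw [map_add]; exact add_mem hx hy
  · intro f x hx' hx
    rw [smul_eq_mul, Derivation.leibniz]
    exact add_mem (Ideal.mul_mem_left _ _ hx) (Ideal.mul_mem_right _ _ hx')

lemma act_smul (hE : IsEuler n E) (β : Fin n →₀ ℕ) (f : Ring' K r n) (t : T) :
    act E lam β (f • t) = vf K r β f • t +
      f • act E lam β t := by
  rw [act_apply, act_apply, vf_apply, Finset.sum_smul, Finset.smul_sum,
    ← Finset.sum_add_distrib]
  refine Finset.sum_congr rfl fun i _ => ?_
  rw [hE, mul_smul (slot i β) (eul i f), smul_comm f (slot i β), ← smul_add, smul_add f,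
    smul_smul_comm' _ f, add_assoc]

lemma act_mem_smul_top (hE : IsEuler n E) {I : Ideal (Ring' K r n)} {β : Fin n →₀ ℕ}
    (hI : ∀ x ∈ I, vf K r β x ∈ I) (t : T) (ht : t ∈ I • (⊤ : Submodule (Ring' K r n) T)) :
    act E lam β t ∈ I • (⊤ : Submodule (Ring' K r n) T) := by
  refine Submodule.smul_induction_on ht (fun f hf t _ => ?_) fun a b ha hb => ?_
  · rw [act_smul hE]
    exact add_mem (Submodule.smul_mem_smul (hI f hf) trivial) (Submodule.smul_mem_smul hf trivial)
  · rw [map_add]; exact add_mem ha hb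

/-- Let `P` be the module over symmetric polynomials spanned by `N`; it is generated by a finite `S
⊆ N`. A power of the ideal `𝔣` of all `sepPoly r l` carries `P` into `gen ρ S`, so by Artin–Rees `N
∩ 𝔣 ^ m T ⊆ gen ρ S` for some `m`. The submodule `𝔣 ^ m T` contains an intersection of submodules
`locus ^ M T`, modulo which `N` is finitely generated by hypothesis. -/
theorem noeth_act_of_relNoeth_locus [CharZero K] [Module.Finite (Ring' K r n) T]
    (hE : IsEuler n E) (e : ℕ)
    (hspan : eigenSpan E (fun _ x => x ≠ 0) = ⊤) (hlam : ∀ i, lam i ≠ 1)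
    (h : ∀ p ∈ places r, ∀ M, RelNoeth (fun β : {β : Fin n →₀ ℕ // e ≤ β.degree} => act E lam β.1)
      ((locus K n p ^ M • (⊤ : Submodule (Ring' K r n) T)).restrictScalars K) ⊤) :
    Noeth (fun β : {β : Fin n →₀ ℕ // e ≤ β.degree} => act E lam β.1) := by
  classical
  set ρ := fun β : {β : Fin n →₀ ℕ // e ≤ β.degree} => act E lam β.1 with hρ
  intro N hN _
  have hfin : Module.Finite (inv K r n) T := Module.Finite.trans (Ring' K r n) T
  have hnoeth : IsNoetherian (inv K r n) T := inferInstance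
  let P : Submodule (inv K r n) T := Submodule.span _ (N : Set T)
  obtain ⟨S, hSN, hSP⟩ := (Submodule.fg_span_iff_fg_span_finset_subset (N : Set T)).1
    (IsNoetherian.noetherian P)
  -- This is the conductor of `P` into the subspace generated by `S`. It is an ideal although `gen ρ
  -- S` is only a `K`-subspace, because `P` is stable under multiplication by invariants.
  let 𝔥 : Ideal (inv K r n) :=
    { carrier := {x | ∀ t ∈ P, x • t ∈ gen ρ (S : Set T)}
      zero_mem' := fun t _ => by simp
      add_mem' := fun {a b} ha hb t ht => by rw [add_smul]; exact add_mem (ha t ht) (hb t ht)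
      smul_mem' := fun c x hx t ht => by
        rw [smul_eq_mul, mul_comm, mul_smul]; exact hx _ (P.smul_mem c ht) }
  let f : (Fin n → K) → inv K r n := fun l => ⟨sepPoly r l, sepPoly_mem l⟩
  have hf : ∀ l, f l ∈ 𝔥.radical := by
    intro l
    have h1 : ∀ t ∈ S, ∃ c : ℕ, ∀ G ∈ inv K r n, (G * sepPoly r l ^ c) • t ∈ gen ρ (S : Set T) :=
      fun t ht => exists_sepPoly_pow_smul_mem hE (stable_gen _) hspan hlam l (subset_gen _ ht)
    choose! c hc using h1
    refine ⟨S.sup c, fun t ht => ?_⟩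
    change t ∈ Submodule.span _ _ at ht
    rw [hSP] at ht
    suffices h2 : ∀ x : inv K r n, (x * f l ^ S.sup c) • t ∈ gen ρ (S : Set T) by
      simpa using h2 1
    refine Submodule.span_induction ?_ ?_ ?_ ?_ ht
    · intro s hs x
      have h3 := hc s hs _ (x * f l ^ (S.sup c - c s)).2
      have h4 : x * f l ^ S.sup c = x * f l ^ (S.sup c - c s) * f l ^ c s := by
        rw [mul_assoc, ← pow_add, Nat.sub_add_cancel (Finset.le_sup hs)]
      rw [h4]
      exact h3
    · simp
    · intro a b _ _ ha hb x; rw [smul_add]; exact add_mem (ha x) (hb x)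
    · intro a s _ hs x
      rw [smul_smul, mul_right_comm]
      exact hs _
  let 𝔣 : Ideal (inv K r n) := Ideal.span (Set.range f)
  obtain ⟨C, hC⟩ := Ideal.exists_pow_le_of_le_radical_of_fg (I := 𝔣) (J := 𝔥)
    (Ideal.span_le.2 (by rintro _ ⟨l, rfl⟩; exact hf l)) (IsNoetherian.noetherian _)
  obtain ⟨c, hc⟩ := Ideal.exists_pow_inf_eq_pow_smul 𝔣 P
  obtain ⟨a, ha⟩ := Ideal.exists_pow_le_of_le_radical_of_fg
    (prod_locus_le_radical (K := K) (r := r) (n := n) (𝔣.map (algebraMap (inv K r n) (Ring' K r n)))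
      fun l => Ideal.mem_map_of_mem _ (Ideal.subset_span ⟨l, rfl⟩ : f l ∈ 𝔣))
    (IsNoetherian.noetherian _)
  -- The product of the loci to the power `a` lies in the extension of `𝔣`; the exponent `c` is lost
  -- in Artin–Rees, and `𝔣 ^ C` lies in the conductor.
  obtain ⟨M, hM⟩ := exists_finset_inf_pow_smul_le (T := T) (places r) (locus K n) (a * (C + c))
  have hA := relNoeth_finset_inf (ρ := ρ) (places r)
    (fun p => (locus K n p ^ M • (⊤ : Submodule (Ring' K r n) T)).restrictScalars K)
    (fun p _ β t ht => act_mem_smul_top hE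
      (derivation_mem_pow _ _ (vf_mem_locus p β.1) M) t ht) fun p hp => h p hp M
  obtain ⟨S', hS', h'⟩ := hA N hN le_top
  refine ⟨S ∪ S', by rw [Finset.coe_union]; exact Set.union_subset hSN hS', ?_⟩
  rw [bot_sup_eq]
  refine (le_inf_sup_gen hN hS' h').trans (le_trans (sup_le_sup_right ?_ _) (gen_union S S'))
  rintro t ⟨htN, htA⟩
  have h1 : t ∈ (𝔣.map (algebraMap (inv K r n) (Ring' K r n))) ^ (C + c) •
      (⊤ : Submodule (Ring' K r n) T) := by
    refine (Submodule.smul_mono_left ?_) (hM ?_)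
    · rw [pow_mul]; exact Ideal.pow_right_mono ha _
    · simp only [SetLike.mem_coe, Submodule.mem_finsetInf, Submodule.restrictScalars_mem] at htA ⊢
      exact htA
  have h2 : t ∈ 𝔣 ^ (C + c) • (⊤ : Submodule (inv K r n) T) := by
    have := Ideal.smul_restrictScalars (S := Ring' K r n) (M := T) (𝔣 ^ (C + c)) ⊤
    rw [Ideal.map_pow] at this
    rw [← Submodule.restrictScalars_top (inv K r n) (Ring' K r n) T, ← this]
    exact h1
  have h3 : t ∈ 𝔣 ^ C • P := by
    have : t ∈ 𝔣 ^ (C + c) • (⊤ : Submodule (inv K r n) T) ⊓ P := ⟨h2, Submodule.subset_span htN⟩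
    rw [hc (C + c) (by omega), Nat.add_sub_cancel] at this
    exact Submodule.smul_mono le_rfl inf_le_right this
  refine Submodule.smul_induction_on h3 (fun x hx t ht => hC hx t ht) fun _ _ => add_mem

end Action

end MultiPoly

/-! ### From the quotient by an ideal to the quotients by its powers -/

namespace MultiPoly

open MvPolynomial StableNoetherian

variable {K : Type*} [Field K] {r n : ℕ}

/-- A combination of the monomials `x ^ β` in the groups of variables. -/
noncomputable def weight (c d : Fin r → ℕ) (β : Fin n →₀ ℕ) : Ring' K r n :=
  ∑ i, ((c i : K) + d i * (β.degree : K)) • slot i β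

lemma weight_add (c d c' d' : Fin r → ℕ) (β : Fin n →₀ ℕ) :
    (weight (c + c') (d + d') β : Ring' K r n) = weight c d β + weight c' d' β := by
  simp only [weight, ← Finset.sum_add_distrib, ← add_smul]
  refine Finset.sum_congr rfl fun i _ => ?_
  simp only [Pi.add_apply, Nat.cast_add]
  congr 1; ring

lemma weight_zero (β : Fin n →₀ ℕ) : (weight 0 0 β : Ring' K r n) = 0 := by simp [weight]

lemma weight_single (j : Fin r) (c d : ℕ) (β : Fin n →₀ ℕ) :
    (weight (Pi.single j c) (Pi.single j d) β : Ring' K r n) =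
      ((c : K) + d * (β.degree : K)) • slot j β := by
  rw [weight, Finset.sum_eq_single j]
  · simp
  · intro i _ hi; simp [hi]
  · simp

section Filtration

variable {Y Z : Ideal (Ring' K r n)} {yc yd zc : Fin r → ℕ} {e : ℕ}

/-- `μ` is a product of `s` generators of `Z` and `t` generators of `Y`, to first order. -/
def IsProduct (Y Z : Ideal (Ring' K r n)) (yc yd zc : Fin r → ℕ) (e s t : ℕ) (μ : Ring' K r n) :
    Prop :=
  μ ∈ Z ^ s * Y ^ t ∧ ∀ β : Fin n →₀ ℕ, e ≤ β.degree →
    vf K r β μ - weight (s • zc + t • yc) (t • yd) β * μ ∈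
      Z ^ (s + 1) * Y ^ (t - 1) ⊔ Y ^ (s + t + 1)

lemma pow_mul_pow_le (hZY : Z ≤ Y) {s t m : ℕ} (h : m ≤ s + t) : Z ^ s * Y ^ t ≤ Y ^ m :=
  (Ideal.mul_mono (Ideal.pow_right_mono hZY s) le_rfl).trans
    (by rw [← pow_add]; exact Ideal.pow_le_pow_right h)

/-- By the Leibniz rule the weights add, and each error term gains either a factor from `Z` in
exchange for one from `Y`, or a further power of `Y`. -/
lemma IsProduct.mul (hZY : Z ≤ Y) {s t s' t' : ℕ} {μ μ' : Ring' K r n}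
    (h : IsProduct Y Z yc yd zc e s t μ) (h' : IsProduct Y Z yc yd zc e s' t' μ') :
    IsProduct Y Z yc yd zc e (s + s') (t + t') (μ * μ') := by
  have key : ∀ {s t s' t' : ℕ} {x y : Ring' K r n}, x ∈ Z ^ s * Y ^ t →
      y ∈ Z ^ (s' + 1) * Y ^ (t' - 1) ⊔ Y ^ (s' + t' + 1) →
      x * y ∈ Z ^ (s + s' + 1) * Y ^ (t + t' - 1) ⊔ Y ^ (s + s' + (t + t') + 1) := by
    intro s t s' t' x y hx hy
    have h1 := Ideal.mul_mem_mul hx hy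
    rw [Ideal.mul_sup] at h1
    refine SetLike.le_def.1 (sup_le_sup ?_ ?_) h1
    · rw [mul_mul_mul_comm, ← pow_add, ← pow_add, add_assoc]
      exact Ideal.mul_mono le_rfl (Ideal.pow_le_pow_right (by omega))
    · refine (Ideal.mul_mono (pow_mul_pow_le hZY le_rfl) le_rfl).trans ?_
      rw [← pow_add]
      exact Ideal.pow_le_pow_right (by omega)
  refine ⟨?_, fun β hβ => ?_⟩
  · have := Ideal.mul_mem_mul h.1 h'.1
    rwa [mul_mul_mul_comm, ← pow_add, ← pow_add] at this
  · have e1 : (weight ((s + s') • zc + (t + t') • yc) ((t + t') • yd) β : Ring' K r n) =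
        weight (s • zc + t • yc) (t • yd) β + weight (s' • zc + t' • yc) (t' • yd) β := by
      rw [← weight_add]; congr 1
      · simp only [add_smul]; abel
      · rw [add_smul]
    rw [e1, Derivation.leibniz, smul_eq_mul, smul_eq_mul]
    have e2 : ∀ a b c d : Ring' K r n, μ * b + μ' * a - (c + d) * (μ * μ') =
      μ' * (a - c * μ) + μ * (b - d * μ') := fun a b c d => by ring
    rw [e2]
    refine add_mem ?_ (key h.1 (h'.2 β hβ))
    rw [add_comm s, add_comm t]
    exact key h'.1 (h.2 β hβ)

lemma IsProduct.one : IsProduct Y Z yc yd zc e 0 0 (1 : Ring' K r n) := by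
  refine ⟨by simp, fun β _ => ?_⟩
  have : (weight (0 • zc + 0 • yc) (0 • yd) β : Ring' K r n) = 0 := by
    rw [zero_smul, zero_smul, zero_smul, add_zero, weight_zero]
  rw [this]
  simp

lemma exists_isProduct_span (hZY : Z ≤ Y) (y z : Finset (Ring' K r n))
    (hy : Ideal.span (y : Set (Ring' K r n)) = Y) (hz : Ideal.span (z : Set (Ring' K r n)) = Z)
    (hy' : ∀ μ ∈ y, IsProduct Y Z yc yd zc e 0 1 μ) (hz' : ∀ μ ∈ z, IsProduct Y Z yc yd zc e 1 0 μ)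
    (s t : ℕ) : ∃ G : Finset (Ring' K r n), Ideal.span (G : Set (Ring' K r n)) = Z ^ s * Y ^ t ∧
      ∀ μ ∈ G, IsProduct Y Z yc yd zc e s t μ := by
  classical
  induction s with
  | zero =>
    induction t with
    | zero => exact ⟨{1}, by simp, by simpa using IsProduct.one⟩
    | succ t ih =>
      obtain ⟨G, hG, hG'⟩ := ih
      refine ⟨Finset.image₂ (· * ·) G y, ?_, ?_⟩
      · rw [Finset.coe_image₂, Set.image2_mul, ← Ideal.span_mul_span', hG, hy, pow_succ, mul_assoc]
      · intro μ hμ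
        obtain ⟨a, ha, b, hb, rfl⟩ := Finset.mem_image₂.1 hμ
        have := (hG' a ha).mul hZY (hy' b hb)
        rwa [add_zero] at this
  | succ s ih =>
    obtain ⟨G, hG, hG'⟩ := ih
    refine ⟨Finset.image₂ (· * ·) G z, ?_, ?_⟩
    · rw [Finset.coe_image₂, Set.image2_mul, ← Ideal.span_mul_span', hG, hz, pow_succ, mul_right_comm]
    · intro μ hμ
      obtain ⟨a, ha, b, hb, rfl⟩ := Finset.mem_image₂.1 hμ
      have := (hG' a ha).mul hZY (hz' b hb)
      rwa [add_zero] at this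

section Action

variable {T : Type*} [AddCommGroup T] [Module K T] [Module (Ring' K r n) T]
  [IsScalarTower K (Ring' K r n) T] {E : Fin r → Module.End K T} {lam : Fin r → K}

lemma restrict_smul_top_le {I : Ideal (Ring' K r n)} {A : Submodule K T}
    (h : ∀ f ∈ I, ∀ t : T, f • t ∈ A) :
    (I • (⊤ : Submodule (Ring' K r n) T)).restrictScalars K ≤ A := fun t ht =>
  Submodule.smul_induction_on (p := fun t => t ∈ A) ((Submodule.restrictScalars_mem K _ t).1 ht)
    (fun f hf t _ => h f hf t) fun _ _ => A.add_mem

lemma smul_mem_restrict {I : Ideal (Ring' K r n)} {f : Ring' K r n} (hf : f ∈ I) (t : T) :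
    f • t ∈ (I • (⊤ : Submodule (Ring' K r n) T)).restrictScalars K :=
  (Submodule.restrictScalars_mem K _ _).2 (Submodule.smul_mem_smul hf trivial)

/-- Euler operators, shifted by integers. -/
def shift (E : Fin r → Module.End K T) (c : Fin r → ℕ) (i : Fin r) : Module.End K T :=
  E i + (c i : K) • 1

lemma IsEuler.shift (hE : IsEuler n E) (c : Fin r → ℕ) : IsEuler n (shift E c) := by
  intro i f t
  simp only [MultiPoly.shift, LinearMap.add_apply, LinearMap.smul_apply, Module.End.one_apply,
    smul_add, hE i f t, smul_smul_comm']
  abel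

/-- If `μ` is an approximate eigenvector of the vector fields with weight `c i + d i * |β|` at each
point, then multiplication by `μ` is an approximate intertwiner from the action with Euler operators
shifted by `c` and parameters shifted by `d`. -/
lemma act_smul_sub (hE : IsEuler n E) (c d : Fin r → ℕ) (β : Fin n →₀ ℕ) (μ : Ring' K r n) (t : T) :
    act E lam β (μ • t) - μ • act (shift E c) (fun i => lam i + d i) β t =
      (vf K r β μ - weight c d β * μ) • t := by
  have h : act (shift E c) (fun i => lam i + d i) β t = act E lam β t +
      (weight c d β : Ring' K r n) • t := by
    rw [act_apply, act_apply, weight, Finset.sum_smul, ← Finset.sum_add_distrib]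
    refine Finset.sum_congr rfl fun i _ => ?_
    rw [smul_assoc, ← smul_smul_comm', ← smul_add]
    congr 1
    simp only [shift, LinearMap.add_apply, LinearMap.smul_apply, Module.End.one_apply, add_mul,
      add_smul]
    abel
  rw [act_smul hE, h, smul_add, sub_smul, smul_smul, mul_comm μ]
  abel

/-- The generators are adjoined to `I` one at a time. Each contributes an image of `T / J T` under
multiplication by `μ`, for a shifted action. -/
lemma relNoeth_sup_span (hE : IsEuler n E) (J I : Ideal (Ring' K r n))
    (hI : ∀ β : Fin n →₀ ℕ, e ≤ β.degree → ∀ x ∈ I, vf K r β x ∈ I)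
    (hT : ∀ c d : Fin r → ℕ, RelNoeth (fun β : {β : Fin n →₀ ℕ // e ≤ β.degree} =>
      act (shift E c) (fun i => lam i + d i) β.1)
      ((J • (⊤ : Submodule (Ring' K r n) T)).restrictScalars K) ⊤)
    (G : Finset (Ring' K r n)) (hG : ∀ μ ∈ G, (∀ x ∈ J, x * μ ∈ I) ∧
      ∃ c d : Fin r → ℕ, ∀ β : Fin n →₀ ℕ, e ≤ β.degree → vf K r β μ - weight c d β * μ ∈ I) :
    RelNoeth (fun β : {β : Fin n →₀ ℕ // e ≤ β.degree} => act E lam β.1)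
      ((I • (⊤ : Submodule (Ring' K r n) T)).restrictScalars K)
      (((I ⊔ Ideal.span (G : Set (Ring' K r n))) • (⊤ : Submodule (Ring' K r n) T)).restrictScalars
        K) := by
  induction G using Finset.cons_induction with
  | empty => simpa using relNoeth_self _
  | cons μ G hμ ih =>
    have ih := ih fun μ' h' => hG μ' (by simp [h'])
    obtain ⟨hμJ, c, d, hcd⟩ := hG μ (by simp)
    set I' := I ⊔ Ideal.span (G : Set (Ring' K r n)) with hI'
    have hst : Stable (fun β : {β : Fin n →₀ ℕ // e ≤ β.degree} => act E lam β.1)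
        ((I' • (⊤ : Submodule (Ring' K r n) T)).restrictScalars K) := by
      intro β t ht
      refine act_mem_smul_top hE (fun x hx => ?_) t ht
      obtain ⟨a, ha, b, hb, rfl⟩ := Submodule.mem_sup.1 hx
      rw [map_add]
      refine add_mem (Ideal.mem_sup_left (hI _ β.2 a ha)) ?_
      refine Submodule.span_induction ?_ ?_ ?_ ?_ hb
      · intro μ' hμ'
        obtain ⟨c, d, h⟩ := (hG μ' (by simp [Finset.mem_coe.1 hμ'])).2
        rw [← sub_add_cancel (vf K r β.1 μ') (weight c d β.1 * μ')]
        exact add_mem (Ideal.mem_sup_left (h _ β.2))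
          (Ideal.mul_mem_left _ _ (Ideal.mem_sup_right (Ideal.subset_span hμ')))
      · simp
      · intro x y _ _ hx hy; rw [map_add]; exact add_mem hx hy
      · intro f x hx' hx
        rw [smul_eq_mul, Derivation.leibniz]
        exact add_mem (Ideal.mul_mem_left _ _ hx)
          (Ideal.mul_mem_right _ _ (Ideal.mem_sup_right hx'))
    refine ih.trans ?_ hst
    have h2 := RelNoeth.sup_range (A := (I' • (⊤ : Submodule (Ring' K r n) T)).restrictScalars K)
      (ρ := fun β : {β : Fin n →₀ ℕ // e ≤ β.degree} => act E lam β.1) (hT c d)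
      (Algebra.lsmul K K T μ) (fun β t => ?_) hst ?_
    · refine h2.mono le_rfl ?_
      rw [Finset.coe_cons, Set.insert_eq, Ideal.span_union, sup_comm (Ideal.span _), ← sup_assoc,
        ← hI']
      refine restrict_smul_top_le fun f hf t => ?_
      obtain ⟨a, ha, b, hb, rfl⟩ := Submodule.mem_sup.1 hf
      obtain ⟨g, rfl⟩ := Ideal.mem_span_singleton'.1 hb
      rw [add_smul]
      refine Submodule.add_mem_sup (smul_mem_restrict ha t) ⟨g • t, ?_⟩
      change μ • g • t = _
      rw [smul_smul, mul_comm]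
    · rw [← neg_mem_iff, neg_sub]
      have h3 := act_smul_sub (lam := lam) hE c d β.1 μ t
      have h4 := smul_mem_restrict (I := I') (Ideal.mem_sup_left (hcd _ β.2)) t
      rw [← h3] at h4
      exact h4
    · rw [Submodule.map_le_iff_le_comap]
      refine restrict_smul_top_le fun f hf t => ?_
      have h4 := smul_mem_restrict (I := I') (Ideal.mem_sup_left (hμJ f hf)) t
      rw [mul_comm, mul_smul] at h4
      exact h4

/-- The generators of `Y` are eigenvectors of the vector fields only modulo `Z` and `Y ^ 2`. So the
step from `Y ^ (M + 1)` to `Y ^ M` is refined by the ideals `Z ^ s * Y ^ t` with `s + t = M`;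
passing to larger `s` absorbs the error, and each layer is generated by products that are
eigenvectors. -/
lemma relNoeth_pow (hE : IsEuler n E) (hZY : Z ≤ Y) (y z : Finset (Ring' K r n))
    (hy : Ideal.span (y : Set (Ring' K r n)) = Y) (hz : Ideal.span (z : Set (Ring' K r n)) = Z)
    (hy' : ∀ μ ∈ y, IsProduct Y Z yc yd zc e 0 1 μ) (hz' : ∀ μ ∈ z, IsProduct Y Z yc yd zc e 1 0 μ)
    (hYs : ∀ β : Fin n →₀ ℕ, ∀ x ∈ Y, vf K r β x ∈ Y)
    (hZs : ∀ β : Fin n →₀ ℕ, ∀ x ∈ Z, vf K r β x ∈ Z)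
    (hT : ∀ c d : Fin r → ℕ, RelNoeth (fun β : {β : Fin n →₀ ℕ // e ≤ β.degree} =>
      act (shift E c) (fun i => lam i + d i) β.1)
      ((Y • (⊤ : Submodule (Ring' K r n) T)).restrictScalars K) ⊤) (M : ℕ) :
    RelNoeth (fun β : {β : Fin n →₀ ℕ // e ≤ β.degree} => act E lam β.1)
      ((Y ^ M • (⊤ : Submodule (Ring' K r n) T)).restrictScalars K) ⊤ := by
  have hst : ∀ (s t m : ℕ) (β : Fin n →₀ ℕ), ∀ x ∈ Z ^ s * Y ^ t ⊔ Y ^ m,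
      vf K r β x ∈ Z ^ s * Y ^ t ⊔ Y ^ m := by
    intro s t m β x hx
    obtain ⟨a, ha, b, hb, rfl⟩ := Submodule.mem_sup.1 hx
    rw [map_add]
    refine add_mem (Ideal.mem_sup_left ?_)
      (Ideal.mem_sup_right (derivation_mem_pow _ _ (hYs β) m b hb))
    refine Submodule.mul_induction_on ha (fun u hu v hv => ?_) fun u v hu hv => ?_
    · rw [Derivation.leibniz, smul_eq_mul, smul_eq_mul, mul_comm v]
      exact add_mem (Ideal.mul_mem_mul hu (derivation_mem_pow _ _ (hYs β) t v hv))
        (Ideal.mul_mem_mul (derivation_mem_pow _ _ (hZs β) s u hu) hv)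
    · rw [map_add]; exact add_mem hu hv
  induction M with
  | zero =>
    simp only [pow_zero, Ideal.one_eq_top, Submodule.top_smul, Submodule.restrictScalars_top]
    exact relNoeth_self _
  | succ M ih =>
    -- For `t = 0` the truncated exponent `t - 1` in `IsProduct` is harmless, as the error then lies
    -- in `Z ^ (M + 1) ⊔ Y ^ (M + 1) = Y ^ (M + 1)`.
    have key : ∀ t s : ℕ, s + t = M →
        RelNoeth (fun β : {β : Fin n →₀ ℕ // e ≤ β.degree} => act E lam β.1)
        ((Y ^ (M + 1) • (⊤ : Submodule (Ring' K r n) T)).restrictScalars K)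
        (((Z ^ s * Y ^ t ⊔ Y ^ (M + 1)) • (⊤ : Submodule (Ring' K r n) T)).restrictScalars K) := by
      intro t
      induction t with
      | zero =>
        intro s hs
        obtain ⟨G, hG, hG'⟩ := exists_isProduct_span hZY y z hy hz hy' hz' s 0
        rw [← hG, sup_comm]
        refine relNoeth_sup_span hE Y _ (fun β _ => derivation_mem_pow _ _ (hYs β) _) hT G
          fun μ hμ => ⟨fun x hx => ?_, s • zc + 0 • yc, 0 • yd, fun β hβ => ?_⟩
        · rw [pow_succ, mul_comm x]
          exact Ideal.mul_mem_mul (pow_mul_pow_le hZY hs.ge (hG' μ hμ).1) hx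
        · refine (sup_le ?_ ?_ : _ ≤ Y ^ (M + 1)) ((hG' μ hμ).2 β hβ)
          · exact pow_mul_pow_le hZY (by omega)
          · exact Ideal.pow_le_pow_right (by omega)
      | succ t ih =>
        intro s hs
        refine (ih (s + 1) (by omega)).trans ?_ fun β t ht => act_mem_smul_top hE (hst _ _ _ β.1) t ht
        obtain ⟨G, hG, hG'⟩ := exists_isProduct_span hZY y z hy hz hy' hz' s (t + 1)
        refine (relNoeth_sup_span hE Y _ (fun β _ => hst (s + 1) t (M + 1) β) hT G
          fun μ hμ => ⟨fun x hx => Ideal.mem_sup_right ?_, s • zc + (t + 1) • yc, (t + 1) • yd,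
            fun β hβ => ?_⟩).mono le_rfl ?_
        · rw [pow_succ, mul_comm x]
          exact Ideal.mul_mem_mul (pow_mul_pow_le hZY hs.ge (hG' μ hμ).1) hx
        · have := (hG' μ hμ).2 β hβ
          rwa [Nat.add_sub_cancel, hs] at this
        · rw [hG]
          exact restrict_smul_top_le fun f hf t => smul_mem_restrict
            (SetLike.le_def.1 (sup_le le_sup_right (le_sup_right.trans le_sup_left)) hf) t
    have h1 := key M 0 (by simp)
    rw [pow_zero, one_mul, sup_eq_left.2 (Ideal.pow_le_pow_right (Nat.le_succ M))] at h1
    exact h1.trans ih fun β t ht => act_mem_smul_top hE (derivation_mem_pow _ _ (hYs β.1) _) t ht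

end Action

end Filtration

end MultiPoly

/-! ### The infinitesimal neighbourhoods of the origin and of the diagonals -/

namespace MultiPoly

open MvPolynomial StableNoetherian

variable {K : Type*} [Field K] {r n : ℕ}

lemma slot_add (i : Fin r) (β γ : Fin n →₀ ℕ) :
    (slot i (β + γ) : Ring' K r n) = slot i β * slot i γ := by
  rw [slot, slot, slot, ← map_mul, monomial_mul, mul_one]

lemma slot_single (i : Fin r) (b : Fin n) :
    (slot i (Finsupp.single b 1) : Ring' K r n) = X (i, b) := by
  rw [slot, ← X, rename_X]

lemma slot_zero (i : Fin r) : (slot i 0 : Ring' K r n) = 1 := by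
  rw [slot, ← C_apply, C_1, map_one]

lemma exists_eq_add_single {β : Fin n →₀ ℕ} (h : 1 ≤ β.degree) :
    ∃ γ b, β = γ + Finsupp.single b 1 := by
  have : β ≠ 0 := by rintro rfl; simp at h
  obtain ⟨b, hb⟩ := Finsupp.support_nonempty_iff.2 this
  exact ⟨β - Finsupp.single b 1, b,
    (Finsupp.sub_add_single_one_cancel (Finsupp.mem_support_iff.1 hb)).symm⟩

lemma slot_mem_locus_none (i : Fin r) {β : Fin n →₀ ℕ} (h : 1 ≤ β.degree) :
    (slot i β : Ring' K r n) ∈ locus K n (i, none) := by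
  obtain ⟨γ, b, rfl⟩ := exists_eq_add_single h
  rw [slot_add, slot_single]
  exact Ideal.mul_mem_left _ _ (Ideal.subset_span ⟨b, by simp [coords]⟩)

variable (K) in
/-- The ideal of the pairs of proportional points. -/
noncomputable def minors (n : ℕ) (i j : Fin r) : Ideal (Ring' K r n) :=
  Ideal.span (Set.range fun p : Fin n × Fin n => X (i, p.1) * X (j, p.2) - X (i, p.2) * X (j, p.1))

lemma minor_mem (i j : Fin r) (a b : Fin n) :
    (X (i, a) * X (j, b) - X (i, b) * X (j, a) : Ring' K r n) ∈ minors K n i j :=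
  Ideal.subset_span ⟨(a, b), rfl⟩

lemma vf_minor (i j : Fin r) (a b : Fin n) (β : Fin n →₀ ℕ) :
    vf K r β (X (i, a) * X (j, b) - X (i, b) * X (j, a)) =
      (slot i β + slot j β) * (X (i, a) * X (j, b) - X (i, b) * X (j, a)) := by
  simp only [map_sub, Derivation.leibniz, vf_X, smul_eq_mul]
  ring

lemma vf_mem_minors (i j : Fin r) (β : Fin n →₀ ℕ) :
    ∀ x ∈ minors K n i j, vf K r β x ∈ minors K n i j := by
  intro x hx
  refine Submodule.span_induction ?_ ?_ ?_ ?_ hx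
  · rintro _ ⟨⟨a, b⟩, rfl⟩
    rw [vf_minor]
    exact Ideal.mul_mem_left _ _ (minor_mem i j a b)
  · simp
  · intro x y _ _ hx hy; rw [map_add]; exact add_mem hx hy
  · intro f x hx' hx
    rw [smul_eq_mul, Derivation.leibniz]
    exact add_mem (Ideal.mul_mem_left _ _ hx) (Ideal.mul_mem_right _ _ hx')

lemma sub_mem_locus (i j : Fin r) (a : Fin n) :
    (X (i, a) - X (j, a) : Ring' K r n) ∈ locus K n (i, some j) :=
  Ideal.subset_span ⟨a, rfl⟩

lemma slot_sub_slot_mem_locus (i j : Fin r) (β : Fin n →₀ ℕ) :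
    (slot i β - slot j β : Ring' K r n) ∈ locus K n (i, some j) :=
  rename_sub_rename_mem i j _

lemma minors_le (i j : Fin r) : minors K n i j ≤ locus K n (i, some j) := by
  refine Ideal.span_le.2 ?_
  rintro _ ⟨⟨a, b⟩, rfl⟩
  have : (X (i, a) * X (j, b) - X (i, b) * X (j, a) : Ring' K r n) =
      X (j, b) * (X (i, a) - X (j, a)) - X (j, a) * (X (i, b) - X (j, b)) := by ring
  simp only [SetLike.mem_coe, this]
  exact sub_mem (Ideal.mul_mem_left _ _ (sub_mem_locus i j a))
    (Ideal.mul_mem_left _ _ (sub_mem_locus i j b))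

/-- The first order Taylor formula at coinciding points, modulo the relation of proportionality. -/
lemma slot_sub_slot_mul_sub_mem (i j : Fin r) (a : Fin n) (β : Fin n →₀ ℕ) :
    ((slot i β - slot j β) * X (j, a) - (β.degree : Ring' K r n) * slot j β *
      (X (i, a) - X (j, a))) ∈ minors K n i j ⊔ locus K n (i, some j) ^ 2 := by
  -- The expression is a derivation in the monomial up to second order terms, so it is enough to
  -- treat single variables.
  have hadd : ∀ β γ : Fin n →₀ ℕ, ((slot i β - slot j β) * X (j, a) -
      (β.degree : Ring' K r n) * slot j β * (X (i, a) - X (j, a))) ∈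
        minors K n i j ⊔ locus K n (i, some j) ^ 2 →
      ((slot i γ - slot j γ) * X (j, a) - (γ.degree : Ring' K r n) * slot j γ *
        (X (i, a) - X (j, a))) ∈ minors K n i j ⊔ locus K n (i, some j) ^ 2 →
      ((slot i (β + γ) - slot j (β + γ)) * X (j, a) - ((β + γ).degree : Ring' K r n) *
        slot j (β + γ) * (X (i, a) - X (j, a))) ∈ minors K n i j ⊔ locus K n (i, some j) ^ 2 := by
    intro β γ hβ hγ
    have h2 : (slot i γ - slot j γ) * (X (i, a) - X (j, a)) ∈
        minors K n i j ⊔ locus K n (i, some j) ^ 2 := by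
      refine Ideal.mem_sup_right ?_
      rw [pow_two]
      exact Ideal.mul_mem_mul (slot_sub_slot_mem_locus i j γ) (sub_mem_locus i j a)
    have h3 := add_mem (add_mem (Ideal.mul_mem_left _ (slot i γ) hβ)
      (Ideal.mul_mem_left _ (slot j β) hγ))
      (Ideal.mul_mem_left _ ((β.degree : Ring' K r n) * slot j β) h2)
    convert h3 using 1
    rw [slot_add, slot_add, map_add, Nat.cast_add]
    ring
  have h0 : ((slot i (0 : Fin n →₀ ℕ) - slot j 0) * X (j, a) -
      ((0 : Fin n →₀ ℕ).degree : Ring' K r n) * slot j 0 *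
      (X (i, a) - X (j, a))) ∈ minors K n i j ⊔ locus K n (i, some j) ^ 2 := by
    simp [slot_zero]
  induction β using Finsupp.induction_linear with
  | zero => exact h0
  | add β γ hβ hγ => exact hadd β γ hβ hγ
  | single b m =>
    induction m with
    | zero => rw [Finsupp.single_zero]; exact h0
    | succ m ih =>
      rw [Finsupp.single_add]
      -- For one variable the expression is exactly the negative of a minor.
      refine hadd _ _ ih (Ideal.mem_sup_left ?_)
      rw [slot_single, slot_single, Finsupp.degree_single]
      convert neg_mem (minor_mem (K := K) i j a b) using 1
      push_cast
      ring

section Action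

variable {T : Type*} [AddCommGroup T] [Module K T] [Module (Ring' K r n) T]
  [IsScalarTower K (Ring' K r n) T] {E : Fin r → Module.End K T} {lam : Fin r → K}

/-- At the origin a coordinate is mapped to `x ^ β` times itself, which lies in the square of the
ideal since `|β| ≥ 1`; all weights are zero and no `Z` is needed. On a diagonal the differences `X
(i, a) - X (j, a)` have weight `1 + |β|` at the point `j`, but only modulo the minors, because the
derivative of the field is not scalar in normal directions. The minors themselves have weight `slot
i β + slot j β`, which is `2 * slot j β` on the diagonal. -/
lemma relNoeth_locus_pow (hE : IsEuler n E) {e : ℕ} (he : 1 ≤ e) (p : Fin r × Option (Fin r))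
    (hT : ∀ c d : Fin r → ℕ, RelNoeth (fun β : {β : Fin n →₀ ℕ // e ≤ β.degree} =>
      act (shift E c) (fun i => lam i + d i) β.1)
      ((locus K n p • (⊤ : Submodule (Ring' K r n) T)).restrictScalars K) ⊤) (M : ℕ) :
    RelNoeth (fun β : {β : Fin n →₀ ℕ // e ≤ β.degree} => act E lam β.1)
      ((locus K n p ^ M • (⊤ : Submodule (Ring' K r n) T)).restrictScalars K) ⊤ := by
  classical
  have hy : Ideal.span ((Finset.univ.image (coords p) : Finset (Ring' K r n)) :
      Set (Ring' K r n)) = locus K n p := by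
    rw [Finset.coe_image, Finset.coe_univ, Set.image_univ]; rfl
  rcases p with ⟨i, _ | j⟩
  · refine relNoeth_pow (Z := ⊥) (yc := 0) (yd := 0) (zc := 0) hE bot_le _ ∅ hy (by simp) ?_
      (by simp) (vf_mem_locus _) (by simp) hT M
    intro μ hμ
    obtain ⟨a, _, rfl⟩ := Finset.mem_image.1 hμ
    have h1 : (coords (i, none) a : Ring' K r n) ∈ locus K n (i, none) :=
      Ideal.subset_span ⟨a, rfl⟩
    refine ⟨by simpa using h1, fun β hβ => Ideal.mem_sup_right ?_⟩
    rw [smul_zero, smul_zero, add_zero, weight_zero, zero_mul, sub_zero]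
    have h2 : vf K r β (coords (i, none) a) = slot i β * coords (i, none) a := by
      simp [coords, vf_X]
    rw [h2, show 0 + 1 + 1 = 2 from rfl, pow_two]
    exact Ideal.mul_mem_mul (slot_mem_locus_none i (he.trans hβ)) h1
  · have hz : Ideal.span ((Finset.univ.image fun p : Fin n × Fin n =>
        (X (i, p.1) * X (j, p.2) - X (i, p.2) * X (j, p.1) : Ring' K r n) :
        Finset (Ring' K r n)) : Set (Ring' K r n)) = minors K n i j := by
      rw [Finset.coe_image, Finset.coe_univ, Set.image_univ]; rfl
    refine relNoeth_pow (yc := Pi.single j 1) (yd := Pi.single j 1) (zc := Pi.single j 2) hE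
      (minors_le i j) _ _ hy hz ?_ ?_ (vf_mem_locus _) (vf_mem_minors i j) hT M
    · intro μ hμ
      obtain ⟨a, _, rfl⟩ := Finset.mem_image.1 hμ
      refine ⟨by simpa [coords] using (sub_mem_locus i j a), fun β _ => ?_⟩
      rw [zero_smul, one_smul, zero_add, zero_add, weight_single, pow_one, Nat.sub_self,
        pow_zero, mul_one]
      have h1 := slot_sub_slot_mul_sub_mem (K := K) i j a β
      have h2 : (slot i β - slot j β) * (X (i, a) - X (j, a)) ∈
          minors K n i j ⊔ locus K n (i, some j) ^ 2 := by
        refine Ideal.mem_sup_right ?_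
        rw [pow_two]
        exact Ideal.mul_mem_mul (slot_sub_slot_mem_locus i j β) (sub_mem_locus i j a)
      convert add_mem h1 h2 using 1
      simp only [coords, Option.elim, map_sub, vf_X, Nat.cast_one, one_mul, Algebra.smul_def,
        map_add, map_one, map_natCast]
      ring
    · intro μ hμ
      obtain ⟨⟨a, b⟩, _, rfl⟩ := Finset.mem_image.1 hμ
      refine ⟨by simpa using minor_mem i j a b, fun β _ => Ideal.mem_sup_right ?_⟩
      rw [zero_smul, one_smul, add_zero, add_zero, ← Pi.single_zero j, weight_single, vf_minor]
      have h2 : (slot i β - slot j β) * (X (i, a) * X (j, b) - X (i, b) * X (j, a)) ∈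
          locus K n (i, some j) ^ (1 + 1) := by
        rw [show 1 + 1 = 2 from rfl, pow_two]
        exact Ideal.mul_mem_mul (slot_sub_slot_mem_locus i j β) (minors_le i j (minor_mem i j a b))
      convert h2 using 1
      simp only [Nat.cast_ofNat, Nat.cast_zero, zero_mul, add_zero, Algebra.smul_def, map_ofNat]
      ring

end Action

end MultiPoly

/-! ### Restriction to a locus, with one point fewer -/

namespace MultiPoly

open MvPolynomial StableNoetherian

variable {K : Type*} [Field K] {r n : ℕ}

/-- The eigenvalues of the `i`-th operator are of the form `c i + m` with `m ∈ ℕ`. -/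
def EigenvaluesFrom {T : Type*} [AddCommGroup T] [Module K T] (E : Fin r → Module.End K T)
    (c : Fin r → K) : Prop :=
  eigenSpan E (fun i x => ∃ m : ℕ, x = c i + m) = ⊤

lemma eigenSpan_le_comap {r' : ℕ} {T T' : Type*} [AddCommGroup T] [Module K T] [AddCommGroup T']
    [Module K T'] {E : Fin r → Module.End K T} {p : Fin r → K → Prop}
    {E' : Fin r' → Module.End K T'} {p' : Fin r' → K → Prop} (q : T →ₗ[K] T')
    (h : ∀ t (ε : Fin r → K), (∀ i, p i (ε i)) → (∀ i, E i t = ε i • t) →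
      ∃ ε' : Fin r' → K, (∀ i, p' i (ε' i)) ∧ ∀ i, E' i (q t) = ε' i • q t) :
    eigenSpan E p ≤ (eigenSpan E' p').comap q := by
  refine Submodule.span_le.2 ?_
  rintro t ⟨ε, h1, h2⟩
  exact Submodule.subset_span (h t ε h1 h2)

lemma map_mem_eigenSpan {r' : ℕ} {T T' : Type*} [AddCommGroup T] [Module K T] [AddCommGroup T']
    [Module K T'] {E : Fin r → Module.End K T} {p : Fin r → K → Prop}
    {E' : Fin r' → Module.End K T'} {p' : Fin r' → K → Prop} {t : T} (ht : t ∈ eigenSpan E p)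
    (q : T →ₗ[K] T') (h : ∀ t (ε : Fin r → K), (∀ i, p i (ε i)) → (∀ i, E i t = ε i • t) →
      ∃ ε' : Fin r' → K, (∀ i, p' i (ε' i)) ∧ ∀ i, E' i (q t) = ε' i • q t) :
    q t ∈ eigenSpan E' p' :=
  eigenSpan_le_comap q h ht

lemma eigenSpan_mono {T : Type*} [AddCommGroup T] [Module K T] {E : Fin r → Module.End K T}
    {p p' : Fin r → K → Prop} (h : ∀ i x, p i x → p' i x) : eigenSpan E p ≤ eigenSpan E p' :=
  eigenSpan_le_comap LinearMap.id fun _ ε h1 h2 => ⟨ε, fun i => h i _ (h1 i), h2⟩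

lemma eul_succAbove_rename (i : Fin (r + 1)) (s : Fin r) (g : Ring' K r n) :
    eul (i.succAbove s) (rename (Prod.map i.succAbove id) g : Ring' K (r + 1) n) =
      rename (Prod.map i.succAbove id) (eul s g) := by
  induction g using MvPolynomial.induction_on with
  | C c =>
    rw [rename_C, show (C c : Ring' K (r + 1) n) = algebraMap K _ c from rfl,
      show (C c : Ring' K r n) = algebraMap K _ c from rfl, Derivation.map_algebraMap,
      Derivation.map_algebraMap, map_zero]
  | add f g hf hg => simp only [map_add, hf, hg]
  | mul_X f p hf =>
    obtain ⟨j, a⟩ := p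
    have h1 : rename (Prod.map i.succAbove id) (X (j, a) : Ring' K r n) =
        (X (i.succAbove j, a) : Ring' K (r + 1) n) := rename_X _ _
    rw [map_mul, Derivation.leibniz, Derivation.leibniz, hf, h1, eul_X, eul_X, map_add, smul_eq_mul,
      smul_eq_mul, smul_eq_mul, smul_eq_mul, map_mul, map_mul, h1]
    by_cases hj : j = s
    · simp [hj]
    · simp [hj]

lemma eul_self_rename (i : Fin (r + 1)) (g : Ring' K r n) :
    eul i (rename (Prod.map i.succAbove id) g : Ring' K (r + 1) n) = 0 := by
  induction g using MvPolynomial.induction_on with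
  | C c => rw [rename_C, show (C c : Ring' K (r + 1) n) = algebraMap K _ c from rfl,
      Derivation.map_algebraMap]
  | add f g hf hg => simp only [map_add, hf, hg, add_zero]
  | mul_X f p hf =>
    obtain ⟨j, a⟩ := p
    have h1 : rename (Prod.map i.succAbove id) (X (j, a) : Ring' K r n) =
        (X (i.succAbove j, a) : Ring' K (r + 1) n) := rename_X _ _
    rw [map_mul, Derivation.leibniz, hf, h1, eul_X, if_neg (Fin.succAbove_ne i j), smul_zero,
      smul_zero, add_zero]

lemma rename_slot (i : Fin (r + 1)) (s : Fin r) (β : Fin n →₀ ℕ) :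
    rename (Prod.map i.succAbove id) (slot s β : Ring' K r n) = slot (i.succAbove s) β := by
  rw [slot, slot, rename_rename]; rfl

/-- Euler operators after the `i`-th point has been put at the origin or at another point. -/
def merge {T : Type*} [AddCommGroup T] [Module K T] (E : Fin (r + 1) → Module.End K T)
    (i : Fin (r + 1)) (o : Option (Fin (r + 1))) (s : Fin r) : Module.End K T :=
  E (i.succAbove s) + if o = some (i.succAbove s) then E i else 0

variable (K n) in
lemma exists_sub_rename_mem (i : Fin (r + 1)) (o : Option (Fin (r + 1))) (ho : o ≠ some i)
    (f : Ring' K (r + 1) n) :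
    ∃ g : Ring' K r n, f - rename (Prod.map i.succAbove id) g ∈ locus K n (i, o) := by
  induction f using MvPolynomial.induction_on with
  | C c => exact ⟨C c, by simp⟩
  | add f g hf hg =>
    obtain ⟨f', hf⟩ := hf
    obtain ⟨g', hg⟩ := hg
    refine ⟨f' + g', ?_⟩
    convert add_mem hf hg using 1
    rw [map_add]; ring
  | mul_X f p hf =>
    obtain ⟨f', hf⟩ := hf
    have hX : ∃ g : Ring' K r n,
        (X p : Ring' K (r + 1) n) - rename (Prod.map i.succAbove id) g ∈ locus K n (i, o) := by
      obtain ⟨k, a⟩ := p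
      rcases Fin.eq_self_or_eq_succAbove i k with rfl | ⟨s, rfl⟩
      · rcases o with _ | j
        · exact ⟨0, Ideal.subset_span ⟨a, by simp [coords]⟩⟩
        · rcases Fin.eq_self_or_eq_succAbove k j with rfl | ⟨s, rfl⟩
          · exact absurd rfl ho
          · exact ⟨X (s, a), by simpa using sub_mem_locus k (k.succAbove s) a⟩
      · exact ⟨X (s, a), by simp⟩
    obtain ⟨g', hg⟩ := hX
    refine ⟨f' * g', ?_⟩
    convert add_mem (Ideal.mul_mem_right (X p) _ hf)
      (Ideal.mul_mem_left _ (rename (Prod.map i.succAbove id) f') hg) using 1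
    rw [map_mul]; ring

section Merge

variable {T : Type*} [AddCommGroup T] [Module K T] [Module (Ring' K (r + 1) n) T]
  {E : Fin (r + 1) → Module.End K T} {lam : Fin (r + 1) → K}

lemma merge_smul (hE : IsEuler n E) (i : Fin (r + 1)) (o : Option (Fin (r + 1))) (s : Fin r)
    (f : Ring' K (r + 1) n) (t : T) : merge E i o s (f • t) =
      ((eul (i.succAbove s) + if o = some (i.succAbove s) then eul i else 0 :
        Derivation K (Ring' K (r + 1) n) (Ring' K (r + 1) n)) f) • t + f • merge E i o s t := by
  simp only [merge, LinearMap.add_apply, Derivation.add_apply]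
  split_ifs
  · rw [hE, hE, add_smul, smul_add]; abel
  · rw [hE]; simp

/-- On a diagonal, neither Euler field of the two coinciding points need be tangent, but their sum
is; hence the form of `merge`. -/
lemma merge_eul_mem (i : Fin (r + 1)) (o : Option (Fin (r + 1))) (s : Fin r) :
    ∀ x ∈ locus K n (i, o), (eul (i.succAbove s) + if o = some (i.succAbove s) then eul i else 0 :
        Derivation K (Ring' K (r + 1) n) (Ring' K (r + 1) n)) x ∈ locus K n (i, o) := by
  intro x hx
  refine Submodule.span_induction ?_ ?_ ?_ ?_ hx
  · rintro _ ⟨a, rfl⟩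
    have h0 : (coords (i, o) a : Ring' K (r + 1) n) ∈ locus K n (i, o) := Ideal.subset_span ⟨a, rfl⟩
    have h1 : (eul (i.succAbove s) + if o = some (i.succAbove s) then eul i else 0 :
        Derivation K (Ring' K (r + 1) n) (Ring' K (r + 1) n)) (coords (i, o) a) =
        if o = some (i.succAbove s) then coords (i, o) a else 0 := by
      rcases o with _ | j
      · simp [coords, eul_X, Fin.ne_succAbove]
      · by_cases hj : j = i.succAbove s
        · subst hj
          simp [coords, eul_X, Fin.ne_succAbove, Fin.succAbove_ne, neg_add_eq_sub]
        · simp [coords, eul_X, Fin.ne_succAbove, hj]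
    rw [h1]
    split_ifs
    · exact h0
    · exact zero_mem _
  · simp
  · intro x y _ _ hx hy; rw [map_add]; exact add_mem hx hy
  · intro f x hx' hx
    rw [smul_eq_mul, Derivation.leibniz]
    exact add_mem (Ideal.mul_mem_left _ _ hx) (Ideal.mul_mem_right _ _ hx')

lemma exists_induced {T' : Type*} [AddCommGroup T'] [Module K T'] (q : T →ₗ[K] T')
    (hq : Function.Surjective q) (f : Module.End K T) (h : ∀ t, q t = 0 → q (f t) = 0) :
    ∃ f' : Module.End K T', ∀ t, f' (q t) = q (f t) := by
  obtain ⟨g, hg⟩ := q.exists_rightInverse_of_surjective (LinearMap.range_eq_top.2 hq)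
  refine ⟨q ∘ₗ f ∘ₗ g, fun t => ?_⟩
  have h1 := h (g (q t) - t) (by
    rw [map_sub, ← LinearMap.comp_apply, hg, LinearMap.id_apply, sub_self])
  rw [map_sub, map_sub, sub_eq_zero] at h1
  exact h1

variable [IsScalarTower K (Ring' K (r + 1) n) T]

lemma smul_eq_smul_of_sub_mem {T' : Type*} [AddCommGroup T'] [Module (Ring' K (r + 1) n) T']
    {I : Ideal (Ring' K (r + 1) n)} (h : ∀ f ∈ I, ∀ t : T', f • t = 0) {f g : Ring' K (r + 1) n}
    (hfg : f - g ∈ I) (t : T') : f • t = g • t := by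
  rw [← sub_eq_zero, ← sub_smul, h _ hfg]

/-- At the origin the term of the point `i` dies because `x ^ β` vanishes there for `|β| ≥ 1`. On a
diagonal the monomials of the two points agree, so the terms combine and the Euler operators and
parameters add. -/
lemma quotient_act {e : ℕ} (he : 1 ≤ e) {i : Fin (r + 1)}
    {o : Option (Fin (r + 1))} (ho : o ≠ some i) {T' : Type*} [AddCommGroup T'] [Module K T']
    [Module (Ring' K (r + 1) n) T'] [Module (Ring' K r n) T'] [IsScalarTower K (Ring' K r n) T']
    [IsScalarTower K (Ring' K (r + 1) n) T']
    (hm : ∀ (f : Ring' K r n) (t : T'), f • t =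
      (rename (Prod.map i.succAbove id) f : Ring' K (r + 1) n) • t)
    (hJ : ∀ f ∈ locus K n (i, o), ∀ t : T', f • t = 0)
    (q : T →ₗ[K] T') (hq : ∀ (f : Ring' K (r + 1) n) t, q (f • t) = f • q t)
    {E' : Fin r → Module.End K T'} (hE' : ∀ s t, E' s (q t) = q (merge E i o s t))
    (β : Fin n →₀ ℕ) (hβ : e ≤ β.degree) (t : T) :
    q (act E lam β t) = act E' (fun s => lam (i.succAbove s) +
      if o = some (i.succAbove s) then lam i else 0) β (q t) := by
  rw [act_apply, act_apply, Fin.sum_univ_succAbove _ i, map_add, map_sum]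
  simp only [hm, rename_slot, hE', hq, merge]
  rcases o with _ | j
  · rw [hJ _ (slot_mem_locus_none i (he.trans hβ)), zero_add]
    refine Finset.sum_congr rfl fun s _ => ?_
    simp
  · rcases Fin.eq_self_or_eq_succAbove i j with rfl | ⟨s, rfl⟩
    · exact absurd rfl ho
    · rw [smul_eq_smul_of_sub_mem hJ (slot_sub_slot_mem_locus i (i.succAbove s) β)]
      have h1 : ∀ s' ∈ Finset.univ, (slot (i.succAbove s') β : Ring' K (r + 1) n) •
          (q ((E (i.succAbove s') + if some (i.succAbove s) = some (i.succAbove s') then E i else 0) t)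
            + ((lam (i.succAbove s') + if some (i.succAbove s) = some (i.succAbove s') then lam i
              else 0) * (β.degree : K)) • q t) =
          (slot (i.succAbove s') β : Ring' K (r + 1) n) • q (E (i.succAbove s') t +
            (lam (i.succAbove s') * (β.degree : K)) • t) +
          if s' = s then (slot (i.succAbove s) β : Ring' K (r + 1) n) •
            q (E i t + (lam i * (β.degree : K)) • t) else 0 := by
        intro s' _
        by_cases h : s' = s
        · subst h
          simp only [if_true, LinearMap.add_apply, map_add, map_smul, add_mul, add_smul, smul_add]
          abel
        · have h' : ¬ i.succAbove s = i.succAbove s' := fun h' =>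
            h (Fin.succAbove_right_injective h').symm
          simp [h, h']
      rw [Finset.sum_congr rfl h1, Finset.sum_add_distrib, Finset.sum_ite_eq' Finset.univ s, if_pos
        (Finset.mem_univ s), add_comm]

lemma finite_of_rename {i : Fin (r + 1)}
    {o : Option (Fin (r + 1))} (ho : o ≠ some i) {T' : Type*} [AddCommGroup T']
    [Module (Ring' K (r + 1) n) T'] [Module (Ring' K r n) T']
    (hm : ∀ (f : Ring' K r n) (t : T'), f • t =
      (rename (Prod.map i.succAbove id) f : Ring' K (r + 1) n) • t)
    (hJ : ∀ f ∈ locus K n (i, o), ∀ t : T', f • t = 0) [h : Module.Finite (Ring' K (r + 1) n) T'] :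
    Module.Finite (Ring' K r n) T' := by
  obtain ⟨S, hS⟩ := h.fg_top
  refine ⟨⟨S, ?_⟩⟩
  rw [eq_top_iff]
  intro t _
  have ht : t ∈ Submodule.span (Ring' K (r + 1) n) (S : Set T') := hS ▸ trivial
  refine Submodule.span_induction ?_ ?_ ?_ ?_ ht
  · exact fun s hs => Submodule.subset_span hs
  · exact zero_mem _
  · exact fun x y _ _ => add_mem
  · intro f x _ hx
    obtain ⟨g, hg⟩ := exists_sub_rename_mem K n i o ho f
    rw [smul_eq_smul_of_sub_mem hJ hg, ← hm]
    exact Submodule.smul_mem _ _ hx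

end Merge

universe u

/-- The quotient by the locus is a finitely generated module over the polynomials in the remaining
points, and the merged operators are again of Euler type, with eigenvalues in translates of `ℕ`. The
induction hypothesis for `r` points therefore applies. -/
theorem relNoeth_locus {e : ℕ} (he : 1 ≤ e)
    (ih : ∀ (T : Type u) [AddCommGroup T] [Module K T] [Module (Ring' K r n) T]
      [IsScalarTower K (Ring' K r n) T] [Module.Finite (Ring' K r n) T]
      (E : Fin r → Module.End K T) (lam c : Fin r → K), IsEuler n E → EigenvaluesFrom E c →
      Noeth fun β : {β : Fin n →₀ ℕ // e ≤ β.degree} => act E lam β.1)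
    (T : Type u) [AddCommGroup T] [Module K T] [Module (Ring' K (r + 1) n) T]
    [IsScalarTower K (Ring' K (r + 1) n) T] [Module.Finite (Ring' K (r + 1) n) T]
    {E : Fin (r + 1) → Module.End K T} {lam c : Fin (r + 1) → K} (hE : IsEuler n E)
    (hc : EigenvaluesFrom E c) {i : Fin (r + 1)} {o : Option (Fin (r + 1))} (ho : o ≠ some i) :
    RelNoeth (fun β : {β : Fin n →₀ ℕ // e ≤ β.degree} => act E lam β.1)
      ((locus K n (i, o) • (⊤ : Submodule (Ring' K (r + 1) n) T)).restrictScalars K) ⊤ := by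
  set U := locus K n (i, o) • (⊤ : Submodule (Ring' K (r + 1) n) T) with hU
  let _ : Module (Ring' K r n) (T ⧸ U) := Module.compHom (T ⧸ U)
    (rename (Prod.map i.succAbove id) : Ring' K r n →ₐ[K] Ring' K (r + 1) n).toRingHom
  have hm : ∀ (f : Ring' K r n) (t : T ⧸ U), f • t =
      (rename (Prod.map i.succAbove id) f : Ring' K (r + 1) n) • t := fun _ _ => rfl
  have hJ : ∀ f ∈ locus K n (i, o), ∀ t : T ⧸ U, f • t = 0 := by
    intro f hf t
    obtain ⟨t, rfl⟩ := U.mkQ_surjective t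
    rw [← map_smul, Submodule.mkQ_apply, Submodule.Quotient.mk_eq_zero]
    exact Submodule.smul_mem_smul hf trivial
  have _ : IsScalarTower K (Ring' K r n) (T ⧸ U) := ⟨fun a f t => by
    rw [hm, hm, map_smul, smul_assoc]⟩
  have _ : Module.Finite (Ring' K r n) (T ⧸ U) := finite_of_rename ho hm hJ
  let q : T →ₗ[K] T ⧸ U := U.mkQ.restrictScalars K
  have hq : ∀ (f : Ring' K (r + 1) n) t, q (f • t) = f • q t := fun f t => U.mkQ.map_smul f t
  have hqs : Function.Surjective q := U.mkQ_surjective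
  have hq0 : ∀ t, q t = 0 ↔ t ∈ U := fun t => Submodule.Quotient.mk_eq_zero U
  have h1 : ∀ s, ∃ f' : Module.End K (T ⧸ U), ∀ t, f' (q t) = q (merge E i o s t) := by
    refine fun s => exists_induced q hqs _ fun t ht => ?_
    rw [hq0] at ht ⊢
    refine Submodule.smul_induction_on ht (fun f hf t _ => ?_) fun a b ha hb => ?_
    · rw [merge_smul hE]
      exact add_mem (Submodule.smul_mem_smul (merge_eul_mem i o s f hf) trivial)
        (Submodule.smul_mem_smul hf trivial)
    · rw [map_add]; exact add_mem ha hb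
  choose E' hE' using h1
  have hEul : IsEuler n E' := by
    intro s f t
    obtain ⟨t, rfl⟩ := hqs t
    rw [hm, ← hq, hE', merge_smul hE, map_add, hq, hq, hm, hm, hE', Derivation.add_apply,
      eul_succAbove_rename]
    congr 2
    split_ifs
    · rw [eul_self_rename, add_zero]
    · simp
  have hEig : EigenvaluesFrom E' (fun s => c (i.succAbove s) +
      if o = some (i.succAbove s) then c i else 0) := by
    rw [EigenvaluesFrom, eq_top_iff]
    intro t _
    obtain ⟨t, rfl⟩ := hqs t
    have ht : t ∈ eigenSpan E (fun i x => ∃ m : ℕ, x = c i + m) := hc ▸ trivial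
    refine map_mem_eigenSpan ht q fun t ε h2 h3 => ?_
    refine ⟨fun s => ε (i.succAbove s) + if o = some (i.succAbove s) then ε i else 0,
      fun s => ?_, fun s => ?_⟩
    · obtain ⟨m, hm⟩ := h2 (i.succAbove s)
      obtain ⟨m', hm'⟩ := h2 i
      beta_reduce
      rw [hm, hm']
      split_ifs
      · exact ⟨m + m', by push_cast; ring⟩
      · exact ⟨m, by ring⟩
    · rw [hE', merge, LinearMap.add_apply, h3, ← map_smul]
      congr 1
      beta_reduce
      split_ifs
      · rw [h3, add_smul]
      · simp
  have hN := ih (T ⧸ U) E' (fun s => lam (i.succAbove s) +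
      if o = some (i.succAbove s) then lam i else 0) _ hEul hEig
  refine (RelNoeth.comap hN q fun β t => quotient_act he ho hm hJ q hq hE' β.1 β.2 t).mono ?_
    le_rfl
  intro t ht
  exact (hq0 t).1 ht

end MultiPoly

/-! ### Zero eigenvalues, parameters equal to one, and induction on the number of points -/

namespace MultiPoly

open MvPolynomial StableNoetherian

variable {K : Type*} [Field K] {r n : ℕ}

section Action

variable {T : Type*} [AddCommGroup T] [Module K T] [Module (Ring' K r n) T]
  [IsScalarTower K (Ring' K r n) T] {E : Fin r → Module.End K T} {lam c : Fin r → K}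

lemma smul_mem_eigenSpan (hE : IsEuler n E) {p : Fin r → K → Prop}
    (hp : ∀ i x (m : ℕ), p i x → p i (x + m)) (f : Ring' K r n) {t : T} (ht : t ∈ eigenSpan E p) :
    f • t ∈ eigenSpan E p := by
  have h1 : f • t = ∑ m ∈ f.support, coeff m f • (monomial m (1 : K) : Ring' K r n) • t :=
    sum_support_smul ((Algebra.lsmul K K T).toLinearMap.flip t) f
  rw [h1]
  refine Submodule.sum_mem _ fun m _ => Submodule.smul_mem _ _ ?_
  exact map_mem_eigenSpan ht (Algebra.lsmul K K T (monomial m (1 : K)))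
    fun t ε h1 h2 => ⟨fun i => ε i + deg i m, fun i => hp i _ _ (h1 i),
      fun i => hE.apply_monomial h2 i m 1⟩

/-- The span of the joint eigenvectors whose eigenvalues are at least `c i + v i`. -/
def eigenFrom (hE : IsEuler n E) (c : Fin r → K) (v : Fin r → ℕ) : Submodule (Ring' K r n) T where
  carrier := eigenSpan E fun i x => ∃ m : ℕ, v i ≤ m ∧ x = c i + m
  zero_mem' := zero_mem _
  add_mem' := add_mem
  smul_mem' f _ ht := smul_mem_eigenSpan hE (by
    rintro i x m ⟨m', h, rfl⟩
    exact ⟨m' + m, by omega, by push_cast; ring⟩) f ht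

lemma mem_eigenFrom (hE : IsEuler n E) (c : Fin r → K) (v : Fin r → ℕ) (t : T) :
    t ∈ eigenFrom hE c v ↔ t ∈ eigenSpan E fun i x => ∃ m : ℕ, v i ≤ m ∧ x = c i + m := Iff.rfl

lemma eigenFrom_zero (hE : IsEuler n E) (hc : EigenvaluesFrom E c) : eigenFrom hE c 0 = ⊤ := by
  rw [eq_top_iff]
  intro t _
  rw [mem_eigenFrom]
  have : t ∈ eigenSpan E (fun i x => ∃ m : ℕ, x = c i + m) := hc ▸ trivial
  exact eigenSpan_mono (by simp) this

/-- A coordinate of the point `i` raises the `i`-th Euler eigenvalue by one and fixes the others. -/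
lemma locus_smul_eigenFrom_le (hE : IsEuler n E) (c : Fin r → K) (v : Fin r → ℕ) (i : Fin r) :
    locus K n (i, none) • eigenFrom hE c v ≤ eigenFrom hE c (v + Pi.single i 1) := by
  refine Submodule.smul_le.2 fun f hf t ht => ?_
  refine Submodule.span_induction ?_ ?_ ?_ ?_ hf
  · rintro _ ⟨a, rfl⟩
    rw [mem_eigenFrom] at ht ⊢
    refine map_mem_eigenSpan ht (Algebra.lsmul K K T (coords (i, none) a : Ring' K r n))
      fun t ε h1 h2 => ?_
    refine ⟨fun j => ε j + if i = j then 1 else 0, fun j => ?_, fun j => ?_⟩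
    · obtain ⟨m, h3, h4⟩ := h1 j
      by_cases hij : i = j
      · subst hij
        exact ⟨m + 1, by simpa using h3, by simp [h4]; ring⟩
      · exact ⟨m, by simpa [Ne.symm hij, Pi.single_apply] using h3, by simp [h4, hij]⟩
    · refine hE.apply_smul (h2 j) ?_
      simp only [coords, Option.elim, sub_zero, eul_X]
      split_ifs <;> simp
  · rw [zero_smul]; exact zero_mem _
  · intro x y _ _ hx hy; rw [add_smul]; exact add_mem hx hy
  · intro g x _ hx; rw [smul_assoc]; exact Submodule.smul_mem _ _ hx

lemma locus_pow_smul_eigenFrom_le (hE : IsEuler n E) (c : Fin r → K) (v : Fin r → ℕ) (i : Fin r)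
    (m : ℕ) : locus K n (i, none) ^ m • eigenFrom hE c v ≤ eigenFrom hE c (v + Pi.single i m) := by
  induction m with
  | zero => simp
  | succ m ih =>
    rw [pow_succ', ← smul_eq_mul, Submodule.smul_assoc]
    refine (Submodule.smul_mono le_rfl ih).trans ((locus_smul_eigenFrom_le hE c _ i).trans ?_)
    rw [add_assoc, ← Pi.single_add]

lemma prod_locus_pow_smul_top_le (hE : IsEuler n E) (hc : EigenvaluesFrom E c) (m : ℕ) :
    (∏ i : Fin r, locus K n (i, none)) ^ m • (⊤ : Submodule (Ring' K r n) T) ≤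
      eigenFrom hE c fun _ => m := by
  have : ∀ s : Finset (Fin r), (∏ i ∈ s, locus K n (i, none)) ^ m •
      (⊤ : Submodule (Ring' K r n) T) ≤ eigenFrom hE c (∑ i ∈ s, Pi.single i m) := by
    intro s
    induction s using Finset.cons_induction with
    | empty => simp [eigenFrom_zero hE hc]
    | cons i s hi ih =>
      rw [Finset.prod_cons, Finset.sum_cons, mul_pow, ← smul_eq_mul (_ ^ m), Submodule.smul_assoc, add_comm]
      exact (Submodule.smul_mono le_rfl ih).trans (locus_pow_smul_eigenFrom_le hE c _ i m)
  have h := this Finset.univ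
  rwa [Finset.univ_sum_single (fun _ : Fin r => m)] at h

lemma apply_mem_eigenFrom (hE : IsEuler n E) (c : Fin r → K) (v : Fin r → ℕ) (i : Fin r) {t : T}
    (ht : t ∈ eigenFrom hE c v) : E i t ∈ eigenFrom hE c v := by
  rw [mem_eigenFrom] at ht ⊢
  refine map_mem_eigenSpan ht (E i) fun t ε h1 h2 => ⟨ε, h1, fun j => ?_⟩
  rw [h2, map_smul, h2, smul_comm]

/-- The restriction of the Euler operators to `eigenFrom`. -/
def restrictEigen (hE : IsEuler n E) (c : Fin r → K) (v : Fin r → ℕ) (i : Fin r) :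
    Module.End K (eigenFrom hE c v) where
  toFun t := ⟨E i t, apply_mem_eigenFrom hE c v i t.2⟩
  map_add' _ _ := Subtype.ext (map_add (E i) _ _)
  map_smul' a _ := Subtype.ext (map_smul (E i) a _)

lemma isEuler_restrictEigen (hE : IsEuler n E) (c : Fin r → K) (v : Fin r → ℕ) :
    IsEuler n (restrictEigen hE c v) := fun i f t => Subtype.ext (hE i f t)

lemma eigenvaluesFrom_restrictEigen (hE : IsEuler n E) (c : Fin r → K) (v : Fin r → ℕ) :
    EigenvaluesFrom (restrictEigen hE c v) fun i => c i + v i := by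
  rw [EigenvaluesFrom, eq_top_iff]
  rintro ⟨t, ht⟩ _
  obtain ⟨m, ε, w, h1, h2, h3⟩ := exists_eigen_sum ((mem_eigenFrom hE c v t).1 ht)
  have hw : ∀ k, w k ∈ eigenFrom hE c v := fun k =>
    (mem_eigenFrom hE c v _).2 (Submodule.subset_span ⟨ε k, h1 k, h2 k⟩)
  have h4 : (⟨t, ht⟩ : eigenFrom hE c v) = ∑ k, ⟨w k, hw k⟩ := by
    refine Subtype.ext ?_
    rw [AddSubmonoidClass.coe_finsetSum]
    exact h3.symm
  rw [h4]
  refine Submodule.sum_mem _ fun k _ => Submodule.subset_span ⟨ε k, fun i => ?_, fun i =>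
    Subtype.ext (h2 k i)⟩
  obtain ⟨m, h5, h6⟩ := h1 k i
  exact ⟨m - v i, by rw [h6, Nat.cast_sub h5]; ring⟩

lemma EigenvaluesFrom.shift (hc : EigenvaluesFrom E c) (d : Fin r → ℕ) :
    EigenvaluesFrom (shift E d) fun i => c i + d i := by
  rw [EigenvaluesFrom, eq_top_iff, ← (hc : _ = ⊤)]
  intro t ht
  refine map_mem_eigenSpan ht LinearMap.id fun t ε h1 h2 => ⟨fun i => ε i + d i, fun i => ?_,
    fun i => ?_⟩
  · obtain ⟨m, h⟩ := h1 i
    exact ⟨m, by beta_reduce; rw [h]; ring⟩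
  · simp [MultiPoly.shift, h2, add_smul]

lemma exists_forall_add_ne_zero [CharZero K] (c : Fin r → K) :
    ∃ m₀ : ℕ, ∀ i, ∀ m : ℕ, m₀ ≤ m → c i + m ≠ 0 := by
  have : ∀ i, ∃ m₀ : ℕ, ∀ m : ℕ, m₀ ≤ m → c i + m ≠ 0 := by
    intro i
    by_cases h : ∃ m : ℕ, c i + m = 0
    · obtain ⟨m, hm⟩ := h
      refine ⟨m + 1, fun m' h' h0 => ?_⟩
      have : (m' : K) = m := add_left_cancel (h0.trans hm.symm)
      rw [Nat.cast_inj] at this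
      omega
    · exact ⟨0, fun m _ h0 => h ⟨m, h0⟩⟩
  choose f hf using this
  exact ⟨Finset.univ.sup f, fun i m hm => hf i m ((Finset.le_sup (Finset.mem_univ i)).trans hm)⟩

open Classical in
-- The relation `E i ∘ x ^ β E i = x ^ β (E i + |β|) ∘ E i` shows that the Euler operator
-- intertwines the parameters `0` and `1`. The product is over those `i` with `lam i = 1`.
lemma eulerProd_act (hE : IsEuler n E) (hspan : eigenSpan E (fun _ _ => True) = ⊤)
    (β : Fin n →₀ ℕ) (t : T) :
    eulerProd E (fun i => lam i - 1) (act E (fun i => if lam i = 1 then 0 else lam i) β t) =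
      act E lam β (eulerProd E (fun i => lam i - 1) t) := by
  obtain ⟨m, ε, w, -, h2, rfl⟩ := exists_eigen_sum (hspan ▸ Submodule.mem_top : t ∈ eigenSpan E _)
  simp only [map_sum]
  refine Finset.sum_congr rfl fun k _ => ?_
  rw [eulerProd_apply (h2 k), map_smul, act_apply, act_apply, map_sum, Finset.smul_sum]
  refine Finset.sum_congr rfl fun i _ => ?_
  have h3 : ∀ j, E j ((slot i β : Ring' K r n) • w k) =
      (ε k j + if j = i then (β.degree : K) else 0) • (slot i β : Ring' K r n) • w k := fun j =>
    hE.apply_smul (h2 k j) (eul_slot i j β)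
  rw [h2, ← add_smul, ← add_smul, smul_smul_comm', smul_smul_comm', map_smul, eulerProd_apply h3,
    smul_smul, smul_smul]
  congr 1
  simp only [sub_eq_zero]
  by_cases h : lam i = 1
  · rw [if_pos h, h, ← Finset.mul_prod_erase _ _ (Finset.mem_univ i),
      ← Finset.mul_prod_erase _ _ (Finset.mem_univ i), if_pos h, if_pos h, if_pos rfl]
    have : ∏ j ∈ Finset.univ.erase i, (if lam j = 1 then
        ε k j + if j = i then (β.degree : K) else 0 else 1) =
        ∏ j ∈ Finset.univ.erase i, if lam j = 1 then ε k j else 1 :=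
      Finset.prod_congr rfl fun j hj => by rw [if_neg (Finset.ne_of_mem_erase hj), add_zero]
    rw [this]
    ring
  · rw [if_neg h, mul_comm]
    congr 1
    refine Finset.prod_congr rfl fun j _ => ?_
    by_cases hj : j = i
    · subst hj; rw [if_neg h, if_neg h]
    · rw [if_neg hj, add_zero]

end Action

universe u

/-- This removes from `noeth_act_of_relNoeth_locus` the conditions that the eigenvalues are nonzero
and the parameters differ from `1`. The part of `T` with large eigenvalues satisfies the first
condition, and the quotient by it is controlled by the points at the origin. Parameters equal to `1`
are replaced by `0` by means of `eulerProd_act`. -/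
theorem noeth_act_of_relNoeth [CharZero K] {e : ℕ} (he : 1 ≤ e)
    (h : ∀ (T : Type u) [AddCommGroup T] [Module K T] [Module (Ring' K r n) T]
      [IsScalarTower K (Ring' K r n) T] [Module.Finite (Ring' K r n) T]
      (E : Fin r → Module.End K T) (lam c : Fin r → K), IsEuler n E → EigenvaluesFrom E c →
      ∀ p ∈ places r, RelNoeth (fun β : {β : Fin n →₀ ℕ // e ≤ β.degree} => act E lam β.1)
        ((locus K n p • (⊤ : Submodule (Ring' K r n) T)).restrictScalars K) ⊤)
    (T : Type u) [AddCommGroup T] [Module K T] [Module (Ring' K r n) T]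
      [IsScalarTower K (Ring' K r n) T] [Module.Finite (Ring' K r n) T]
      (E : Fin r → Module.End K T) (lam c : Fin r → K) (hE : IsEuler n E)
      (hc : EigenvaluesFrom E c) :
    Noeth fun β : {β : Fin n →₀ ℕ // e ≤ β.degree} => act E lam β.1 := by
  classical
  have hpow : ∀ (T : Type u) [AddCommGroup T] [Module K T] [Module (Ring' K r n) T]
      [IsScalarTower K (Ring' K r n) T] [Module.Finite (Ring' K r n) T]
      (E : Fin r → Module.End K T) (lam c : Fin r → K), IsEuler n E → EigenvaluesFrom E c →
      ∀ p ∈ places r, ∀ M, RelNoeth (fun β : {β : Fin n →₀ ℕ // e ≤ β.degree} => act E lam β.1)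
        ((locus K n p ^ M • (⊤ : Submodule (Ring' K r n) T)).restrictScalars K) ⊤ := by
    intro T _ _ _ _ _ E lam c hE hc p hp M
    exact relNoeth_locus_pow hE he p (fun c' d => h T _ _ _ (hE.shift c') (hc.shift c') p hp) M
  obtain ⟨m₀, hm₀⟩ := exists_forall_add_ne_zero c
  set L := eigenFrom hE c (fun _ => m₀) with hL
  set EL := restrictEigen hE c (fun _ => m₀) with hEL
  have hEL1 : IsEuler n EL := isEuler_restrictEigen hE c _
  have hEL2 : EigenvaluesFrom EL fun i => c i + m₀ := eigenvaluesFrom_restrictEigen hE c _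
  have hEL3 : eigenSpan EL (fun _ x => x ≠ 0) = ⊤ := by
    rw [eq_top_iff, ← (hEL2 : _ = ⊤)]
    refine eigenSpan_mono ?_
    rintro i _ ⟨m, rfl⟩
    have := hm₀ i (m₀ + m) (by omega)
    push_cast at this
    rwa [← add_assoc] at this
  have hfin : Module.Finite (Ring' K r n) L := Module.Finite.of_fg (IsNoetherian.noetherian L)
  have hN0 : Noeth fun β : {β : Fin n →₀ ℕ // e ≤ β.degree} =>
      act EL (fun i => if lam i = 1 then 0 else lam i) β.1 := by
    refine noeth_act_of_relNoeth_locus hEL1 e hEL3 (fun i => ?_) (hpow L _ _ _ hEL1 hEL2)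
    split_ifs with hi
    · exact zero_ne_one
    · exact hi
  -- The intertwiner is surjective because it acts on joint eigenvectors by nonzero scalars.
  have hN1 : Noeth fun β : {β : Fin n →₀ ℕ // e ≤ β.degree} => act EL lam β.1 := by
    refine hN0.of_surjective (eulerProd EL (fun i => lam i - 1)) (fun β t =>
      eulerProd_act hEL1 ?_ β.1 t) ?_
    · rw [eq_top_iff, ← hEL3]
      exact eigenSpan_mono fun _ _ _ => trivial
    · rw [← LinearMap.range_eq_top, eq_top_iff, ← hEL3]
      refine Submodule.span_le.2 ?_
      rintro t ⟨ε, h1, h2⟩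
      have h3 : (∏ i, if lam i - 1 = 0 then ε i else 1) ≠ 0 := Finset.prod_ne_zero_iff.2
        fun i _ => by
          split_ifs
          · exact h1 i
          · exact one_ne_zero
      refine ⟨(∏ i, if lam i - 1 = 0 then ε i else 1)⁻¹ • t, ?_⟩
      rw [map_smul, eulerProd_apply h2, smul_smul, inv_mul_cancel₀ h3, one_smul]
  have hact : ∀ (β : Fin n →₀ ℕ) (t : L), ((act EL lam β t : L) : T) = act E lam β t := by
    intro β t
    rw [act_apply, act_apply, AddSubmonoidClass.coe_finsetSum]
    rfl
  have h1 := RelNoeth.sup_range (A := ⊥)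
    (ρ := fun β : {β : Fin n →₀ ℕ // e ≤ β.degree} => act E lam β.1) hN1
    (L.subtype.restrictScalars K) (fun β t => by
      rw [Submodule.mem_bot, sub_eq_zero]; exact hact β.1 t) stable_bot (by simp)
  rw [bot_sup_eq] at h1
  -- The `m₀`-th power of the product of the origin ideals maps `T` into `L`, so it suffices to
  -- divide by high powers of these ideals separately.
  obtain ⟨M, hM⟩ := exists_finset_inf_pow_smul_le (T := T) (Finset.univ : Finset (Fin r))
    (fun i => locus K n (i, none)) m₀
  have h2 := relNoeth_finset_inf (ρ := fun β : {β : Fin n →₀ ℕ // e ≤ β.degree} => act E lam β.1)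
    (Finset.univ : Finset (Fin r))
    (fun i => (locus K n (i, none) ^ M • (⊤ : Submodule (Ring' K r n) T)).restrictScalars K)
    (fun i _ β t ht => act_mem_smul_top hE (derivation_mem_pow _ _ (vf_mem_locus _ β.1) M) t ht)
    (fun i _ => hpow T E lam c hE hc (i, none) (by simp [places]) M)
  refine h1.trans (h2.mono ?_ le_rfl) ?_
  · intro t ht
    have : t ∈ L := prod_locus_pow_smul_top_le hE hc m₀ (hM (by
      simp only [Submodule.mem_finsetInf, Submodule.restrictScalars_mem] at ht ⊢
      exact ht))
    exact ⟨⟨t, this⟩, rfl⟩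
  · rintro β _ ⟨t, rfl⟩
    exact ⟨act EL lam β.1 t, hact β.1 t⟩

theorem noeth_act [CharZero K] {e : ℕ} (he : 1 ≤ e) (r : ℕ) (T : Type u) [AddCommGroup T]
    [Module K T] [Module (Ring' K r n) T] [IsScalarTower K (Ring' K r n) T]
    [Module.Finite (Ring' K r n) T] (E : Fin r → Module.End K T) (lam c : Fin r → K)
    (hE : IsEuler n E) (hc : EigenvaluesFrom E c) :
    Noeth fun β : {β : Fin n →₀ ℕ // e ≤ β.degree} => act E lam β.1 := by
  induction r generalizing T with
  | zero =>
    -- Without points there are no loci, so the condition on them is vacuous.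
    exact noeth_act_of_relNoeth he (fun T _ _ _ _ _ E lam c _ _ p _ => p.1.elim0) T E lam c hE hc
  | succ r ih =>
    refine noeth_act_of_relNoeth he (fun T _ _ _ _ _ E lam c hE hc p hp => ?_) T E lam c hE hc
    exact relNoeth_locus he (fun T _ _ _ _ _ E lam c hE hc => ih T E lam c hE hc) T hE hc
      (Finset.mem_filter.1 hp).2

end MultiPoly

/-! ### Dévissage of the nonscalar part of the action -/

namespace MultiPoly

open MvPolynomial StableNoetherian

variable {K : Type*} [Field K] {r n : ℕ}

/-- The partial derivative of `x ^ β` in the `i`-th group of variables. -/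
noncomputable def dslot (i : Fin r) (a : Fin n) (β : Fin n →₀ ℕ) : Ring' K r n :=
  rename (Prod.mk i) (pderiv a (monomial β 1))

/-- This is Euler's identity; it turns operators `A i a` proportional to the coordinates into the
term `lam i * |β|` of the scalar action. -/
lemma sum_dslot_mul_X (i : Fin r) (β : Fin n →₀ ℕ) :
    ∑ a, dslot i a β * X (i, a) = (β.degree : K) • (slot i β : Ring' K r n) := by
  have h : ∑ a, pderiv a (monomial β (1 : K)) * X a = (β.degree : K) • monomial β (1 : K) := by
    have h1 : ∀ a, pderiv a (monomial β (1 : K)) * X a = (β a : K) • monomial β 1 := by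
      intro a
      rw [mul_comm, X_mul_pderiv_monomial, Nat.cast_smul_eq_nsmul]
    simp only [h1, ← Finset.sum_smul, Finsupp.degree_eq_sum, Nat.cast_sum]
  simp only [dslot, slot]
  rw [← map_smul, ← h, map_sum]
  simp

section Devissage

universe u
variable {T : Type u} [AddCommGroup T] [Module (Ring' K r n) T]

/-- Multiplication by a coordinate. -/
noncomputable def mulX (i : Fin r) (a : Fin n) : Module.End (Ring' K r n) T :=
  (X (i, a) : Ring' K r n) • 1

lemma mulX_apply (i : Fin r) (a : Fin n) (t : T) :
    (mulX i a : Module.End (Ring' K r n) T) t = (X (i, a) : Ring' K r n) • t := rfl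

/-- The operators that measure the failure of proportionality of `A i` and the coordinates. -/
noncomputable def skew (A : Fin r → Fin n → Module.End (Ring' K r n) T) (i : Fin r) (a b : Fin n) :
    Module.End (Ring' K r n) T :=
  mulX i b * A i a - mulX i a * A i b

lemma skew_apply (A : Fin r → Fin n → Module.End (Ring' K r n) T) (i : Fin r) (a b : Fin n) (t : T) :
    skew A i a b t = (X (i, b) : Ring' K r n) • A i a t - (X (i, a) : Ring' K r n) • A i b t := rfl

lemma mem_sup_map_of_eq {U X : Submodule (Ring' K r n) T} {c : Module.End (Ring' K r n) T} {s t : T}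
    (ht : t ∈ X) (h : s = c t) : s ∈ U ⊔ X.map c :=
  Submodule.mem_sup_right ⟨t, ht, h.symm⟩

variable [Module K T]

/-- `U` is stable under all the operators. -/
structure OpStable (E : Fin r → Module.End K T) (I : Fin r → Module.End (Ring' K r n) T)
    (A : Fin r → Fin n → Module.End (Ring' K r n) T) (U : Submodule (Ring' K r n) T) : Prop where
  E_mem : ∀ i, ∀ t ∈ U, E i t ∈ U
  I_mem : ∀ i, ∀ t ∈ U, I i t ∈ U
  A_mem : ∀ i a, ∀ t ∈ U, A i a t ∈ U

section Stable

variable {E : Fin r → Module.End K T} {I : Fin r → Module.End (Ring' K r n) T}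
  {A : Fin r → Fin n → Module.End (Ring' K r n) T}

lemma OpStable.sup {U L : Submodule (Ring' K r n) T} (hU : OpStable E I A U)
    (hL : OpStable E I A L) : OpStable E I A (U ⊔ L) := by
  constructor
  · intro i t ht
    obtain ⟨a, ha, b, hb, rfl⟩ := Submodule.mem_sup.1 ht
    rw [map_add]; exact Submodule.add_mem_sup (hU.E_mem i a ha) (hL.E_mem i b hb)
  · intro i t ht
    obtain ⟨a, ha, b, hb, rfl⟩ := Submodule.mem_sup.1 ht
    rw [map_add]; exact Submodule.add_mem_sup (hU.I_mem i a ha) (hL.I_mem i b hb)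
  · intro i x t ht
    obtain ⟨a, ha, b, hb, rfl⟩ := Submodule.mem_sup.1 ht
    rw [map_add]; exact Submodule.add_mem_sup (hU.A_mem i x a ha) (hL.A_mem i x b hb)

lemma OpStable.sup_map {U X : Submodule (Ring' K r n) T} (hU : OpStable E I A U)
    (c : Module.End (Ring' K r n) T) (hE : ∀ i, ∀ t ∈ X, E i (c t) ∈ U ⊔ X.map c)
    (hI : ∀ i, ∀ t ∈ X, I i (c t) ∈ U ⊔ X.map c) (hA : ∀ i a, ∀ t ∈ X, A i a (c t) ∈ U ⊔ X.map c) :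
    OpStable E I A (U ⊔ X.map c) := by
  constructor
  · intro i t ht
    obtain ⟨a, ha, _, ⟨b, hb, rfl⟩, rfl⟩ := Submodule.mem_sup.1 ht
    rw [map_add]; exact add_mem (Submodule.mem_sup_left (hU.E_mem i a ha)) (hE i b hb)
  · intro i t ht
    obtain ⟨a, ha, _, ⟨b, hb, rfl⟩, rfl⟩ := Submodule.mem_sup.1 ht
    rw [map_add]; exact add_mem (Submodule.mem_sup_left (hU.I_mem i a ha)) (hI i b hb)
  · intro i x t ht
    obtain ⟨a, ha, _, ⟨b, hb, rfl⟩, rfl⟩ := Submodule.mem_sup.1 ht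
    rw [map_add]; exact add_mem (Submodule.mem_sup_left (hU.A_mem i x a ha)) (hA i x b hb)

variable (E I A) in
/-- A subquotient of `T`. -/
structure SubQuot where
  U : Submodule (Ring' K r n) T
  L : Submodule (Ring' K r n) T
  hU : OpStable E I A U
  hL : OpStable E I A L
  le : U ≤ L

/-- `P` is a subquotient of `Q`. -/
def SubQuot.Le (P Q : SubQuot E I A) : Prop := Q.U ≤ P.U ∧ P.L ≤ Q.L

lemma SubQuot.Le.trans {P Q R : SubQuot E I A} (h : P.Le Q) (h' : Q.Le R) : P.Le R :=
  ⟨h'.1.trans h.1, h.2.trans h'.2⟩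

/-- The operator `c` vanishes on the subquotient. -/
def SubQuot.Kills (P : SubQuot E I A) (c : Module.End (Ring' K r n) T) : Prop := ∀ t ∈ P.L, c t ∈ P.U

lemma SubQuot.Kills.mono {P Q : SubQuot E I A} {c : Module.End (Ring' K r n) T} (h : Q.Kills c)
    (hPQ : P.Le Q) : P.Kills c := fun t ht => hPQ.1 (h t (hPQ.2 ht))

/-- The property passes to subquotients. -/
def Hereditary (Q : SubQuot E I A → Prop) : Prop := ∀ P P', SubQuot.Le P' P → Q P → Q P'

/-- The operator `c` preserves stable subspaces, and the images of stable subspaces under `c` are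
stable, modulo `P.U`. -/
def SubQuot.Normal (P : SubQuot E I A) (c : Module.End (Ring' K r n) T) : Prop :=
  (∀ X, OpStable E I A X → ∀ t ∈ X, c t ∈ X) ∧
    ∀ X, OpStable E I A X → P.U ≤ X → X ≤ P.L → OpStable E I A (P.U ⊔ X.map c)

lemma SubQuot.opStable_prod (P : SubQuot E I A) (cs : List (Module.End (Ring' K r n) T))
    (h : ∀ c ∈ cs, P.Normal c) : OpStable E I A (P.U ⊔ P.L.map cs.prod) ∧
      P.U ⊔ P.L.map cs.prod ≤ P.L := by
  induction cs with
  | nil => simpa [Module.End.one_eq_id, sup_eq_right.2 P.le] using P.hL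
  | cons c cs ih =>
    obtain ⟨h1, h2⟩ := ih fun c hc => h c (by simp [hc])
    obtain ⟨h3, h4⟩ := h c (by simp)
    have h7 : P.U ⊔ P.L.map (c :: cs).prod = P.U ⊔ (P.U ⊔ P.L.map cs.prod).map c := by
      rw [Submodule.map_sup, ← sup_assoc, sup_eq_left.2 (Submodule.map_le_iff_le_comap.2
        (h3 _ P.hU)), List.prod_cons, Module.End.mul_eq_comp, Submodule.map_comp]
    rw [h7]
    refine ⟨h4 _ h1 le_sup_left h2, sup_le P.le ?_⟩
    rintro _ ⟨t, ht, rfl⟩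
    exact h3 _ P.hL _ (h2 ht)

end Stable

variable [IsScalarTower K (Ring' K r n) T]

/-- The action of `x ^ β` times the Euler field, in terms of operators `A i a` that describe the
nonscalar part. -/
noncomputable def fullAct (E : Fin r → Module.End K T) (I : Fin r → Module.End (Ring' K r n) T)
    (A : Fin r → Fin n → Module.End (Ring' K r n) T) (β : Fin n →₀ ℕ) : Module.End K T :=
  ∑ i, (Algebra.lsmul K K T (slot i β : Ring' K r n) * (E i + (I i).restrictScalars K) +
    ∑ a, Algebra.lsmul K K T (dslot i a β : Ring' K r n) * (A i a).restrictScalars K)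

lemma fullAct_apply (E : Fin r → Module.End K T) (I : Fin r → Module.End (Ring' K r n) T)
    (A : Fin r → Fin n → Module.End (Ring' K r n) T) (β : Fin n →₀ ℕ) (t : T) :
    fullAct E I A β t = ∑ i, ((slot i β : Ring' K r n) • (E i t + I i t) +
      ∑ a, (dslot i a β : Ring' K r n) • A i a t) := by
  simp [fullAct, LinearMap.sum_apply]

/-- The relations satisfied by the operators that describe modules of tensor fields. -/
structure IsFieldOps (E : Fin r → Module.End K T) (I : Fin r → Module.End (Ring' K r n) T)
    (A : Fin r → Fin n → Module.End (Ring' K r n) T) : Prop where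
  euler : IsEuler n E
  euler_I : ∀ i j t, E i (I j t) = I j (E i t)
  euler_A : ∀ i j a t, E i (A j a t) = A j a (E i t) + if i = j then A j a t else 0
  I_comm : ∀ i j, I i * I j = I j * I i
  I_A : ∀ i j a, I i * A j a = A j a * I i
  A_comm : ∀ i j a b, i ≠ j → A i a * A j b = A j b * A i a
  A_lie : ∀ i a b, A i a * A i b - A i b * A i a = skew A i a b
  skew_nilpotent : ∀ i a b, IsNilpotent (skew A i a b)
  A_split : ∀ i a, ∃ l : List K, (l.map fun s => A i a - s • mulX i a).prod = 0
  I_split : ∀ i, ∃ l : List K, (l.map fun s => I i - s • (1 : Module.End (Ring' K r n) T)).prod = 0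

variable {E : Fin r → Module.End K T} {I : Fin r → Module.End (Ring' K r n) T}
  {A : Fin r → Fin n → Module.End (Ring' K r n) T}

lemma OpStable.fullAct_mem {U : Submodule (Ring' K r n) T} (hU : OpStable E I A U)
    (β : Fin n →₀ ℕ) {t : T} (ht : t ∈ U) : fullAct E I A β t ∈ U := by
  rw [fullAct_apply]
  refine U.sum_mem fun i _ => U.add_mem (U.smul_mem _ (U.add_mem (hU.E_mem i t ht)
    (hU.I_mem i t ht))) (U.sum_mem fun a _ => U.smul_mem _ (hU.A_mem i a t ht))

/-- The subquotient is noetherian. -/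
def SubQuot.IsNoeth (e : ℕ) (P : SubQuot E I A) : Prop :=
  RelNoeth (fun β : {β : Fin n →₀ ℕ // e ≤ β.degree} => fullAct E I A β.1)
    (P.U.restrictScalars K) (P.L.restrictScalars K)

/-- Subquotients with `Q₀` are noetherian if their subquotients with `Q₁` are. -/
def Covers (e : ℕ) (Q₀ Q₁ : SubQuot E I A → Prop) : Prop :=
  ∀ P, Q₀ P → (∀ P', SubQuot.Le P' P → Q₁ P' → P'.IsNoeth e) → P.IsNoeth e

lemma Covers.trans {e : ℕ} {Q₀ Q₁ Q₂ : SubQuot E I A → Prop} (h : Covers e Q₀ Q₁)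
    (h' : Covers e Q₁ Q₂) : Covers e Q₀ Q₂ := fun P hP hP' =>
  h P hP fun P₁ h1 h2 => h' P₁ h2 fun P₂ h3 h4 => hP' P₂ (h3.trans h1) h4

/-- The conditions are imposed one after another, and heredity keeps those already obtained. -/
lemma Covers.forall {e : ℕ} {κ : Type*} [Finite κ] {Q₀ : SubQuot E I A → Prop}
    {Q : κ → SubQuot E I A → Prop} (hQ₀ : Hereditary Q₀) (hQ : ∀ j, Hereditary (Q j))
    (h : ∀ j, Covers e Q₀ (Q j)) : Covers e Q₀ (fun P => Q₀ P ∧ ∀ j, Q j P) := by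
  classical
  have := Fintype.ofFinite κ
  have key : ∀ s : Finset κ, Covers e Q₀ (fun P => Q₀ P ∧ ∀ j ∈ s, Q j P) := by
    intro s
    induction s using Finset.cons_induction with
    | empty => exact fun P hP h' => h' P ⟨le_rfl, le_rfl⟩ ⟨hP, by simp⟩
    | cons j s hj ih =>
      intro P hP hP'
      refine ih P hP fun P₁ h1 h2 => h j P₁ h2.1 fun P₂ h3 h4 => hP' P₂ (h3.trans h1)
        ⟨hQ₀ _ _ h3 h2.1, fun j' hj' => ?_⟩
      rcases Finset.mem_cons.1 hj' with rfl | hj'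
      · exact h4
      · exact hQ _ _ _ h3 (h2.2 j' hj')
  intro P hP hP'
  exact key Finset.univ P hP fun P₁ h1 h2 => hP' P₁ h1 ⟨h2.1, fun j => h2.2 j (Finset.mem_univ j)⟩

/-- The images of `P.L` under the tails of the product form a finite filtration, and each layer is
killed by one of the factors. Normality makes its members stable. -/
lemma SubQuot.isNoeth_of_list {e : ℕ} (cs : List (Module.End (Ring' K r n) T))
    (P : SubQuot E I A) (hcs : ∀ c ∈ cs, P.Normal c) (h0 : P.Kills cs.prod)
    (h : ∀ P' : SubQuot E I A, P'.Le P → (∃ c ∈ cs, P'.Kills c) → P'.IsNoeth e) :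
    P.IsNoeth e := by
  induction cs generalizing P with
  | nil =>
    have : P.L = P.U := le_antisymm (fun t ht => by simpa using h0 t ht) P.le
    rw [SubQuot.IsNoeth, this]
    exact relNoeth_self _
  | cons c cs ih =>
    obtain ⟨h1, h2⟩ := P.opStable_prod cs fun c hc => hcs c (by simp [hc])
    let P₁ : SubQuot E I A := ⟨P.U, P.U ⊔ P.L.map cs.prod, P.hU, h1, le_sup_left⟩
    let P₂ : SubQuot E I A := ⟨P.U ⊔ P.L.map cs.prod, P.L, h1, P.hL, h2⟩
    have hN1 : P₁.IsNoeth e := by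
      refine h P₁ ⟨le_rfl, h2⟩ ⟨c, by simp, fun t ht => ?_⟩
      obtain ⟨a, ha, _, ⟨b, hb, rfl⟩, rfl⟩ := Submodule.mem_sup.1 ht
      rw [map_add]
      exact P.U.add_mem ((hcs c (by simp)).1 _ P.hU a ha) (h0 b hb)
    have hN2 : P₂.IsNoeth e := by
      refine ih P₂ (fun c hc => ?_) (fun t ht => ?_) fun P' hP' ⟨c, hc, hc'⟩ =>
        h P' (hP'.trans ⟨le_sup_left, le_rfl⟩) ⟨c, by simp [hc], hc'⟩
      · obtain ⟨h3, h4⟩ := hcs c (by simp [hc])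
        refine ⟨h3, fun X hX hUX hXL => ?_⟩
        have := h1.sup (h4 X hX (le_sup_left.trans hUX) hXL)
        rwa [← sup_assoc, sup_eq_left.2 (le_sup_left : P.U ≤ P.U ⊔ P.L.map cs.prod)] at this
      · exact Submodule.mem_sup_right ⟨t, ht, rfl⟩
    exact RelNoeth.trans hN1 hN2 fun β t ht => P₁.hL.fullAct_mem β.1 ht

lemma covers_of_list {e : ℕ} {Q₀ Q₁ : SubQuot E I A → Prop}
    (h : ∀ P, Q₀ P → ∃ cs : List (Module.End (Ring' K r n) T), (∀ c ∈ cs, P.Normal c) ∧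
      P.Kills cs.prod ∧ ∀ P' : SubQuot E I A, P'.Le P → ∀ c ∈ cs, P'.Kills c → Q₁ P') :
    Covers e Q₀ Q₁ := fun P hP hP' => by
  obtain ⟨cs, h1, h2, h3⟩ := h P hP
  exact P.isNoeth_of_list cs h1 h2 fun P' h4 ⟨c, hc, h5⟩ => hP' P' h4 (h3 P' h4 c hc h5)

namespace IsFieldOps

lemma E_mulX (h : IsFieldOps E I A) (i j : Fin r) (a : Fin n) (t : T) :
    E i ((X (j, a) : Ring' K r n) • t) =
      (X (j, a) : Ring' K r n) • (E i t + if i = j then t else 0) := by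
  rw [h.euler, eul_X]
  by_cases hij : i = j
  · rw [if_pos hij.symm, if_pos hij, smul_add, add_comm]
  · rw [if_neg (Ne.symm hij), if_neg hij, zero_smul, zero_add, add_zero]

lemma I_apply_comm (h : IsFieldOps E I A) (i j : Fin r) (t : T) : I i (I j t) = I j (I i t) :=
  LinearMap.congr_fun (h.I_comm i j) t

lemma I_A_apply (h : IsFieldOps E I A) (i j : Fin r) (a : Fin n) (t : T) :
    I i (A j a t) = A j a (I i t) :=
  LinearMap.congr_fun (h.I_A i j a) t

lemma A_apply_comm (h : IsFieldOps E I A) {i j : Fin r} (hij : i ≠ j) (a b : Fin n) (t : T) :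
    A i a (A j b t) = A j b (A i a t) :=
  LinearMap.congr_fun (h.A_comm i j a b hij) t

lemma A_lie_apply (h : IsFieldOps E I A) (i : Fin r) (a b : Fin n) (t : T) :
    A i a (A i b t) = A i b (A i a t) + skew A i a b t := by
  have := LinearMap.congr_fun (h.A_lie i a b) t
  rw [← this]
  simp

/-- The operators pass through `skew A i a b` up to harmless changes: at the same point `E i`
becomes `E i + 2` and `A i c` becomes `A i c - X (i, c)`, while all others commute with it. -/
lemma normal_skew (h : IsFieldOps E I A) (P : SubQuot E I A) (i : Fin r) (a b : Fin n) :
    P.Normal (skew A i a b) := by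
  refine ⟨fun X hX t ht => ?_, fun X hX hUX hXL => P.hU.sup_map _ (fun j t ht => ?_)
    (fun j t ht => ?_) fun j c t ht => ?_⟩
  · rw [skew_apply]
    exact X.sub_mem (X.smul_mem _ (hX.A_mem _ _ _ ht)) (X.smul_mem _ (hX.A_mem _ _ _ ht))
  · refine mem_sup_map_of_eq (t := E j t + if j = i then t + t else 0) ?_ ?_
    · refine X.add_mem (hX.E_mem j t ht) ?_
      split_ifs
      · exact X.add_mem ht ht
      · exact X.zero_mem
    · rw [skew_apply, map_sub, h.E_mulX, h.E_mulX, h.euler_A, h.euler_A]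
      by_cases hj : j = i
      · simp only [if_pos hj, map_add, skew_apply]; module
      · simp only [if_neg hj, add_zero, skew_apply]
  · refine mem_sup_map_of_eq (hX.I_mem j t ht) ?_
    rw [skew_apply, map_sub, map_smul, map_smul, h.I_A_apply, h.I_A_apply, skew_apply]
  · by_cases hj : j = i
    · subst hj
      refine mem_sup_map_of_eq (t := A j c t - (MvPolynomial.X (j, c) : Ring' K r n) • t)
        (X.sub_mem (hX.A_mem j c t ht) (X.smul_mem _ ht)) ?_
      rw [skew_apply, map_sub, map_smul, map_smul, h.A_lie_apply j c a, h.A_lie_apply j c b, map_sub,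
        map_smul]
      simp only [skew_apply]
      module
    · refine mem_sup_map_of_eq (hX.A_mem j c t ht) ?_
      rw [skew_apply, map_sub, map_smul, map_smul, h.A_apply_comm hj, h.A_apply_comm hj, skew_apply]

lemma normal_mulX (h : IsFieldOps E I A) (P : SubQuot E I A) (i : Fin r) (a : Fin n) :
    P.Normal (mulX i a) := by
  refine ⟨fun X hX t ht => X.smul_mem _ ht, fun X hX hUX hXL => P.hU.sup_map _ (fun j t ht => ?_)
    (fun j t ht => ?_) fun j c t ht => ?_⟩
  · refine mem_sup_map_of_eq (t := E j t + if j = i then t else 0) ?_ (h.E_mulX j i a t)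
    refine X.add_mem (hX.E_mem j t ht) ?_
    split_ifs
    · exact ht
    · exact X.zero_mem
  · exact mem_sup_map_of_eq (hX.I_mem j t ht) (map_smul _ _ _)
  · exact mem_sup_map_of_eq (hX.A_mem j c t ht) (map_smul _ _ _)

lemma normal_I (h : IsFieldOps E I A) (P : SubQuot E I A) (i : Fin r) (s : K) :
    P.Normal (I i - s • (1 : Module.End (Ring' K r n) T)) := by
  have hs : ∀ t, (I i - s • (1 : Module.End (Ring' K r n) T)) t = I i t - s • t := fun t => rfl
  refine ⟨fun X hX t ht => ?_, fun X hX hUX hXL => P.hU.sup_map _ (fun j t ht => ?_)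
    (fun j t ht => ?_) fun j c t ht => ?_⟩
  · rw [hs]
    exact X.sub_mem (hX.I_mem i t ht) (X.smul_of_tower_mem s ht)
  · refine mem_sup_map_of_eq (hX.E_mem j t ht) ?_
    rw [hs, hs, map_sub, h.euler_I, map_smul]
  · refine mem_sup_map_of_eq (hX.I_mem j t ht) ?_
    rw [hs, hs, map_sub, h.I_apply_comm, LinearMap.map_smul_of_tower]
  · refine mem_sup_map_of_eq (hX.A_mem j c t ht) ?_
    rw [hs, hs, map_sub, h.I_A_apply, LinearMap.map_smul_of_tower]

/-- The commutator of `A i c` and `A i a` is `skew A i c a`, so these operators commute on the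
subquotient once the skew operators vanish there. -/
lemma normal_A (h : IsFieldOps E I A) (P : SubQuot E I A) (i : Fin r) (a : Fin n) (s : K)
    (hP : ∀ b, P.Kills (skew A i b a)) : P.Normal (A i a - s • mulX i a) := by
  have hs : ∀ t, (A i a - s • mulX i a : Module.End (Ring' K r n) T) t = A i a t - s • (X (i, a) : Ring' K r n) • t :=
    fun t => rfl
  refine ⟨fun X hX t ht => ?_, fun X hX hUX hXL => P.hU.sup_map _ (fun j t ht => ?_)
    (fun j t ht => ?_) fun j c t ht => ?_⟩
  · rw [hs]
    exact X.sub_mem (hX.A_mem i a t ht) (X.smul_of_tower_mem s (X.smul_mem _ ht))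
  · refine mem_sup_map_of_eq (t := E j t + if j = i then t else 0) ?_ ?_
    · refine X.add_mem (hX.E_mem j t ht) ?_
      split_ifs
      · exact ht
      · exact X.zero_mem
    rw [hs, hs, map_sub, h.euler_A, map_smul, h.E_mulX]
    by_cases hj : j = i
    · simp only [if_pos hj, map_add]
    · simp only [if_neg hj, add_zero]
  · refine mem_sup_map_of_eq (hX.I_mem j t ht) ?_
    rw [hs, hs, map_sub, h.I_A_apply, LinearMap.map_smul_of_tower, map_smul]
  · by_cases hj : j = i
    · subst hj
      have h1 : A j c ((A j a - s • mulX j a : Module.End (Ring' K r n) T) t) = skew A j c a t +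
          (A j a - s • mulX j a : Module.End (Ring' K r n) T) (A j c t) := by
        rw [hs, hs, map_sub, h.A_lie_apply j c a, LinearMap.map_smul_of_tower, map_smul]
        abel
      rw [h1]
      exact Submodule.add_mem_sup (hP c t (hXL ht)) ⟨_, hX.A_mem j c t ht, rfl⟩
    · refine mem_sup_map_of_eq (hX.A_mem j c t ht) ?_
      rw [hs, hs, map_sub, h.A_apply_comm hj, LinearMap.map_smul_of_tower, map_smul]

lemma covers_skew (h : IsFieldOps E I A) (e : ℕ) :
    Covers e (fun _ : SubQuot E I A => True) (fun P => ∀ i a b, P.Kills (skew A i a b)) := by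
  have := Covers.forall (e := e) (κ := Fin r × Fin n × Fin n)
    (Q₀ := fun _ : SubQuot E I A => True) (Q := fun j P => P.Kills (skew A j.1 j.2.1 j.2.2))
    (fun _ _ _ _ => trivial) (fun _ _ _ h hk => hk.mono h) fun j => covers_of_list fun P _ => by
      obtain ⟨m, hm⟩ := h.skew_nilpotent j.1 j.2.1 j.2.2
      refine ⟨List.replicate m (skew A j.1 j.2.1 j.2.2), fun c hc => ?_, ?_, fun P' _ c hc hk => ?_⟩
      · rw [List.eq_of_mem_replicate hc]; exact h.normal_skew P _ _ _
      · rw [List.prod_replicate, hm]; exact fun t _ => P.U.zero_mem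
      · rwa [List.eq_of_mem_replicate hc] at hk
  exact fun P hP h' => this P hP fun P' h1 h2 => h' P' h1 fun i a b => h2.2 (i, a, b)

/-- The subquotients on which the operators `A i a` and `I i` are scalar multiples of
multiplication operators. -/
def Scalar (P : SubQuot E I A) : Prop :=
  (∀ i a b, P.Kills (skew A i a b)) ∧ (∀ i a, ∃ s : K, P.Kills (A i a - s • mulX i a)) ∧
    ∀ i, ∃ s : K, P.Kills (I i - s • (1 : Module.End (Ring' K r n) T))

lemma hereditary_scalar : Hereditary (Scalar : SubQuot E I A → Prop) := fun _ _ h hP =>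
  ⟨fun i a b => (hP.1 i a b).mono h, fun i a => (hP.2.1 i a).imp fun _ hs => hs.mono h,
    fun i => (hP.2.2 i).imp fun _ hs => hs.mono h⟩

lemma covers_scalar (h : IsFieldOps E I A) (e : ℕ) :
    Covers e (fun _ : SubQuot E I A => True) Scalar := by
  have hQ₀ : Hereditary (fun P : SubQuot E I A => ∀ i a b, P.Kills (skew A i a b)) :=
    fun _ _ h hP i a b => (hP i a b).mono h
  have h1 := Covers.forall (e := e) (κ := Fin r × Fin n) (Q := fun j (P : SubQuot E I A) =>
    ∃ s : K, P.Kills (A j.1 j.2 - s • mulX j.1 j.2)) hQ₀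
    (fun j _ _ h hk => hk.imp fun _ hs => hs.mono h) fun j => covers_of_list fun P hP => by
      obtain ⟨l, hl⟩ := h.A_split j.1 j.2
      refine ⟨_, fun c hc => ?_, fun t _ => by rw [hl]; exact P.U.zero_mem, fun P' _ c hc hk => ?_⟩
      · obtain ⟨s, _, rfl⟩ := List.mem_map.1 hc
        exact h.normal_A P _ _ _ fun b => hP _ _ _
      · obtain ⟨s, _, rfl⟩ := List.mem_map.1 hc
        exact ⟨s, hk⟩
  have h2 := Covers.forall (e := e) (κ := Fin r) (Q := fun j (P : SubQuot E I A) =>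
    ∃ s : K, P.Kills (I j - s • (1 : Module.End (Ring' K r n) T))) hQ₀
    (fun j _ _ h hk => hk.imp fun _ hs => hs.mono h) fun j => covers_of_list fun P hP => by
      obtain ⟨l, hl⟩ := h.I_split j
      refine ⟨_, fun c hc => ?_, fun t _ => by rw [hl]; exact P.U.zero_mem, fun P' _ c hc hk => ?_⟩
      · obtain ⟨s, _, rfl⟩ := List.mem_map.1 hc
        exact h.normal_I P _ _
      · obtain ⟨s, _, rfl⟩ := List.mem_map.1 hc
        exact ⟨s, hk⟩
  refine (h.covers_skew e).trans fun P hP h' => h1 P hP fun P₁ h3 h4 => h2 P₁ h4.1 fun P₂ h5 h6 =>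
    h' P₂ (h5.trans h3) ⟨h6.1, fun i a => (h4.2 (i, a)).imp fun _ hs => hs.mono h5, h6.2⟩

/-- The subquotients on which each `A i` is proportional to the coordinates. -/
def Proportional (P : SubQuot E I A) : Prop :=
  (∀ i, ∃ s : K, ∀ a, P.Kills (A i a - s • mulX i a)) ∧
    ∀ i, ∃ s : K, P.Kills (I i - s • (1 : Module.End (Ring' K r n) T))

/-- Suppose `A i a = s X (i, a)` and `A i b = s' X (i, b)` on a subquotient. The vanishing of `skew
A i a b` gives `(s' - s) X (i, a) X (i, b) = 0`. So either the scalars agree or a further filtration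
has layers killed by one of the two coordinates, and for such a coordinate the scalar is arbitrary.
-/
lemma covers_proportional (h : IsFieldOps E I A) (e : ℕ) :
    Covers e (fun _ : SubQuot E I A => True) Proportional := by
  refine (h.covers_scalar e).trans ?_
  have h1 := Covers.forall (e := e) (κ := Fin r × Fin n × Fin n) (Q := fun j (P : SubQuot E I A) =>
    (∃ s : K, P.Kills (A j.1 j.2.1 - s • mulX j.1 j.2.1) ∧
      P.Kills (A j.1 j.2.2 - s • mulX j.1 j.2.2)) ∨ P.Kills (mulX j.1 j.2.1) ∨
      P.Kills (mulX j.1 j.2.2)) hereditary_scalar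
    (fun j _ _ h hk => by
      rcases hk with ⟨s, h1, h2⟩ | h1 | h1
      · exact Or.inl ⟨s, h1.mono h, h2.mono h⟩
      · exact Or.inr (Or.inl (h1.mono h))
      · exact Or.inr (Or.inr (h1.mono h))) fun ⟨i, a, b⟩ P hP hP' => by
      obtain ⟨s, hs⟩ := hP.2.1 i a
      obtain ⟨s', hs'⟩ := hP.2.1 i b
      by_cases hss : s = s'
      · subst hss
        exact hP' P ⟨le_rfl, le_rfl⟩ (Or.inl ⟨s, hs, hs'⟩)
      · refine P.isNoeth_of_list [mulX i a, mulX i b] (fun c hc => ?_) (fun t ht => ?_)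
          fun P' hPP ⟨c, hc, hk⟩ => hP' P' hPP ?_
        · simp only [List.mem_cons, List.not_mem_nil, or_false] at hc
          rcases hc with rfl | rfl <;> exact h.normal_mulX P _ _
        · have e1 := P.U.smul_mem (X (i, b)) (hs t ht)
          have e2 := P.U.smul_mem (X (i, a)) (hs' t ht)
          have e3 := P.U.sub_mem (P.U.sub_mem e1 e2) (hP.1 i a b t ht)
          have e4 : (X (i, b) : Ring' K r n) • (A i a - s • mulX i a : Module.End (Ring' K r n) T) t -
              (X (i, a) : Ring' K r n) • (A i b - s' • mulX i b : Module.End (Ring' K r n) T) t - skew A i a b t =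
              (s' - s) • (X (i, a) : Ring' K r n) • (X (i, b) : Ring' K r n) • t := by
            simp only [LinearMap.sub_apply, LinearMap.smul_apply, mulX_apply, skew_apply, smul_sub,
              smul_smul_comm', sub_smul, smul_comm (X (i, b) : Ring' K r n) (X (i, a) : Ring' K r n)]
            abel
          rw [e4] at e3
          have := P.U.smul_of_tower_mem (s' - s)⁻¹ e3
          rw [smul_smul, inv_mul_cancel₀ (sub_ne_zero.2 (Ne.symm hss)), one_smul] at this
          simpa [mulX_apply, smul_comm (X (i, b) : Ring' K r n) (X (i, a) : Ring' K r n)] using this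
        · simp only [List.mem_cons, List.not_mem_nil, or_false] at hc
          rcases hc with rfl | rfl
          · exact Or.inr (Or.inl hk)
          · exact Or.inr (Or.inr hk)
  refine fun P hP h' => h1 P hP fun P₁ h3 ⟨h4, h5⟩ => h' P₁ h3 ⟨fun i => ?_, h4.2.2⟩
  have hzero : ∀ a (s s' : K), P₁.Kills (mulX i a) → P₁.Kills (A i a - s • mulX i a) →
      P₁.Kills (A i a - s' • mulX i a) := by
    intro a s s' hX hs t ht
    have := P₁.U.add_mem (hs t ht) (P₁.U.smul_of_tower_mem (s - s') (hX t ht))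
    convert this using 1
    simp only [LinearMap.sub_apply, LinearMap.smul_apply, sub_smul]
    abel
  -- The common scalar is determined by any coordinate that does not act as zero; if there is none,
  -- the value `0` serves.
  by_cases hall : ∀ a, P₁.Kills (mulX i a)
  · exact ⟨0, fun a => by
      obtain ⟨s, hs⟩ := h4.2.1 i a
      exact hzero a s 0 (hall a) hs⟩
  · push Not at hall
    obtain ⟨a, ha⟩ := hall
    obtain ⟨s, hs⟩ := h4.2.1 i a
    refine ⟨s, fun b => ?_⟩
    rcases h5 (i, a, b) with ⟨s', h6, h7⟩ | h6 | h6
    · by_cases hss : s = s'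
      · rwa [hss]
      · exfalso
        refine ha fun t ht => ?_
        have := P₁.U.smul_of_tower_mem (s' - s)⁻¹ (P₁.U.sub_mem (hs t ht) (h6 t ht))
        convert this using 1
        simp only [LinearMap.sub_apply, LinearMap.smul_apply]
        rw [sub_sub_sub_cancel_left, ← sub_smul, smul_smul,
          inv_mul_cancel₀ (sub_ne_zero.2 (Ne.symm hss)), one_smul]
    · exact absurd h6 ha
    · obtain ⟨s', hs'⟩ := h4.2.1 i b
      exact hzero b s' s h6 hs'


end IsFieldOps

/-- Joint eigenvectors for distinct eigenvalues that sum to an element of a stable subspace lie in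
this subspace. -/
lemma mem_of_sum_eigen_mem {N : Submodule K T} (hN : ∀ i, ∀ t ∈ N, E i t ∈ N)
    (s : Finset (Fin r → K)) (w : (Fin r → K) → T) (hw : ∀ ε ∈ s, ∀ i, E i (w ε) = ε i • w ε)
    (h : ∑ ε ∈ s, w ε ∈ N) : ∀ ε ∈ s, w ε ∈ N := by
  classical
  induction s using Finset.cons_induction generalizing w with
  | empty => simp
  | cons δ s hδ ih =>
    have h1 : ∀ ε ∈ s, w ε ∈ N := by
      intro ε hε
      have hne : ∃ i, ε i ≠ δ i := by
        by_contra! hc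
        exact hδ (funext hc ▸ hε)
      obtain ⟨i, hi⟩ := hne
      -- Applying `E i - δ i` removes the component `δ` and rescales the component `ε` by a nonzero
      -- factor.
      have h2 := ih (fun ε => (ε i - δ i) • w ε) (fun ε hε j => by
        rw [map_smul, hw ε (Finset.mem_cons_of_mem hε), smul_comm]) (by
        have := N.sub_mem (hN i _ h) (N.smul_mem (δ i) h)
        rw [map_sum, Finset.smul_sum, ← Finset.sum_sub_distrib, Finset.sum_cons] at this
        convert this using 1
        rw [hw δ (Finset.mem_cons_self _ _), sub_self, zero_add]
        exact Finset.sum_congr rfl fun ε hε => by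
          rw [hw ε (Finset.mem_cons_of_mem hε), sub_smul]) ε hε
      exact (N.smul_mem_iff (sub_ne_zero.2 hi)).1 h2
    intro ε hε
    rcases Finset.mem_cons.1 hε with rfl | hε
    · rw [Finset.sum_cons] at h
      exact (N.add_mem_iff_left (N.sum_mem h1)).1 h
    · exact h1 ε hε

/-- A stable subspace of the span of the eigenvectors is spanned by eigenvectors. -/
lemma exists_eigen_sum_of_stable {N : Submodule K T} (hN : ∀ i, ∀ t ∈ N, E i t ∈ N)
    {p : Fin r → K → Prop} {u : T} (hu : u ∈ eigenSpan E p) (huN : u ∈ N) :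
    ∃ (s : Finset (Fin r → K)) (w : (Fin r → K) → T), (∀ ε ∈ s, ∀ i, p i (ε i)) ∧
      (∀ ε ∈ s, ∀ i, E i (w ε) = ε i • w ε) ∧ (∀ ε ∈ s, w ε ∈ N) ∧ ∑ ε ∈ s, w ε = u := by
  classical
  obtain ⟨m, ε, w, h1, h2, h3⟩ := exists_eigen_sum hu
  have h4 : ∀ δ ∈ Finset.univ.image ε, ∀ i, E i (∑ k with ε k = δ, w k) =
      δ i • ∑ k with ε k = δ, w k := by
    intro δ _ i
    rw [map_sum, Finset.smul_sum]
    refine Finset.sum_congr rfl fun k hk => ?_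
    rw [h2, (Finset.mem_filter.1 hk).2]
  have h5 : ∑ δ ∈ Finset.univ.image ε, ∑ k with ε k = δ, w k = u := by
    rw [← h3]
    exact Finset.sum_fiberwise_of_maps_to (fun k _ => Finset.mem_image_of_mem ε (Finset.mem_univ k)) _
  refine ⟨Finset.univ.image ε, fun δ => ∑ k with ε k = δ, w k, ?_, h4,
    mem_of_sum_eigen_mem hN _ _ h4 (h5 ▸ huN), h5⟩
  intro δ hδ i
  obtain ⟨k, _, rfl⟩ := Finset.mem_image.1 hδ
  exact h1 k i

/-- The restriction of a linear map to a submodule over a larger ring. -/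
def restrictTower (f : Module.End K T) (L : Submodule (Ring' K r n) T) (h : ∀ t ∈ L, f t ∈ L) :
    Module.End K L where
  toFun t := ⟨f t, h t t.2⟩
  map_add' _ _ := Subtype.ext (map_add f _ _)
  map_smul' a _ := Subtype.ext (map_smul f a _)

lemma coe_restrictTower (f : Module.End K T) (L : Submodule (Ring' K r n) T) (h : ∀ t ∈ L, f t ∈ L)
    (t : L) : (restrictTower f L h t : T) = f t := rfl

/-- On `P.L / P.U` the operators `A i a` and `I i` are `lam i * X (i, a)` and `s i`. By Euler's
identity the full action becomes the scalar action with Euler operators `E i + s i`, and `noeth_act`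
applies. -/
lemma IsFieldOps.isNoeth_of_proportional [CharZero K] [Module.Finite (Ring' K r n) T] {e : ℕ}
    (he : 1 ≤ e) (h : IsFieldOps E I A) {c : Fin r → K} (hc : EigenvaluesFrom E c)
    (P : SubQuot E I A) (hP : IsFieldOps.Proportional P) : P.IsNoeth e := by
  obtain ⟨hA, hI⟩ := hP
  choose lam hlam using hA
  choose s hs using hI
  let ρ : {β : Fin n →₀ ℕ // e ≤ β.degree} → Module.End K T := fun β => fullAct E I A β.1
  let EL : Fin r → Module.End K P.L := fun i => restrictTower (E i + s i • 1) P.L fun t ht =>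
    P.L.add_mem (P.hL.E_mem i t ht) (P.L.smul_of_tower_mem (s i) ht)
  let ρL : {β : Fin n →₀ ℕ // e ≤ β.degree} → Module.End K P.L := fun β =>
    restrictTower (ρ β) P.L fun t ht => P.hL.fullAct_mem β.1 ht
  let U := P.U.submoduleOf P.L
  let q : P.L →ₗ[K] P.L ⧸ U := U.mkQ.restrictScalars K
  have hq : ∀ (f : Ring' K r n) t, q (f • t) = f • q t := fun f t => U.mkQ.map_smul f t
  have hqs : Function.Surjective q := U.mkQ_surjective
  have hq0 : ∀ t : P.L, q t = 0 ↔ (t : T) ∈ P.U := fun t => Submodule.Quotient.mk_eq_zero U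
  have h1 : ∀ i, ∃ f' : Module.End K (P.L ⧸ U), ∀ t, f' (q t) = q (EL i t) := by
    refine fun i => exists_induced q hqs _ fun t ht => ?_
    rw [hq0] at ht ⊢
    exact P.U.add_mem (P.hU.E_mem i t ht) (P.U.smul_of_tower_mem (s i) ht)
  choose E' hE' using h1
  have hEul : IsEuler n E' := by
    intro i f t
    obtain ⟨t, rfl⟩ := hqs t
    rw [← hq, hE', hE', ← hq, ← hq, ← map_add]
    refine congrArg q (Subtype.ext ?_)
    change E i (f • (t : T)) + s i • f • (t : T) = eul i f • (t : T) + f • (E i t + s i • (t : T))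
    rw [h.euler, smul_add, smul_comm f (s i), add_assoc]
  have hfin : Module.Finite (Ring' K r n) P.L := Module.Finite.of_fg (IsNoetherian.noetherian P.L)
  have hEig : EigenvaluesFrom E' fun i => c i + s i := by
    rw [EigenvaluesFrom, eq_top_iff]
    rintro t' -
    obtain ⟨t, rfl⟩ := hqs t'
    obtain ⟨S, w, h2, h3, h4, h5⟩ := exists_eigen_sum_of_stable
      (N := P.L.restrictScalars K) (fun i t ht => P.hL.E_mem i t ht)
      (hc ▸ trivial : (t : T) ∈ eigenSpan E fun i x => ∃ m : ℕ, x = c i + m) t.2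
    have h6 : t = ∑ ε : S, ⟨w ε, h4 ε ε.2⟩ := by
      refine Subtype.ext ?_
      rw [AddSubmonoidClass.coe_finsetSum, ← h5]
      exact (Finset.sum_coe_sort S w).symm
    rw [h6, map_sum]
    refine Submodule.sum_mem _ fun ε _ => Submodule.subset_span ⟨fun i => ε.1 i + s i, fun i => ?_,
      fun i => ?_⟩
    · obtain ⟨m, hm⟩ := h2 ε ε.2 i
      exact ⟨m, by beta_reduce; rw [hm]; ring⟩
    · rw [hE', ← map_smul]
      refine congrArg q (Subtype.ext ?_)
      change E i (w ε) + s i • w ε = (ε.1 i + s i) • w ε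
      rw [h3 ε ε.2, add_smul]
  have hN := noeth_act he r (P.L ⧸ U) E' lam (fun i => c i + s i) hEul hEig
  have hqρ : ∀ β t, q (ρL β t) = act E' lam β.1 (q t) := by
    intro β t
    rw [act_apply]
    simp only [hE', ← hq, ← map_smul, ← map_add, ← map_sum]
    rw [← sub_eq_zero, ← map_sub, hq0, AddSubgroupClass.coe_sub, coe_restrictTower,
      AddSubmonoidClass.coe_finsetSum, fullAct_apply, ← Finset.sum_sub_distrib]
    refine P.U.sum_mem fun i _ => ?_
    have h7 := P.U.add_mem (P.U.smul_mem (slot i β.1) (hs i t t.2))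
      (P.U.sum_mem fun a (_ : a ∈ Finset.univ) => P.U.smul_mem (dslot i a β.1) (hlam i a t t.2))
    have h8 : ∑ a, (dslot i a β.1 : Ring' K r n) • (lam i • mulX i a : Module.End (Ring' K r n) T) t =
        (lam i * (β.1.degree : K)) • (slot i β.1 : Ring' K r n) • (t : T) := by
      have : ∀ a, (dslot i a β.1 : Ring' K r n) • (lam i • mulX i a : Module.End (Ring' K r n) T)
          (t : T) = lam i • (dslot i a β.1 * X (i, a) : Ring' K r n) • (t : T) := by
        intro a
        rw [LinearMap.smul_apply, mulX_apply, smul_comm, mul_smul]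
      simp only [this]
      rw [← Finset.smul_sum, ← Finset.sum_smul, sum_dslot_mul_X, smul_assoc, mul_smul]
    convert h7 using 1
    simp only [LinearMap.sub_apply, smul_sub, Finset.sum_sub_distrib, h8]
    change _ - ((slot i β.1 : Ring' K r n) • ((E i t + s i • (t : T)) + _)) = _
    simp only [smul_add, LinearMap.smul_apply, Module.End.one_apply, Submodule.coe_smul_of_tower]
    rw [smul_comm (slot i β.1 : Ring' K r n) (lam i * _)]
    abel
  have h9 := (RelNoeth.comap hN q hqρ).sup_range (ρ := ρ) (A := P.U.restrictScalars K)
    (P.L.subtype.restrictScalars K) (fun β t => by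
      change (ρL β t : T) - ρ β t ∈ _
      rw [coe_restrictTower, sub_self]; exact zero_mem _)
    (fun β t ht => P.hU.fullAct_mem β.1 ht) (by
      rintro _ ⟨t, ht, rfl⟩
      exact (hq0 t).1 ht)
  refine h9.mono le_rfl fun t ht => Submodule.mem_sup_right ⟨⟨t, ht⟩, rfl⟩

/-- Modules with the structure of tensor fields are noetherian. -/
theorem IsFieldOps.noeth_fullAct [CharZero K] [Module.Finite (Ring' K r n) T] {e : ℕ}
    (he : 1 ≤ e) (h : IsFieldOps E I A) {c : Fin r → K} (hc : EigenvaluesFrom E c) :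
    Noeth fun β : {β : Fin n →₀ ℕ // e ≤ β.degree} => fullAct E I A β.1 := by
  let P : SubQuot E I A := ⟨⊥, ⊤, ⟨by simp, by simp, by simp⟩, ⟨by simp, by simp, by simp⟩, bot_le⟩
  exact h.covers_proportional e P trivial fun P' _ hP' => h.isNoeth_of_proportional he hc P' hP'

end Devissage

end MultiPoly

/-! ### Matrix units and the model over an algebraically closed field -/

namespace MultiPoly

open MvPolynomial StableNoetherian

variable {K : Type*} [Field K] {r n : ℕ}

/-- An operator that is an eigenvector of a commutator with a nonzero eigenvalue is nilpotent. -/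
lemma isNilpotent_of_commutator {B T : Type*} [CommRing B] [IsDomain B] [CharZero B]
    [IsNoetherianRing B] [AddCommGroup T] [Module B T] [Module.Finite B T] [Module.Free B T]
    {A N : Module.End B T} {x : B} (hx : x ≠ 0) (h : A * N - N * A = x • N) : IsNilpotent N := by
  by_contra hN
  rw [IsNilpotent, not_exists] at hN
  have h1 : ∀ m : ℕ, A * N ^ m - N ^ m * A = (m * x : B) • N ^ m := by
    intro m
    induction m with
    | zero => simp
    | succ m ih =>
      have : A * N ^ (m + 1) - N ^ (m + 1) * A = (A * N ^ m - N ^ m * A) * N + N ^ m * (A * N - N * A) := by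
        rw [pow_succ]; noncomm_ring
      rw [this, ih, h, smul_mul_assoc, mul_smul_comm, ← pow_succ, ← add_smul]
      congr 1
      push_cast
      ring
  -- If no power of `N` vanished, the powers would be eigenvectors of `ad` for the distinct
  -- eigenvalues `m * x`, hence linearly independent in a noetherian module, which is absurd.
  let ad : Module.End B (Module.End B T) := LinearMap.mulLeft B A - LinearMap.mulRight B A
  have h2 := Module.End.eigenvectors_linearIndependent' ad (fun m : ℕ => (m * x : B))
    (fun m m' hm => by simpa [hx] using hm) (fun m => N ^ m) fun m =>
      ⟨Module.End.mem_eigenspace_iff.2 (h1 m), hN m⟩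
  have := h2.finite_of_isNoetherian
  exact not_finite ℕ

section RingLemmas

variable {R : Type*} [Ring R] [Algebra K R]

/-- The sum of an operator with split minimal polynomial and a nilpotent operator that shifts its
eigenvalues. -/
lemma exists_prod_add_nilpotent {H P x : R} (hxP : x * P = P * x)
    (h : H * P = P * (H + x)) (hP : IsNilpotent P) {l : List K}
    (hl : (l.map fun s => H - s • x).prod = 0) :
    ∃ l' : List K, (l'.map fun s => H + P - s • x).prod = 0 := by
  have h1 : ∀ m : ℕ, H * P ^ m = P ^ m * (H + (m : K) • x) := by
    intro m
    induction m with
    | zero => simp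
    | succ m ih =>
      rw [pow_succ, ← mul_assoc, ih, mul_assoc, add_mul, h, smul_mul_assoc, hxP, mul_assoc,
        ← mul_smul_comm, ← mul_add, add_assoc]
      congr 3
      push_cast
      rw [add_smul, one_smul, add_comm]
  have hxm : ∀ m : ℕ, x * P ^ m = P ^ m * x := fun m => (Commute.pow_right hxP m : _)
  -- Moving past `P ^ m` replaces `H` by `H + m x`, so the product with scalars shifted by `m` acts
  -- on the leading term as the original product, up to a multiple of `P ^ (m + 1)`.
  have h2 : ∀ (m : ℕ) (l : List K) (t : R), ∃ u,
      (l.map fun s => H + P - (s + (m : K)) • x).prod * (P ^ m * t) =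
      P ^ m * ((l.map fun s => H - s • x).prod * t) + P ^ (m + 1) * u := by
    intro m l t
    induction l with
    | nil => exact ⟨0, by simp⟩
    | cons s l ih =>
      obtain ⟨u, hu⟩ := ih
      obtain ⟨w, hw⟩ : ∃ w, w = (l.map fun s => H - s • x).prod * t := ⟨_, rfl⟩
      rw [← hw] at hu
      refine ⟨w + (H + ((m + 1 : ℕ) : K) • x + P - (s + m) • x) * u, ?_⟩
      rw [List.map_cons, List.prod_cons, mul_assoc, hu, List.map_cons, List.prod_cons, mul_assoc, ← hw]
      have e1 : (H + P - (s + m) • x) * (P ^ m * w) = P ^ m * ((H - s • x) * w) + P ^ (m + 1) * w := by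
        rw [← mul_assoc, sub_mul, add_mul, h1, smul_mul_assoc, hxm, ← pow_succ', ← mul_assoc, ← add_mul]
        congr 1
        rw [mul_add, mul_sub, mul_smul_comm, mul_smul_comm, add_smul]
        abel
      have e2 : (H + P - (s + m) • x) * (P ^ (m + 1) * u) =
          P ^ (m + 1) * ((H + ((m + 1 : ℕ) : K) • x + P - (s + m) • x) * u) := by
        rw [← mul_assoc, ← mul_assoc, sub_mul, add_mul, h1, smul_mul_assoc, hxm]
        congr 1
        rw [mul_sub, mul_add _ _ P, mul_smul_comm, ← pow_succ, ← pow_succ']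
      rw [mul_add, e1, e2]
      noncomm_ring
  -- Since the original product vanishes, each shifted copy of the list gains a factor `P`;
  -- nilpotency ends the process.
  have h3 : ∀ m : ℕ, ∃ (l' : List K) (u : R), (l'.map fun s => H + P - s • x).prod = P ^ m * u := by
    intro m
    induction m with
    | zero => exact ⟨[], 1, by simp⟩
    | succ m ih =>
      obtain ⟨l', u, hu⟩ := ih
      obtain ⟨v, hv⟩ := h2 m l u
      refine ⟨l.map (· + (m : K)) ++ l', v, ?_⟩
      rw [List.map_append, List.prod_append, hu, List.map_map]
      rw [hl, zero_mul, mul_zero, zero_add] at hv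
      exact hv
  obtain ⟨m, hm⟩ := hP
  obtain ⟨l', u, hu⟩ := h3 m
  exact ⟨l', by rw [hu, hm, zero_mul]⟩

/-- Commuting families of matrix units. -/
structure IsGl (σ : Fin r → Fin n → Fin n → R) : Prop where
  lie : ∀ i a b c d, σ i a b * σ i c d - σ i c d * σ i a b =
    (if b = c then σ i a d else 0) - if d = a then σ i c b else 0
  comm : ∀ i j, i ≠ j → ∀ a b c d, σ i a b * σ j c d = σ j c d * σ i a b

lemma IsGl.map {σ : Fin r → Fin n → Fin n → R} (h : IsGl σ) {R' : Type*} [Ring R'] (f : R →+* R') :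
    IsGl fun i a b => f (σ i a b) where
  lie i a b c d := by
    rw [← map_mul, ← map_mul, ← map_sub, h.lie, map_sub]
    split_ifs <;> simp
  comm i j hij a b c d := by rw [← map_mul, ← map_mul, h.comm i j hij]

/-- The trace of the matrix units. -/
def glTrace (σ : Fin r → Fin n → Fin n → R) (i : Fin r) : R := ∑ a, σ i a a

/-- The matrix units contracted with the coordinates. -/
def glContract (x : Fin r → Fin n → R) (σ : Fin r → Fin n → Fin n → R) (i : Fin r) (a : Fin n) : R :=
  ∑ j, x i j * σ i a j

variable {σ : Fin r → Fin n → Fin n → R} {x : Fin r → Fin n → R}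

lemma IsGl.trace_comm (h : IsGl σ) (i j : Fin r) (a b : Fin n) :
    glTrace σ i * σ j a b = σ j a b * glTrace σ i := by
  rw [glTrace, Finset.sum_mul, Finset.mul_sum]
  by_cases hij : i = j
  · subst hij
    rw [← sub_eq_zero, ← Finset.sum_sub_distrib]
    simp only [h.lie, Finset.sum_sub_distrib, Finset.sum_ite_eq, Finset.sum_ite_eq', Finset.mem_univ,
      if_true, sub_self]
  · exact Finset.sum_congr rfl fun c _ => h.comm i j hij _ _ _ _

lemma IsGl.trace_trace (h : IsGl σ) (i j : Fin r) :
    glTrace σ i * glTrace σ j = glTrace σ j * glTrace σ i := by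
  rw [glTrace.eq_def σ j, Finset.mul_sum, Finset.sum_mul]
  exact Finset.sum_congr rfl fun a _ => h.trace_comm _ _ _ _

lemma IsGl.trace_contract (h : IsGl σ) (hx : ∀ i a y, x i a * y = y * x i a) (i j : Fin r)
    (a : Fin n) : glTrace σ i * glContract x σ j a = glContract x σ j a * glTrace σ i := by
  rw [glContract, Finset.mul_sum, Finset.sum_mul]
  refine Finset.sum_congr rfl fun b _ => ?_
  rw [← mul_assoc, ← hx, mul_assoc, h.trace_comm, mul_assoc]

lemma IsGl.contract_comm (h : IsGl σ) (hx : ∀ i a y, x i a * y = y * x i a) {i j : Fin r}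
    (hij : i ≠ j) (a b : Fin n) :
    glContract x σ i a * glContract x σ j b = glContract x σ j b * glContract x σ i a := by
  simp only [glContract, Finset.mul_sum, Finset.sum_mul]
  rw [Finset.sum_comm]
  refine Finset.sum_congr rfl fun c _ => Finset.sum_congr rfl fun d _ => ?_
  calc x i c * σ i a c * (x j d * σ j b d) = x i c * (σ i a c * x j d) * σ j b d := by
        simp only [mul_assoc]
    _ = x j d * x i c * (σ i a c * σ j b d) := by rw [← hx, ← mul_assoc, hx i c]; simp only [mul_assoc]
    _ = x j d * (x i c * σ j b d) * σ i a c := by rw [h.comm i j hij]; simp only [mul_assoc]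
    _ = _ := by rw [hx i c]; simp only [mul_assoc]

lemma IsGl.contract_lie (h : IsGl σ) (hx : ∀ i a y, x i a * y = y * x i a) (i : Fin r) (a b : Fin n) :
    glContract x σ i a * glContract x σ i b - glContract x σ i b * glContract x σ i a =
      x i b * glContract x σ i a - x i a * glContract x σ i b := by
  have h1 : ∀ c d, x i c * σ i a c * (x i d * σ i b d) - x i d * σ i b d * (x i c * σ i a c) =
      x i c * x i d * (if c = b then σ i a d else 0) - x i c * x i d * if d = a then σ i b c else 0 := by
    intro c d
    rw [← mul_sub, ← h.lie, mul_sub]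
    congr 1
    · rw [mul_assoc, ← mul_assoc (σ _ _ _), ← hx]; simp only [mul_assoc]
    · rw [mul_assoc, ← mul_assoc (σ _ _ _), ← hx, hx i c (x i d)]; simp only [mul_assoc]
  simp only [glContract, Finset.mul_sum, Finset.sum_mul]
  rw [Finset.sum_comm (f := fun c d => x i d * σ i b d * (x i c * σ i a c)),
    ← Finset.sum_sub_distrib]
  simp only [← Finset.sum_sub_distrib, h1]
  simp only [Finset.sum_sub_distrib, mul_ite, mul_zero, Finset.sum_ite_eq', Finset.mem_univ, if_true]
  congr 1
  · exact Finset.sum_congr rfl fun c _ => mul_assoc _ _ _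
  · rw [Finset.sum_comm]
    simp only [Finset.sum_ite_eq', Finset.mem_univ, if_true]
    exact Finset.sum_congr rfl fun c _ => by rw [hx i c, mul_assoc]

/-- The skew operator is an eigenvector of the commutator with `glContract x σ i a`, which is the
input for its nilpotency. -/
lemma IsGl.contract_skew (h : IsGl σ) (hx : ∀ i a y, x i a * y = y * x i a) (i : Fin r) (a b : Fin n) :
    glContract x σ i a * (x i b * glContract x σ i a - x i a * glContract x σ i b) -
      (x i b * glContract x σ i a - x i a * glContract x σ i b) * glContract x σ i a =
      -(x i a * (x i b * glContract x σ i a - x i a * glContract x σ i b)) := by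
  rw [← h.contract_lie hx i a b, mul_sub (x i a), ← mul_assoc, ← mul_assoc, h.contract_lie hx i a b,
    mul_sub, sub_mul, ← mul_assoc, ← mul_assoc, ← hx, ← hx, mul_assoc (x i a) _ (glContract x σ i a)]
  simp only [mul_assoc]
  abel

/-- For `b ≠ a` the matrix unit `E_ab` has weight one under `E_aa`. Hence the off-diagonal part of
the contraction is an eigenvector of the commutator with the diagonal part, and so nilpotent in the
model. -/
lemma IsGl.sum_erase_lie (h : IsGl σ) (hx : ∀ i a y, x i a * y = y * x i a) (i : Fin r) (a : Fin n) :
    x i a * σ i a a * (∑ b ∈ Finset.univ.erase a, x i b * σ i a b) -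
      (∑ b ∈ Finset.univ.erase a, x i b * σ i a b) * (x i a * σ i a a) =
      x i a * ∑ b ∈ Finset.univ.erase a, x i b * σ i a b := by
  rw [Finset.mul_sum, Finset.sum_mul, ← Finset.sum_sub_distrib, Finset.mul_sum]
  refine Finset.sum_congr rfl fun b hb => ?_
  have h1 := h.lie i a a a b
  rw [if_pos rfl, if_neg (Finset.ne_of_mem_erase hb), sub_zero] at h1
  calc _ = x i a * (x i b * (σ i a a * σ i a b - σ i a b * σ i a a)) := by
        rw [mul_sub, mul_sub]
        congr 1
        · rw [mul_assoc, ← mul_assoc (σ i a a), ← hx]; simp only [mul_assoc]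
        · rw [mul_assoc, ← mul_assoc (σ i a b), ← hx, ← mul_assoc, ← mul_assoc, ← mul_assoc,
            hx i a (x i b)]; simp only [mul_assoc]
    _ = _ := by rw [h1]

/-- The contraction is `x i a * σ i a a` plus the nilpotent off-diagonal part, and the annihilating
product of `σ i a a` multiplied by a power of `x i a` annihilates the diagonal part. -/
lemma IsGl.exists_prod_contract (h : IsGl σ) (hx : ∀ i a y, x i a * y = y * x i a) (i : Fin r)
    (a : Fin n) (hP : IsNilpotent (∑ b ∈ Finset.univ.erase a, x i b * σ i a b)) {l : List K}
    (hl : (l.map fun s => σ i a a - s • 1).prod = 0) :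
    ∃ l' : List K, (l'.map fun s => glContract x σ i a - s • x i a).prod = 0 := by
  rw [glContract, ← Finset.add_sum_erase _ _ (Finset.mem_univ a)]
  refine exists_prod_add_nilpotent (hx i a _) ?_ hP (l := l) ?_
  · rw [mul_add, ← hx i a (∑ b ∈ Finset.univ.erase a, x i b * σ i a b), ← h.sum_erase_lie hx,
      add_sub_cancel]
  · have h2 : ∀ s : K, x i a * σ i a a - s • x i a = x i a * (σ i a a - s • 1) := by
      intro s; rw [mul_sub, mul_smul_comm, mul_one]
    have h3 : ∀ l : List K, ∃ m : ℕ, (l.map fun s => x i a * σ i a a - s • x i a).prod =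
        x i a ^ m * (l.map fun s => σ i a a - s • 1).prod := by
      intro l
      induction l with
      | nil => exact ⟨0, by simp⟩
      | cons s l ih =>
        obtain ⟨m, hm⟩ := ih
        refine ⟨m + 1, ?_⟩
        have h4 : ∀ y : R, y * x i a ^ m = x i a ^ m * y := fun y =>
          (Commute.pow_right (hx i a y).symm m : _)
        rw [List.map_cons, List.prod_cons, hm, h2, List.map_cons, List.prod_cons, pow_succ', mul_assoc,
          ← mul_assoc _ (_ ^ m), h4]
        simp only [mul_assoc]
    obtain ⟨y, hy⟩ := h3 l
    rw [hy, hl, mul_zero]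

lemma IsGl.skew_contract (h : IsGl σ) (hx : ∀ i a y, x i a * y = y * x i a) (i : Fin r) (a b : Fin n) :
    (-glContract x σ i a) * (x i b * glContract x σ i a - x i a * glContract x σ i b) -
      (x i b * glContract x σ i a - x i a * glContract x σ i b) * (-glContract x σ i a) =
      x i a * (x i b * glContract x σ i a - x i a * glContract x σ i b) := by
  rw [← neg_neg (x i a * (_ - _)), ← h.contract_skew hx]
  noncomm_ring

end RingLemmas

section Model

variable {k : Type*} [Field k] (L : Type*) [Field L] [Algebra k L] {V : Type*} [AddCommGroup V]
  [Module k V]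

/-- The Euler operators of the model. -/
noncomputable def modelE (V : Type*) [AddCommGroup V] [Module k V] (i : Fin r) :
    Module.End L (Ring' L r n ⊗[k] V) :=
  TensorProduct.AlgebraTensorModule.map ((eul i : Derivation L (Ring' L r n) (Ring' L r n)) : Ring' L r n →ₗ[L] Ring' L r n)
    (LinearMap.id : V →ₗ[k] V)

/-- The extension of an operator on `V` to the model. -/
noncomputable def modelHom (r n : ℕ) (V : Type*) [AddCommGroup V] [Module k V] :
    Module.End k V →ₐ[k] Module.End (Ring' L r n) (Ring' L r n ⊗[k] V) :=
  Module.End.baseChangeHom k (Ring' L r n) V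

/-- The traces of the actions of `gl_n` in the model. -/
noncomputable def modelI (σ : Fin r → Fin n → Fin n → Module.End k V) (i : Fin r) :
    Module.End (Ring' L r n) (Ring' L r n ⊗[k] V) :=
  glTrace (fun i a b => modelHom L r n V (σ i a b)) i

/-- The contracted matrix units in the model. -/
noncomputable def modelA (σ : Fin r → Fin n → Fin n → Module.End k V) (i : Fin r) (a : Fin n) :
    Module.End (Ring' L r n) (Ring' L r n ⊗[k] V) :=
  glContract mulX (fun i a b => modelHom L r n V (σ i a b)) i a

lemma modelE_tmul (i : Fin r) (g : Ring' L r n) (v : V) :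
    modelE L V i (g ⊗ₜ[k] v) = eul i g ⊗ₜ v := rfl

lemma modelHom_tmul (f : Module.End k V) (g : Ring' L r n) (v : V) :
    modelHom L r n V f (g ⊗ₜ[k] v) = g ⊗ₜ f v := rfl

variable {L}

lemma mulX_comm {T : Type*} [AddCommGroup T] [Module (Ring' L r n) T] (i : Fin r) (a : Fin n)
    (f : Module.End (Ring' L r n) T) : mulX i a * f = f * mulX i a :=
  LinearMap.ext fun _ => (map_smul f _ _).symm

lemma isEuler_modelE : IsEuler n (modelE L V : Fin r → Module.End L (Ring' L r n ⊗[k] V)) := by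
  intro i f t
  induction t with
  | zero => simp
  | add t u ht hu => simp only [smul_add, map_add, ht, hu]; abel
  | tmul g v =>
    simp only [TensorProduct.smul_tmul', modelE_tmul, smul_eq_mul, Derivation.leibniz,
      TensorProduct.add_tmul]
    rw [add_comm, mul_comm g]

lemma modelE_modelHom (i : Fin r) (f : Module.End k V) (t : Ring' L r n ⊗[k] V) :
    modelE L V i (modelHom L r n V f t) = modelHom L r n V f (modelE L V i t) := by
  induction t with
  | zero => simp
  | add t u ht hu => simp only [map_add, ht, hu]
  | tmul g v => rfl

lemma eigenvaluesFrom_modelE :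
    EigenvaluesFrom (modelE L V : Fin r → Module.End L (Ring' L r n ⊗[k] V)) 0 := by
  rw [EigenvaluesFrom, eq_top_iff]
  rintro t -
  induction t with
  | zero => exact zero_mem _
  | add t u ht hu => exact add_mem ht hu
  | tmul g v =>
    rw [g.as_sum, TensorProduct.sum_tmul]
    refine Submodule.sum_mem _ fun m _ => Submodule.subset_span ⟨fun i => deg i m, fun i =>
      ⟨deg i m, by simp⟩, fun i => ?_⟩
    rw [modelE_tmul, eul_monomial, TensorProduct.smul_tmul']

/-- Operators on a finite-dimensional space have split annihilating polynomials over an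
algebraically closed field. -/
lemma exists_prod_modelHom_eq_zero [IsAlgClosed L] [FiniteDimensional k V] (f : Module.End k V) :
    ∃ l : List L, (l.map fun s => modelHom L r n V f - s • 1).prod = 0 := by
  set p := (minpoly k f).map (algebraMap k L) with hp
  have hm : p.Monic := (minpoly.monic (Algebra.IsIntegral.isIntegral f)).map _
  have h1 : Polynomial.aeval (modelHom L r n V f) p = 0 := by
    rw [hp, Polynomial.aeval_map_algebraMap, Polynomial.aeval_algHom_apply, minpoly.aeval, map_zero]
  refine ⟨p.roots.toList, ?_⟩
  rw [(IsAlgClosed.splits p).eq_prod_roots_of_monic hm, ← p.roots.coe_toList, Multiset.map_coe,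
    Multiset.prod_coe, map_list_prod, List.map_map] at h1
  rw [← h1]
  congr 2
  funext s
  simp [Algebra.algebraMap_eq_smul_one]

/-- The model is a finite free module over a domain of characteristic zero, so
`isNilpotent_of_commutator` yields the nilpotency statements. The splitting statements come from
minimal polynomials on `V`, which split over `L`. -/
theorem isFieldOps_model [IsAlgClosed L] [CharZero L] [FiniteDimensional k V]
    {σ : Fin r → Fin n → Fin n → Module.End k V} (hσ : IsGl σ) :
    IsFieldOps (modelE L V) (modelI L σ) (modelA L σ) := by
  have hG := hσ.map (R' := Module.End (Ring' L r n) (Ring' L r n ⊗[k] V)) 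
    (modelHom (k := k) L r n V).toRingHom
  have hx : ∀ i a (y : Module.End (Ring' L r n) (Ring' L r n ⊗[k] V)), mulX i a * y = y * mulX i a :=
    mulX_comm
  have hX : ∀ i a, (X (i, a) : Ring' L r n) ≠ 0 := fun i a => X_ne_zero _
  have hI : ∀ i t, modelI L σ i t = ∑ a, modelHom L r n V (σ i a a) t := fun i t => by
    rw [modelI, glTrace, LinearMap.sum_apply]
  have hA : ∀ i a t, modelA L σ i a t = ∑ b, (X (i, b) : Ring' L r n) • modelHom L r n V (σ i a b) t :=
    fun i a t => by rw [modelA, glContract, LinearMap.sum_apply]; rfl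
  refine ⟨isEuler_modelE, fun i j t => ?_, fun i j a t => ?_, hG.trace_trace, fun i j a =>
    hG.trace_contract hx i j a, fun i j a b hij => hG.contract_comm hx hij a b,
    hG.contract_lie hx, fun i a b => ?_, fun i a => ?_, fun i => ?_⟩
  · simp only [hI, map_sum, modelE_modelHom]
  · simp only [hA, map_sum, isEuler_modelE i, modelE_modelHom, eul_X, Finset.sum_add_distrib]
    rw [add_comm]
    congr 1
    by_cases hij : i = j
    · simp [hij]
    · simp [hij, Ne.symm hij]
  · exact isNilpotent_of_commutator (A := - modelA L σ i a) (hX i a) (hG.skew_contract hx i a b)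
  · obtain ⟨l, hl⟩ := exists_prod_modelHom_eq_zero (L := L) (r := r) (n := n) (σ i a a)
    exact hG.exists_prod_contract hx i a
      (isNilpotent_of_commutator (hX i a) (hG.sum_erase_lie hx i a)) hl
  · obtain ⟨l, hl⟩ := exists_prod_modelHom_eq_zero (L := L) (r := r) (n := n) (glTrace σ i)
    refine ⟨l, ?_⟩
    rw [← hl]
    simp only [modelI, glTrace, map_sum]

end Model

end MultiPoly

/-! ### Descent along a field extension -/

namespace StableNoetherian

/-- Noetherianity descends along field extensions. -/
lemma Noeth.descend {k K I T T' : Type*} [Field k] [Field K] [Algebra k K] [AddCommGroup T] [Module k T]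
    [AddCommGroup T'] [Module k T'] [Module K T'] [IsScalarTower k K T'] {ρ : I → Module.End k T}
    {ρ' : I → Module.End K T'} (h : Noeth ρ') (ι : T →ₗ[k] T') (hι : ∀ i t, ι (ρ i t) = ρ' i (ι t))
    (π : T' →ₗ[k] T) (θ : K →ₗ[k] k) (hθ : θ 1 = 1) (hπ : ∀ a t, π (a • ι t) = θ a • t) :
    Noeth ρ := by
  classical
  intro N hN _
  have hst : ∀ N : Submodule k T, Stable ρ N → Stable ρ' (Submodule.span K (ι '' N)) := by
    intro N hN i t ht
    refine (Submodule.span_le (p := (Submodule.span K (ι '' N)).comap (ρ' i))).2 ?_ ht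
    rintro _ ⟨s, hs, rfl⟩
    exact Submodule.subset_span ⟨ρ i s, hN i s hs, hι i s⟩
  obtain ⟨S', hS', h'⟩ := h _ (hst N hN) le_top
  -- Each generator over `K` is a finite combination of images of elements of `N`; these elements
  -- are the generators over `k`.
  have h1 : ∀ s : T', ∃ S : Finset T, s ∈ S' → (S : Set T) ⊆ N ∧ s ∈ Submodule.span K (ι '' S) := by
    intro s
    by_cases hs : s ∈ S'
    · obtain ⟨U, hU, hsU⟩ := Submodule.mem_span_finite_of_mem_span (hS' hs)
      obtain ⟨S, hS, rfl⟩ := Finset.subset_set_image_iff.1 hU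
      exact ⟨S, fun _ => ⟨hS, by simpa using hsU⟩⟩
    · exact ⟨∅, fun h => absurd h hs⟩
  choose f hf using h1
  refine ⟨S'.biUnion f, ?_, fun t ht => ?_⟩
  · intro t ht
    obtain ⟨s, hs, hst⟩ := Finset.mem_biUnion.1 (Finset.mem_coe.1 ht)
    exact (hf s hs).1 hst
  · rw [bot_sup_eq] at h' ⊢
    set G := gen ρ ((S'.biUnion f : Finset T) : Set T)
    have h2 : ι t ∈ Submodule.span K (ι '' G) := by
      refine gen_le (hst G (stable_gen _)) (fun s hs => ?_) (h' (Submodule.subset_span ⟨t, ht, rfl⟩))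
      refine Submodule.span_mono (Set.image_mono ?_) (hf s hs).2
      exact fun u hu => subset_gen _ (Finset.mem_coe.2 (Finset.mem_biUnion.2 ⟨s, hs, hu⟩))
    -- The retraction `π` returns the `K`-span of `G` to `G`. The scalar `a` is carried along
    -- because `π` is only `k`-linear.
    have h3 : ∀ s ∈ Submodule.span K (ι '' G), ∀ a : K, π (a • s) ∈ G := by
      intro s hs
      induction hs using Submodule.span_induction with
      | mem s hs =>
        obtain ⟨t, ht, rfl⟩ := hs
        intro a
        rw [hπ]
        exact G.smul_mem _ ht
      | zero => simp
      | add s u _ _ hs hu =>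
        intro a
        rw [smul_add, map_add]
        exact G.add_mem (hs a) (hu a)
      | smul b s _ hs =>
        intro a
        rw [smul_smul]
        exact hs _
    have := h3 _ h2 1
    rwa [hπ, hθ, one_smul] at this

end StableNoetherian

/-! ### The model over the base field -/

namespace MultiPoly

open MvPolynomial StableNoetherian

variable {k : Type*} [Field k] {r n : ℕ} {V : Type*} [AddCommGroup V] [Module k V]

/-- The action of `x ^ β` times the Euler field on the model. -/
noncomputable def modelAct (L : Type*) [Field L] [Algebra k L]
    (σ : Fin r → Fin n → Fin n → Module.End k V) (β : Fin n →₀ ℕ) :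
    Module.End L (Ring' L r n ⊗[k] V) :=
  fullAct (modelE L V) (modelI L σ) (modelA L σ) β

lemma modelAct_tmul (L : Type*) [Field L] [Algebra k L]
    (σ : Fin r → Fin n → Fin n → Module.End k V) (β : Fin n →₀ ℕ) (g : Ring' L r n) (v : V) :
    modelAct L σ β (g ⊗ₜ[k] v) = ∑ i, ((slot i β * eul i g) ⊗ₜ v +
      ∑ a, (slot i β * g) ⊗ₜ σ i a a v +
        ∑ a, ∑ b, (dslot i a β * X (i, b) * g) ⊗ₜ σ i a b v) := by
  rw [modelAct, fullAct_apply]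
  refine Finset.sum_congr rfl fun i _ => ?_
  rw [modelE_tmul, smul_add, modelI, glTrace, LinearMap.sum_apply, Finset.smul_sum]
  congr 1
  refine Finset.sum_congr rfl fun a _ => ?_
  rw [modelA, glContract, LinearMap.sum_apply, Finset.smul_sum]
  refine Finset.sum_congr rfl fun b _ => ?_
  rw [Module.End.mul_apply, modelHom_tmul, mulX_apply, TensorProduct.smul_tmul',
    TensorProduct.smul_tmul', smul_eq_mul, smul_eq_mul, mul_assoc]

section BaseChange

variable {L : Type*} [Field L] [Algebra k L]

lemma map_slot (i : Fin r) (β : Fin n →₀ ℕ) :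
    map (algebraMap k L) (slot i β : Ring' k r n) = slot i β := by
  rw [slot, map_rename, map_monomial, map_one, slot]

lemma map_dslot (i : Fin r) (a : Fin n) (β : Fin n →₀ ℕ) :
    map (algebraMap k L) (dslot i a β : Ring' k r n) = dslot i a β := by
  rw [dslot, map_rename, ← pderiv_map, map_monomial, map_one, dslot]

lemma map_eul (i : Fin r) (g : Ring' k r n) :
    map (algebraMap k L) (eul i g) = eul i (map (algebraMap k L) g) := by
  induction g using MvPolynomial.monomial_add_induction_on with
  | C a => simp
  | monomial_add m a f _ _ hf =>
    rw [map_add, map_add, map_add, map_add, hf, eul_monomial, map_monomial, eul_monomial,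
      smul_monomial, smul_monomial, map_monomial, smul_eq_mul, smul_eq_mul, map_mul, map_natCast]

/-- The inclusion of the model over `k` in the model over an extension field. -/
noncomputable def modelIncl (L : Type*) [Field L] [Algebra k L] (r n : ℕ) (V : Type*) [AddCommGroup V]
    [Module k V] : Ring' k r n ⊗[k] V →ₗ[k] Ring' L r n ⊗[k] V :=
  LinearMap.rTensor V (mapAlgHom (Algebra.ofId k L)).toLinearMap

lemma modelIncl_tmul (g : Ring' k r n) (v : V) :
    modelIncl L r n V (g ⊗ₜ v) = map (algebraMap k L) g ⊗ₜ v := rfl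

lemma modelIncl_modelAct (σ : Fin r → Fin n → Fin n → Module.End k V) (β : Fin n →₀ ℕ)
    (t : Ring' k r n ⊗[k] V) :
    modelIncl L r n V (modelAct k σ β t) = modelAct L σ β (modelIncl L r n V t) := by
  induction t with
  | zero => simp
  | add t u ht hu => simp only [map_add, ht, hu]
  | tmul g v =>
    simp only [modelAct_tmul, modelIncl_tmul, map_sum, map_add, map_mul, map_slot, map_dslot, map_eul,
      map_X]

/-- The application of a linear map to the coefficients of a polynomial. -/
noncomputable def mapCoeff (θ : L →ₗ[k] k) : Ring' L r n →ₗ[k] Ring' k r n :=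
  (AddMonoidAlgebra.coeffLinearEquiv k).symm.toLinearMap ∘ₗ Finsupp.mapRange.linearMap θ ∘ₗ
    (AddMonoidAlgebra.coeffLinearEquiv k).toLinearMap

lemma coeff_mapCoeff (θ : L →ₗ[k] k) (g : Ring' L r n) (m : Fin r × Fin n →₀ ℕ) :
    coeff m (mapCoeff θ g) = θ (coeff m g) := rfl

lemma mapCoeff_smul_map (θ : L →ₗ[k] k) (a : L) (g : Ring' k r n) :
    mapCoeff θ (a • map (algebraMap k L) g) = θ a • g := by
  ext m
  rw [coeff_mapCoeff, coeff_smul, coeff_map, coeff_smul, smul_eq_mul, mul_comm, ← Algebra.smul_def,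
    map_smul, smul_eq_mul, smul_eq_mul, mul_comm]

end BaseChange

/-- Modules of tensor fields on products are noetherian. -/
theorem noeth_modelAct [CharZero k] [FiniteDimensional k V] {σ : Fin r → Fin n → Fin n → Module.End k V}
    (hσ : IsGl σ) {e : ℕ} (he : 1 ≤ e) :
    Noeth fun β : {β : Fin n →₀ ℕ // e ≤ β.degree} => modelAct k σ β.1 := by
  let L := AlgebraicClosure k
  have : CharZero L := charZero_of_injective_algebraMap (algebraMap k L).injective
  have h1 := (isFieldOps_model (L := L) hσ).noeth_fullAct he eigenvaluesFrom_modelE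
  -- A `k`-linear retraction of `L` onto `k`, applied to coefficients, retracts the model over `L`
  -- onto the model over `k`.
  obtain ⟨θ, hθ⟩ := (Algebra.linearMap k L).exists_leftInverse_of_injective
    (LinearMap.ker_eq_bot.2 (algebraMap k L).injective)
  refine h1.descend (modelIncl L r n V) (fun β t => modelIncl_modelAct σ β.1 t)
    (LinearMap.rTensor V (mapCoeff θ)) θ ?_ ?_
  · simpa using LinearMap.congr_fun hθ 1
  · intro a t
    induction t with
    | zero => simp
    | add t u ht hu => simp only [map_add, smul_add, ht, hu]
    | tmul g v =>
      rw [modelIncl_tmul, TensorProduct.smul_tmul', LinearMap.rTensor_tmul, mapCoeff_smul_map,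
        TensorProduct.smul_tmul']

end MultiPoly

/-! ### Tensor products with tensor fields as quotients of the model -/

namespace MultiPoly

open MvPolynomial StableNoetherian PolyVectorField

section TensorQuotient

universe u

variable {k : Type u} [Field k] {n : ℕ}

variable (k n) in
/-- The Euler vector field. -/
noncomputable def eulerDer : W k n := mkDerivation k X

/-- The vector field `x ^ β` times the Euler field. -/
noncomputable def eulerField (β : Fin n →₀ ℕ) : W k n := (monomial β (1 : k)) • eulerDer k n

lemma eulerField_apply (β : Fin n →₀ ℕ) (f : MvPolynomial (Fin n) k) :
    eulerField β f = monomial β 1 * eulerDer k n f := rfl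

lemma eulerField_X (β : Fin n →₀ ℕ) (i : Fin n) :
    (eulerField β : W k n) (X i) = monomial β 1 * X i := by
  rw [eulerField_apply, eulerDer, mkDerivation_X]

lemma pderiv_eulerField_X (β : Fin n →₀ ℕ) (i j : Fin n) :
    pderiv i ((eulerField β : W k n) (X j)) =
      pderiv i (monomial β 1) * X j + if i = j then monomial β 1 else 0 := by
  rw [eulerField_X, Derivation.leibniz, pderiv_X, Pi.single_apply, smul_eq_mul, smul_eq_mul, add_comm,
    mul_comm (X j)]
  by_cases h : i = j
  · simp [h]
  · simp [h, Ne.symm h]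

section FieldAct

variable {F : Type*} [AddCommGroup F] [Module k F]

/-- The action of `x ^ β` times the Euler field on tensor fields. -/
noncomputable def fieldAct (σ : Fin n → Fin n → Module.End k F) (β : Fin n →₀ ℕ) :
    Module.End k (MvPolynomial (Fin n) k ⊗[k] F) :=
  LinearMap.rTensor F ((eulerField β : W k n) : MvPolynomial (Fin n) k →ₗ[k] MvPolynomial (Fin n) k) +
    ∑ a, ∑ b, TensorProduct.map (LinearMap.mulLeft k (pderiv a ((eulerField β : W k n) (X b)))) (σ a b)

lemma fieldAct_tmul (σ : Fin n → Fin n → Module.End k F) (β : Fin n →₀ ℕ)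
    (f : MvPolynomial (Fin n) k) (w : F) :
    fieldAct σ β (f ⊗ₜ w) = (monomial β 1 * eulerDer k n f) ⊗ₜ w +
      ∑ a, (monomial β 1 * f) ⊗ₜ σ a a w +
        ∑ a, ∑ b, (pderiv a (monomial β 1) * X b * f) ⊗ₜ σ a b w := by
  simp only [fieldAct, LinearMap.add_apply, LinearMap.rTensor_tmul, LinearMap.sum_apply,
    TensorProduct.map_tmul, LinearMap.mulLeft_apply, pderiv_eulerField_X, add_mul,
    TensorProduct.add_tmul, Finset.sum_add_distrib, ite_mul, zero_mul]
  rw [add_assoc, add_comm (∑ a, ∑ b, _) (∑ a, ∑ b, _)]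
  congr 2
  refine Finset.sum_congr rfl fun a _ => ?_
  rw [Finset.sum_eq_single a]
  · rw [if_pos rfl]
  · intro b _ hb; rw [if_neg (Ne.symm hb), TensorProduct.zero_tmul]
  · simp

end FieldAct

/-- The action on a tensor product. -/
noncomputable def tensorOp {A B : Type*} [AddCommGroup A] [Module k A] [AddCommGroup B] [Module k B]
    (f : Module.End k A) (g : Module.End k B) : Module.End k (A ⊗[k] B) := f.rTensor B + g.lTensor A

lemma tensorOp_tmul {A B : Type*} [AddCommGroup A] [Module k A] [AddCommGroup B] [Module k B]
    (f : Module.End k A) (g : Module.End k B) (a : A) (b : B) :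
    tensorOp f g (a ⊗ₜ b) = f a ⊗ₜ b + a ⊗ₜ g b := rfl

/-- Intertwining maps on the factors of a tensor product intertwine. -/
lemma map_tensorOp {A B A' B' : Type*} [AddCommGroup A] [Module k A] [AddCommGroup B] [Module k B]
    [AddCommGroup A'] [Module k A'] [AddCommGroup B'] [Module k B'] {f : Module.End k A}
    {g : Module.End k B} {f' : Module.End k A'} {g' : Module.End k B'} {φ : A →ₗ[k] A'}
    {ψ : B →ₗ[k] B'} (hφ : ∀ a, φ (f a) = f' (φ a)) (hψ : ∀ b, ψ (g b) = g' (ψ b)) (t : A ⊗[k] B) :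
    TensorProduct.map φ ψ (tensorOp f g t) = tensorOp f' g' (TensorProduct.map φ ψ t) := by
  induction t with
  | zero => simp
  | add t s ht hs => simp only [map_add, ht, hs]
  | tmul a b => simp only [tensorOp_tmul, map_add, TensorProduct.map_tmul, hφ, hψ]

/-- The families of operators that come from a module of tensor fields on a product. -/
def IsTensorQuotient {Z : Type*} [AddCommGroup Z] [Module k Z]
    (ρ : (Fin n →₀ ℕ) → Module.End k Z) : Prop :=
  ∃ (r : ℕ) (V : Type u) (_ : AddCommGroup V) (_ : Module k V) (_ : FiniteDimensional k V)
    (σ : Fin r → Fin n → Fin n → Module.End k V) (_ : IsGl σ) (φ : Ring' k r n ⊗[k] V →ₗ[k] Z),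
    Function.Surjective φ ∧ ∀ β t, φ (modelAct k σ β t) = ρ β (φ t)

lemma IsTensorQuotient.noeth [CharZero k] {Z : Type*} [AddCommGroup Z] [Module k Z]
    {ρ : (Fin n →₀ ℕ) → Module.End k Z} (h : IsTensorQuotient ρ) {e : ℕ} (he : 1 ≤ e) :
    Noeth fun β : {β : Fin n →₀ ℕ // e ≤ β.degree} => ρ β.1 := by
  obtain ⟨r, V, _, _, _, σ, hσ, φ, hφ, h⟩ := h
  exact (noeth_modelAct hσ he).of_surjective φ (fun β t => h β.1 t) hφ

lemma IsTensorQuotient.of_surjective {Z Z' : Type*} [AddCommGroup Z] [Module k Z] [AddCommGroup Z']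
    [Module k Z'] {ρ : (Fin n →₀ ℕ) → Module.End k Z} {ρ' : (Fin n →₀ ℕ) → Module.End k Z'}
    (h : IsTensorQuotient ρ) (ψ : Z →ₗ[k] Z') (hψ : Function.Surjective ψ)
    (hρ : ∀ β t, ψ (ρ β t) = ρ' β (ψ t)) : IsTensorQuotient ρ' := by
  obtain ⟨r, V, _, _, _, σ, hσ, φ, hφ, h⟩ := h
  exact ⟨r, V, _, _, inferInstance, σ, hσ, ψ ∘ₗ φ, hψ.comp hφ, fun β t => by
    rw [LinearMap.comp_apply, h, hρ, LinearMap.comp_apply]⟩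

section Split

variable {r : ℕ}

/-- The inclusion of polynomials as functions of the first group of variables. -/
noncomputable def headIncl (k : Type u) [Field k] (r n : ℕ) :
    MvPolynomial (Fin n) k →ₐ[k] Ring' k (r + 1) n := rename (Prod.mk 0)

/-- The inclusion of polynomials as functions of the last groups of variables. -/
noncomputable def tailIncl (k : Type u) [Field k] (r n : ℕ) :
    Ring' k r n →ₐ[k] Ring' k (r + 1) n := rename (Prod.map Fin.succ id)

lemma split_induction {P : Ring' k (r + 1) n → Prop} (hadd : ∀ p q, P p → P q → P (p + q))
    (hmul : ∀ f g, P (headIncl k r n f * tailIncl k r n g)) (p : Ring' k (r + 1) n) : P p := by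
  have h : p ∈ Submodule.span ℕ (Set.range fun x : MvPolynomial (Fin n) k × Ring' k r n =>
      headIncl k r n x.1 * tailIncl k r n x.2) := by
    induction p using MvPolynomial.induction_on with
    | C a => exact Submodule.subset_span ⟨(C a, 1), by simp [headIncl]⟩
    | add p q hp hq => exact add_mem hp hq
    | mul_X p i hp =>
      induction hp using Submodule.span_induction with
      | mem p hp =>
        obtain ⟨⟨f, g⟩, rfl⟩ := hp
        obtain ⟨i, a⟩ := i
        induction i using Fin.cases with
        | zero =>
          refine Submodule.subset_span ⟨(f * X a, g), ?_⟩
          simp only [headIncl, map_mul, rename_X]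
          ring
        | succ i =>
          refine Submodule.subset_span ⟨(f, g * X (i, a)), ?_⟩
          simp only [tailIncl, map_mul, rename_X, Prod.map_apply, id]
          ring
      | zero => rw [zero_mul]; exact zero_mem _
      | add p q _ _ hp hq => rw [add_mul]; exact add_mem hp hq
      | smul m p _ hp => rw [smul_mul_assoc]; exact Submodule.smul_mem _ _ hp
  induction h using Submodule.span_induction with
  | mem p hp => obtain ⟨⟨f, g⟩, rfl⟩ := hp; exact hmul f g
  | zero => simpa using hmul 0 0
  | add p q _ _ hp hq => exact hadd p q hp hq
  | smul m p _ hp =>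
    induction m with
    | zero => simpa using hmul 0 0
    | succ m ih => rw [add_smul, one_smul]; exact hadd _ _ ih hp

lemma eul_zero_head (f : MvPolynomial (Fin n) k) :
    eul 0 (headIncl k r n f) = headIncl k r n (eulerDer k n f) := by
  induction f using MvPolynomial.induction_on with
  | C a => simp [headIncl, show (C a : MvPolynomial (Fin n) k) = algebraMap k _ a from rfl]
  | add p q hp hq => simp only [map_add, hp, hq]
  | mul_X p i hp =>
    rw [map_mul, Derivation.leibniz, hp, Derivation.leibniz, map_add]
    simp only [smul_eq_mul, map_mul, eulerDer, mkDerivation_X]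
    congr 2
    simp [headIncl, eul_X]

lemma eul_succ_head (i : Fin r) (f : MvPolynomial (Fin n) k) : eul i.succ (headIncl k r n f) = 0 := by
  induction f using MvPolynomial.induction_on with
  | C a => simp [headIncl]
  | add p q hp hq => simp only [map_add, hp, hq, add_zero]
  | mul_X p i hp =>
    rw [map_mul, Derivation.leibniz, hp]
    simp [headIncl, eul_X, (Fin.succ_ne_zero _).symm]

lemma eul_zero_tail (g : Ring' k r n) : eul 0 (tailIncl k r n g) = 0 := by
  induction g using MvPolynomial.induction_on with
  | C a => simp [tailIncl]
  | add p q hp hq => simp only [map_add, hp, hq, add_zero]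
  | mul_X p i hp =>
    rw [map_mul, Derivation.leibniz, hp]
    obtain ⟨j, b⟩ := i
    simp [tailIncl, eul_X]

lemma eul_succ_tail (i : Fin r) (g : Ring' k r n) :
    eul i.succ (tailIncl k r n g) = tailIncl k r n (eul i g) := by
  induction g using MvPolynomial.induction_on with
  | C a => simp [tailIncl]
  | add p q hp hq => simp only [map_add, hp, hq]
  | mul_X p j hp =>
    rw [map_mul, Derivation.leibniz, hp, Derivation.leibniz, map_add]
    simp only [smul_eq_mul, map_mul]
    congr 2
    obtain ⟨j, b⟩ := j
    simp only [tailIncl, rename_X, eul_X, Prod.map_apply, id, Fin.succ_inj]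
    split_ifs
    · rw [rename_X]; rfl
    · rw [map_zero]

/-- The decomposition of the coordinate ring as a tensor product. -/
noncomputable def splitHom (k : Type u) [Field k] (r n : ℕ) :
    Ring' k (r + 1) n →ₐ[k] MvPolynomial (Fin n) k ⊗[k] Ring' k r n :=
  aeval fun p => Fin.cases (X p.2 ⊗ₜ 1) (fun i => 1 ⊗ₜ X (i, p.2)) p.1

lemma splitHom_mul (f : MvPolynomial (Fin n) k) (g : Ring' k r n) :
    splitHom k r n (headIncl k r n f * tailIncl k r n g) = f ⊗ₜ g := by
  have h1 : (splitHom k r n).comp (headIncl k r n) = Algebra.TensorProduct.includeLeft := by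
    ext a
    simp [splitHom, headIncl]
  have h2 : (splitHom k r n).comp (tailIncl k r n) = Algebra.TensorProduct.includeRight := by
    ext a
    simp [splitHom, tailIncl]
  rw [map_mul]
  have h3 := AlgHom.congr_fun h1 f
  have h4 := AlgHom.congr_fun h2 g
  simp only [AlgHom.comp_apply] at h3 h4
  rw [h3, h4]
  simp

variable {F V : Type u} [AddCommGroup F] [Module k F] [AddCommGroup V] [Module k V]

/-- The decomposition of a module of tensor fields on a product. -/
noncomputable def splitMap (k : Type u) [Field k] (r n : ℕ) (F V : Type u) [AddCommGroup F]
    [Module k F] [AddCommGroup V] [Module k V] : Ring' k (r + 1) n ⊗[k] (F ⊗[k] V) →ₗ[k]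
      (MvPolynomial (Fin n) k ⊗[k] F) ⊗[k] (Ring' k r n ⊗[k] V) :=
  (TensorProduct.tensorTensorTensorComm k (MvPolynomial (Fin n) k) (Ring' k r n) F V).toLinearMap ∘ₗ
    LinearMap.rTensor _ (splitHom k r n).toLinearMap

lemma splitMap_tmul (f : MvPolynomial (Fin n) k) (g : Ring' k r n) (w : F) (v : V) :
    splitMap k r n F V ((headIncl k r n f * tailIncl k r n g) ⊗ₜ (w ⊗ₜ v)) =
      (f ⊗ₜ w) ⊗ₜ (g ⊗ₜ v) := by
  rw [splitMap, LinearMap.comp_apply, LinearMap.rTensor_tmul, AlgHom.toLinearMap_apply, splitHom_mul]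
  rfl

lemma splitMap_surjective : Function.Surjective (splitMap k r n F V) := by
  refine (TensorProduct.tensorTensorTensorComm k (MvPolynomial (Fin n) k) (Ring' k r n) F
    V).surjective.comp (LinearMap.rTensor_surjective _ (g := (splitHom k r n).toLinearMap) fun t => ?_)
  induction t with
  | zero => exact ⟨0, map_zero _⟩
  | add t s ht hs =>
    obtain ⟨a, rfl⟩ := ht
    obtain ⟨b, rfl⟩ := hs
    exact ⟨a + b, map_add _ _ _⟩
  | tmul f g => exact ⟨_, splitHom_mul f g⟩

/-- The action of the matrix units on the tensor product of two representations. -/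
noncomputable def consGl (τ : Fin n → Fin n → Module.End k F)
    (σ : Fin r → Fin n → Fin n → Module.End k V) :
    Fin (r + 1) → Fin n → Fin n → Module.End k (F ⊗[k] V) :=
  Fin.cons (fun a b => (τ a b).rTensor V) fun i a b => (σ i a b).lTensor F

lemma isGl_consGl {τ : Fin n → Fin n → Module.End k F} (hτ : IsGl fun _ : Fin 1 => τ)
    {σ : Fin r → Fin n → Fin n → Module.End k V} (hσ : IsGl σ) : IsGl (consGl τ σ) := by
  have h1 := hτ.map (R' := Module.End k (F ⊗[k] V)) (Module.End.rTensorAlgHom k F V).toRingHom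
  have h2 := hσ.map (R' := Module.End k (F ⊗[k] V)) (Module.End.lTensorAlgHom k V F).toRingHom
  have h3 : ∀ (f : Module.End k F) (g : Module.End k V),
      (f.rTensor V : Module.End k (F ⊗[k] V)) * g.lTensor F = g.lTensor F * f.rTensor V := by
    intro f g
    rw [Module.End.mul_eq_comp, Module.End.mul_eq_comp, LinearMap.rTensor_comp_lTensor,
      LinearMap.lTensor_comp_rTensor]
  constructor
  · intro i
    induction i using Fin.cases with
    | zero => exact h1.lie 0
    | succ i => exact h2.lie i
  · intro i j hij a b c d
    induction i using Fin.cases with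
    | zero =>
      induction j using Fin.cases with
      | zero => exact absurd rfl hij
      | succ j => exact h3 _ _
    | succ i =>
      induction j using Fin.cases with
      | zero => exact (h3 _ _).symm
      | succ j => exact h2.comm i j (fun h => hij (h ▸ rfl)) a b c d

lemma slot_zero_eq (β : Fin n →₀ ℕ) :
    (slot 0 β : Ring' k (r + 1) n) = headIncl k r n (monomial β 1) := rfl

lemma dslot_zero_eq (a : Fin n) (β : Fin n →₀ ℕ) :
    (dslot 0 a β : Ring' k (r + 1) n) = headIncl k r n (pderiv a (monomial β 1)) := rfl

lemma slot_succ_eq (i : Fin r) (β : Fin n →₀ ℕ) :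
    (slot i.succ β : Ring' k (r + 1) n) = tailIncl k r n (slot i β) := by
  rw [slot, slot, tailIncl, rename_rename]; rfl

lemma dslot_succ_eq (i : Fin r) (a : Fin n) (β : Fin n →₀ ℕ) :
    (dslot i.succ a β : Ring' k (r + 1) n) = tailIncl k r n (dslot i a β) := by
  rw [dslot, dslot, tailIncl, rename_rename]; rfl

lemma X_zero_eq (a : Fin n) : (X (0, a) : Ring' k (r + 1) n) = headIncl k r n (X a) := by
  rw [headIncl, rename_X]

lemma X_succ_eq (i : Fin r) (a : Fin n) :
    (X (i.succ, a) : Ring' k (r + 1) n) = tailIncl k r n (X (i, a)) := by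
  rw [tailIncl, rename_X]; rfl

/-- Separating the first point from the others splits the sum over points into the two summands of
the action on a tensor product. Products of a polynomial in the first point and one in the others
span, so it suffices to check these. -/
lemma splitMap_modelAct (τ : Fin n → Fin n → Module.End k F)
    (σ : Fin r → Fin n → Fin n → Module.End k V) (β : Fin n →₀ ℕ)
    (t : Ring' k (r + 1) n ⊗[k] (F ⊗[k] V)) :
    splitMap k r n F V (modelAct k (consGl τ σ) β t) =
      tensorOp (fieldAct τ β) (modelAct k σ β) (splitMap k r n F V t) := by
  induction t with
  | zero => simp
  | add t s ht hs => simp only [map_add, ht, hs]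
  | tmul p u =>
    induction u with
    | zero => simp
    | add t s ht hs => simp only [TensorProduct.tmul_add, map_add, ht, hs]
    | tmul w v =>
      induction p using split_induction with
      | hadd p q hp hq => simp only [TensorProduct.add_tmul, map_add, hp, hq]
      | hmul f g =>
        have e1 : ∀ p, p * (headIncl k r n f * tailIncl k r n g) =
            (p * headIncl k r n f) * tailIncl k r n g := fun p => (mul_assoc _ _ _).symm
        have e2 : ∀ p, tailIncl k r n p * (headIncl k r n f * tailIncl k r n g) =
            headIncl k r n f * tailIncl k r n (p * g) := fun p => by rw [map_mul]; ring
        have e3 : ∀ p, headIncl k r n p * (headIncl k r n f * tailIncl k r n g) =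
            headIncl k r n (p * f) * tailIncl k r n g := fun p => by rw [map_mul]; ring
        have c0 : ∀ a b, consGl τ σ 0 a b (w ⊗ₜ v) = τ a b w ⊗ₜ v := fun a b => rfl
        have c1 : ∀ i a b, consGl τ σ (Fin.succ i) a b (w ⊗ₜ v) = w ⊗ₜ σ i a b v := fun i a b => rfl
        have d0 : eul 0 (headIncl k r n f * tailIncl k r n g) =
            headIncl k r n (eulerDer k n f) * tailIncl k r n g := by
          rw [Derivation.leibniz, eul_zero_tail, eul_zero_head, smul_zero, zero_add, smul_eq_mul,
            mul_comm]
        have d1 : ∀ i : Fin r, eul i.succ (headIncl k r n f * tailIncl k r n g) =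
            headIncl k r n f * tailIncl k r n (eul i g) := fun i => by
          rw [Derivation.leibniz, eul_succ_tail, eul_succ_head, smul_zero, add_zero, smul_eq_mul]
        have e4 : ∀ p q, tailIncl k r n p * (headIncl k r n f * tailIncl k r n q) =
            headIncl k r n f * tailIncl k r n (p * q) := fun p q => by rw [map_mul]; ring
        have e5 : ∀ p q, headIncl k r n p * (headIncl k r n q * tailIncl k r n g) =
            headIncl k r n (p * q) * tailIncl k r n g := fun p q => by rw [map_mul]; ring
        rw [splitMap_tmul, tensorOp_tmul, modelAct_tmul, Fin.sum_univ_succ, map_add]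
        congr 1
        · rw [fieldAct_tmul]
          simp only [map_add, map_sum, slot_zero_eq, dslot_zero_eq, X_zero_eq, c0, d0, e5, ← map_mul,
            splitMap_tmul, TensorProduct.add_tmul, TensorProduct.sum_tmul]
        · rw [modelAct_tmul]
          simp only [map_add, map_sum, slot_succ_eq, dslot_succ_eq, X_succ_eq, c1, d1, e4, ← map_mul,
            splitMap_tmul, TensorProduct.tmul_add, TensorProduct.tmul_sum]

end Split

/-- The class of quotients of tensor fields on products is closed under tensor products with tensor
fields. -/
lemma IsTensorQuotient.tensor {F : Type u} [AddCommGroup F] [Module k F] [FiniteDimensional k F]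
    {τ : Fin n → Fin n → Module.End k F} (hτ : IsGl fun _ : Fin 1 => τ) {Z : Type*} [AddCommGroup Z]
    [Module k Z] {ρ : (Fin n →₀ ℕ) → Module.End k Z} (h : IsTensorQuotient ρ) :
    IsTensorQuotient fun β => tensorOp (fieldAct τ β) (ρ β) := by
  obtain ⟨r, V, _, _, _, σ, hσ, φ, hφ, h⟩ := h
  refine ⟨r + 1, F ⊗[k] V, _, _, inferInstance, consGl τ σ, isGl_consGl hτ hσ,
    (TensorProduct.map LinearMap.id φ : (MvPolynomial (Fin n) k ⊗[k] F) ⊗[k] _ →ₗ[k] _) ∘ₗ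
      splitMap k r n F V,
    (TensorProduct.map_surjective Function.surjective_id hφ).comp splitMap_surjective, fun β t => ?_⟩
  rw [LinearMap.comp_apply, splitMap_modelAct, LinearMap.comp_apply]
  exact map_tensorOp (k := k) (f := fieldAct τ β) (f' := fieldAct τ β) (φ := LinearMap.id) (fun _ => rfl)
    (h β) _

/-- The trivial module. -/
lemma isTensorQuotient_zero {Z : Type*} [AddCommGroup Z] [Module k Z] (φ : k →ₗ[k] Z)
    (hφ : Function.Surjective φ) : IsTensorQuotient fun _ : Fin n →₀ ℕ => (0 : Module.End k Z) := by
  refine ⟨0, k, _, _, inferInstance, fun i => i.elim0, ⟨fun i => i.elim0, fun i => i.elim0⟩,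
    φ ∘ₗ (TensorProduct.rid k k).toLinearMap ∘ₗ
      LinearMap.rTensor k (isEmptyAlgEquiv k (Fin 0 × Fin n)).toLinearMap, ?_, fun β t => ?_⟩
  · have h1 : Function.Surjective (isEmptyAlgEquiv k (Fin 0 × Fin n)).toLinearMap :=
      (isEmptyAlgEquiv k (Fin 0 × Fin n)).surjective
    exact hφ.comp ((TensorProduct.rid k k).surjective.comp (LinearMap.rTensor_surjective k h1))
  · rw [modelAct, fullAct_apply]
    simp

end TensorQuotient

end MultiPoly

/-! ### Iterated tensor products, vector fields, finite sums and subquotients -/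

namespace MultiPoly

open MvPolynomial StableNoetherian PolyVectorField

section ConsTensor

variable {k : Type*} [Field k] {s : ℕ} {T : Fin (s + 1) → Type*} [∀ i, AddCommGroup (T i)]
  [∀ i, Module k (T i)]

variable (k T) in
/-- The multiplication of a tensor product by a first factor. -/
noncomputable def consTensor : T 0 ⊗[k] (⨂[k] i : Fin s, T i.succ) →ₗ[k] ⨂[k] i, T i :=
  TensorProduct.lift ((PiTensorProduct.lift (R := k) (s := fun i : Fin s => T i.succ)
    (E := ⨂[k] i, T i)).toLinearMap ∘ₗ (PiTensorProduct.tprod k (s := T)).curryLeft)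

lemma consTensor_tmul (a : T 0) (v : ∀ i : Fin s, T i.succ) :
    consTensor k T (a ⊗ₜ PiTensorProduct.tprod k v) =
      PiTensorProduct.tprod k (Fin.cons a v : ∀ i, T i) := by
  rw [consTensor, TensorProduct.lift.tmul]
  exact PiTensorProduct.lift.tprod v

lemma consTensor_surjective : Function.Surjective (consTensor k T) := by
  rw [← LinearMap.range_eq_top, eq_top_iff, ← PiTensorProduct.span_tprod_eq_top, Submodule.span_le]
  rintro _ ⟨v, rfl⟩
  exact ⟨v 0 ⊗ₜ PiTensorProduct.tprod k (Fin.tail v), by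
    rw [consTensor_tmul]; exact congrArg _ (Fin.cons_self_tail v)⟩

variable {L : Type*} [LieRing L] [LieAlgebra k L]

lemma tensorRep_tprod {ι : Type*} [DecidableEq ι] [Fintype ι] {T : ι → Type*} [∀ i, AddCommGroup (T i)]
    [∀ i, Module k (T i)] (τ : ∀ i, L →ₗ⁅k⁆ Module.End k (T i)) (x : L) (v : ∀ i, T i) :
    tensorRep τ x (PiTensorProduct.tprod k v) =
      ∑ i, PiTensorProduct.tprod k (Function.update v i (τ i x (v i))) := by
  change (∑ i, actAt i (τ i x)) _ = _
  rw [LinearMap.sum_apply]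
  refine Finset.sum_congr rfl fun i _ => ?_
  rw [actAt, PiTensorProduct.map_tprod]
  congr 1
  ext j
  by_cases h : j = i
  · subst h; simp
  · simp [h]

lemma consTensor_tensorRep (τ : ∀ i, L →ₗ⁅k⁆ Module.End k (T i)) (x : L)
    (t : T 0 ⊗[k] (⨂[k] i : Fin s, T i.succ)) :
    consTensor k T (tensorOp (τ 0 x) (tensorRep (fun i => τ i.succ) x) t) =
      tensorRep τ x (consTensor k T t) := by
  induction t with
  | zero => simp
  | add t u ht hu => simp only [map_add, ht, hu]
  | tmul a b =>
    induction b using PiTensorProduct.induction_on with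
    | smul_tprod c v =>
      simp only [TensorProduct.tmul_smul, map_smul]
      congr 1
      rw [tensorOp_tmul, tensorRep_tprod, map_add, TensorProduct.tmul_sum, map_sum]
      simp only [consTensor_tmul]
      rw [tensorRep_tprod, Fin.sum_univ_succ]
      simp only [Fin.cons_zero, Fin.cons_succ, Fin.update_cons_zero, ← Fin.cons_update]
    | add b c hb hc => simp only [TensorProduct.tmul_add, map_add, hb, hc]

end ConsTensor

universe u v

variable {k : Type u} [Field k] {n : ℕ}

lemma isGl_of_lieHom {F : Type*} [AddCommGroup F] [Module k F]
    (σ : Matrix (Fin n) (Fin n) k →ₗ⁅k⁆ Module.End k F) :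
    IsGl fun (_ : Fin 1) a b => σ (Matrix.single a b 1) := by
  refine ⟨fun _ a b c d => ?_, fun i j hij => absurd (Subsingleton.elim i j) hij⟩
  have h := σ.map_lie (Matrix.single a b 1) (Matrix.single c d 1)
  rw [lie_single_single, Ring.lie_def (σ _)] at h
  rw [← h]
  split_ifs <;> simp

/-- Tensor products of modules of tensor fields are quotients of modules of tensor fields on
products. -/
lemma isTensorQuotient_tensorProd {s : ℕ} (V : Fin s → GlIrrep k n) :
    IsTensorQuotient fun β : Fin n →₀ ℕ => TensorProd.rep V (eulerField β) := by
  induction s with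
  | zero =>
    let f : (⨂[k] i, TensorField (V i)) ≃ₗ[k] k := PiTensorProduct.isEmptyEquiv (Fin 0)
    have h := isTensorQuotient_zero (k := k) (n := n) (Z := TensorProd V) f.symm.toLinearMap
      f.symm.surjective
    convert h using 2 with β
    exact Fin.sum_univ_zero fun i => actAt i (TensorField.rep (V i) (eulerField β))
  | succ s ih =>
    refine ((ih fun i => V i.succ).tensor (isGl_of_lieHom (V 0).rep)).of_surjective
      (consTensor k fun i => TensorField (V i)) consTensor_surjective fun β t => ?_
    exact consTensor_tensorRep (fun i => TensorField.rep (V i)) (eulerField β) t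

/-- The dual of the standard representation of `gl_n`. -/
noncomputable def dualGl (k : Type u) [Field k] (n : ℕ) (a b : Fin n) : Module.End k (Fin n → k) :=
  Matrix.toLinAlgEquiv' (-Matrix.single b a 1)

lemma isGl_dualGl : IsGl fun _ : Fin 1 => dualGl k n := by
  have h : IsGl fun (_ : Fin 1) (a b : Fin n) => -Matrix.single b a (1 : k) := by
    refine ⟨fun _ a b c d => ?_, fun i j hij => absurd (Subsingleton.elim i j) hij⟩
    have h := lie_single_single (k := k) b a d c
    rw [Ring.lie_def] at h
    rw [neg_mul_neg, neg_mul_neg, h]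
    simp only [eq_comm (a := a), eq_comm (a := c)]
    split_ifs <;> simp [add_comm, sub_eq_add_neg]
  exact h.map (R' := Module.End k (Fin n → k)) (Matrix.toLinAlgEquiv' (R := k) (n := Fin n)).toRingHom

/-- Vector fields as tensor fields. -/
noncomputable def vectorFieldMap (k : Type u) [Field k] (n : ℕ) :
    MvPolynomial (Fin n) k ⊗[k] (Fin n → k) →ₗ[k] W k n :=
  (mkDerivationEquiv k).toLinearMap ∘ₗ
    (TensorProduct.piScalarRight k k (MvPolynomial (Fin n) k) (Fin n)).toLinearMap

lemma vectorFieldMap_tmul_X (f : MvPolynomial (Fin n) k) (v : Fin n → k) (i : Fin n) :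
    vectorFieldMap k n (f ⊗ₜ v) (X i) = v i • f := by
  change mkDerivation k (TensorProduct.piScalarRight k k (MvPolynomial (Fin n) k) (Fin n) (f ⊗ₜ v)) (X i) = _
  rw [mkDerivation_X, TensorProduct.piScalarRight_apply, TensorProduct.piScalarRightHom_tmul]

lemma vectorFieldMap_surjective : Function.Surjective (vectorFieldMap k n) := by
  exact (mkDerivationEquiv k).surjective.comp
    (TensorProduct.piScalarRight k k (MvPolynomial (Fin n) k) (Fin n)).surjective

/-- In the bracket of a field with `∑ f_l ∂_l`, differentiating the `f_l` gives the scalar part, and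
differentiating the first field gives minus the transposed Jacobian action, which is the dual of the
standard representation. -/
lemma vectorFieldMap_fieldAct (β : Fin n →₀ ℕ) (t : MvPolynomial (Fin n) k ⊗[k] (Fin n → k)) :
    vectorFieldMap k n (fieldAct (dualGl k n) β t) =
      LieModule.toEnd k (W k n) (W k n) (eulerField β) (vectorFieldMap k n t) := by
  induction t with
  | zero => simp
  | add t u ht hu => simp only [map_add, ht, hu]
  | tmul f v =>
    refine derivation_ext fun l => ?_
    have h1 : ∀ a b, vectorFieldMap k n ((pderiv a ((eulerField β : W k n) (X b)) * f) ⊗ₜ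
        dualGl k n a b v) (X l) = if b = l then
          -(v a • (pderiv a ((eulerField β : W k n) (X l)) * f)) else 0 := by
      intro a b
      rw [vectorFieldMap_tmul_X, dualGl]
      have : Matrix.toLinAlgEquiv' (-Matrix.single b a (1 : k)) v l = if b = l then - v a else 0 := by
        rw [Matrix.toLinAlgEquiv'_apply, Matrix.neg_mulVec, Pi.neg_apply, Matrix.single_mulVec]
        by_cases h : b = l
        · subst h; simp
        · simp [h, Ne.symm h]
      rw [this]
      split_ifs with h
      · rw [h, neg_smul]
      · rw [zero_smul]
    rw [fieldAct, LinearMap.add_apply, LinearMap.rTensor_tmul, map_add, Derivation.add_apply,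
      vectorFieldMap_tmul_X, LieModule.toEnd_apply_apply, Derivation.commutator_apply, vectorFieldMap_tmul_X, Derivation.map_smul,
      sub_eq_add_neg]
    congr 1
    simp only [LinearMap.sum_apply, map_sum, PolyVectorField.sum_apply, TensorProduct.map_tmul,
      LinearMap.mulLeft_apply, h1, Finset.sum_ite_eq', Finset.mem_univ, if_true]
    rw [Finset.sum_neg_distrib (G := MvPolynomial (Fin n) k), apply_eq_sum (vectorFieldMap k n _)]
    refine congrArg Neg.neg (Finset.sum_congr rfl fun a _ => ?_)
    rw [vectorFieldMap_tmul_X, smul_mul_assoc, mul_comm]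

lemma IsTensorQuotient.tensor_vectorField {Z : Type*} [AddCommGroup Z] [Module k Z]
    {ρ : (Fin n →₀ ℕ) → Module.End k Z} (h : IsTensorQuotient ρ) :
    IsTensorQuotient fun β : Fin n →₀ ℕ =>
      tensorOp (LieModule.toEnd k (W k n) (W k n) (eulerField β)) (ρ β) := by
  refine (h.tensor isGl_dualGl).of_surjective (TensorProduct.map (vectorFieldMap k n) LinearMap.id)
    (TensorProduct.map_surjective vectorFieldMap_surjective Function.surjective_id) fun β t => ?_
  exact map_tensorOp (k := k) (f := fieldAct (dualGl k n) β) (g := ρ β)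
    (f' := LieModule.toEnd k (W k n) (W k n) (eulerField β)) (g' := ρ β) (ψ := LinearMap.id)
    (vectorFieldMap_fieldAct β) (fun _ => rfl) t

/-- Quotients of finite products. -/
def IsSumQuotient {Y : Type*} [AddCommGroup Y] [Module k Y] (ρ : (Fin n →₀ ℕ) → Module.End k Y) : Prop :=
  ∃ (m : ℕ) (P : Fin m → Type u) (_ : ∀ s, AddCommGroup (P s)) (_ : ∀ s, Module k (P s))
    (ρP : ∀ s, (Fin n →₀ ℕ) → Module.End k (P s)) (φ : (∀ s, P s) →ₗ[k] Y),
    (∀ s, IsTensorQuotient (ρP s)) ∧ Function.Surjective φ ∧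
      ∀ β t, φ (fun s => ρP s β (t s)) = ρ β (φ t)

lemma IsSumQuotient.noeth [CharZero k] {Y : Type*} [AddCommGroup Y] [Module k Y]
    {ρ : (Fin n →₀ ℕ) → Module.End k Y} (h : IsSumQuotient ρ) {e : ℕ} (he : 1 ≤ e) :
    Noeth fun β : {β : Fin n →₀ ℕ // e ≤ β.degree} => ρ β.1 := by
  obtain ⟨m, P, _, _, ρP, φ, hP, hφ, h⟩ := h
  have h1 := Noeth.pi fun s => (hP s).noeth he
  exact h1.of_surjective φ (fun β t => h β.1 t) hφ

lemma IsSumQuotient.tensor_vectorField {Y : Type*} [AddCommGroup Y] [Module k Y]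
    {ρ : (Fin n →₀ ℕ) → Module.End k Y} (h : IsSumQuotient ρ) :
    IsSumQuotient fun β : Fin n →₀ ℕ =>
      tensorOp (LieModule.toEnd k (W k n) (W k n) (eulerField β)) (ρ β) := by
  classical
  obtain ⟨m, P, _, _, ρP, φ, hP, hφ, h⟩ := h
  let ψ : (∀ s, W k n ⊗[k] P s) →ₗ[k] W k n ⊗[k] Y := LinearMap.lsum k _ k fun s =>
    TensorProduct.map LinearMap.id (φ ∘ₗ LinearMap.single k P s)
  have hψ : ∀ t, ψ t = ∑ s, TensorProduct.map LinearMap.id (φ ∘ₗ LinearMap.single k P s) (t s) :=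
    fun t => by simp [ψ, LinearMap.lsum_apply, LinearMap.sum_apply]
  let ρ' : ∀ s, (Fin n →₀ ℕ) → Module.End k (W k n ⊗[k] P s) := fun s β =>
    tensorOp (LieModule.toEnd k (W k n) (W k n) (eulerField β)) (ρP s β)
  have hP' : ∀ s, IsTensorQuotient (Z := W k n ⊗[k] P s) (ρ' s) := fun s =>
    (hP s).tensor_vectorField
  refine ⟨m, fun s => W k n ⊗[k] P s, inferInstance, inferInstance, ρ', ψ, hP', fun t => ?_, fun β t => ?_⟩
  · induction t with
    | zero => exact ⟨0, map_zero _⟩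
    | add t u ht hu =>
      obtain ⟨a, rfl⟩ := ht
      obtain ⟨b, rfl⟩ := hu
      exact ⟨a + b, map_add _ _ _⟩
    | tmul w y =>
      obtain ⟨t, rfl⟩ := hφ y
      refine ⟨fun s => w ⊗ₜ t s, ?_⟩
      rw [hψ]
      simp only [TensorProduct.map_tmul, LinearMap.id_apply, LinearMap.comp_apply]
      rw [← TensorProduct.tmul_sum, ← map_sum]
      congr 2
      exact LinearMap.sum_single_apply P t
  · rw [hψ, hψ, map_sum]
    refine Finset.sum_congr rfl fun s _ => ?_
    refine map_tensorOp (k := k) (φ := LinearMap.id) (f' := LieModule.toEnd k (W k n) (W k n) (eulerField β)) (g' := ρ β)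
      (fun _ => rfl) (fun p => ?_) (t s)
    rw [LinearMap.comp_apply, LinearMap.comp_apply, ← h]
    congr 1
    ext s'
    by_cases hs : s' = s
    · subst hs; simp
    · simp [hs]

/-- Subquotients of the modules in `IsSumQuotient`. -/
def IsSubquotient (e : ℕ) {Z : Type v} [AddCommGroup Z] [Module k Z]
    (ρ : {β : Fin n →₀ ℕ // e ≤ β.degree} → Module.End k Z) : Prop :=
  ∃ (Y X : Type u) (_ : AddCommGroup Y) (_ : Module k Y) (_ : AddCommGroup X) (_ : Module k X)
    (ρY : (Fin n →₀ ℕ) → Module.End k Y)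
    (ρX : {β : Fin n →₀ ℕ // e ≤ β.degree} → Module.End k X) (i : X →ₗ[k] Y) (φ : X →ₗ[k] Z),
    IsSumQuotient ρY ∧ Function.Injective i ∧ Function.Surjective φ ∧
      (∀ β x, i (ρX β x) = ρY β.1 (i x)) ∧ ∀ β x, φ (ρX β x) = ρ β (φ x)

namespace IsSubquotient

variable {e : ℕ} {Z : Type v} [AddCommGroup Z] [Module k Z]
  {ρ : {β : Fin n →₀ ℕ // e ≤ β.degree} → Module.End k Z}

lemma noeth [CharZero k] (h : IsSubquotient e ρ) (he : 1 ≤ e) : Noeth ρ := by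
  obtain ⟨Y, X, _, _, _, _, ρY, ρX, i, φ, hY, hi, hφ, h1, h2⟩ := h
  exact ((hY.noeth he).of_injective i h1 hi).of_surjective φ h2 hφ

lemma of_surjective {Z' : Type*} [AddCommGroup Z'] [Module k Z']
    {ρ' : {β : Fin n →₀ ℕ // e ≤ β.degree} → Module.End k Z'} (h : IsSubquotient e ρ) (ψ : Z →ₗ[k] Z')
    (hψ : Function.Surjective ψ) (hρ : ∀ β t, ψ (ρ β t) = ρ' β (ψ t)) : IsSubquotient e ρ' := by
  obtain ⟨Y, X, _, _, _, _, ρY, ρX, i, φ, hY, hi, hφ, h1, h2⟩ := h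
  exact ⟨Y, X, _, _, _, _, ρY, ρX, i, ψ ∘ₗ φ, hY, hi, hψ.comp hφ, h1, fun β x => by
    rw [LinearMap.comp_apply, h2, hρ, LinearMap.comp_apply]⟩

/-- The tensor product of injections over a field is injective, so a subspace `G` of `W` may replace
`W`. This is the step from `p`-chains to `(p + 1)`-chains. -/
lemma tensor (h : IsSubquotient e ρ) {G : Type u} [AddCommGroup G] [Module k G]
    (adG : {β : Fin n →₀ ℕ // e ≤ β.degree} → Module.End k G) (j : G →ₗ[k] W k n)
    (hj : Function.Injective j) (hG : ∀ β x, 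
      j (adG β x) = LieModule.toEnd k (W k n) (W k n) (eulerField β.1) (j x)) :
    IsSubquotient e fun β => tensorOp (adG β) (ρ β) := by
  obtain ⟨Y, X, _, _, _, _, ρY, ρX, i, φ, hY, hi, hφ, h1, h2⟩ := h
  refine ⟨W k n ⊗[k] Y, G ⊗[k] X, _, _, _, _, _, fun β => tensorOp (adG β) (ρX β),
    TensorProduct.map j i, TensorProduct.map LinearMap.id φ, hY.tensor_vectorField, ?_,
    TensorProduct.map_surjective Function.surjective_id hφ, fun β x => ?_, fun β x => ?_⟩
  · rw [← LinearMap.rTensor_comp_lTensor]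
    exact (Module.Flat.rTensor_preserves_injective_linearMap j hj).comp
      (Module.Flat.lTensor_preserves_injective_linearMap i hi)
  · exact map_tensorOp (k := k) (f' := LieModule.toEnd k (W k n) (W k n) (eulerField β.1)) (hG β) (h1 β) x
  · exact map_tensorOp (k := k) (f' := adG β) (g' := ρ β) (φ := LinearMap.id) (fun _ => rfl) (h2 β) x

end IsSubquotient

end MultiPoly

/-! ### The action on chains and its triviality in homology -/

namespace ChevalleyEilenberg

open StableNoetherian

section Chains

variable {k L M : Type*} [Field k] [LieRing L] [LieAlgebra k L] [AddCommGroup M] [Module k M]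

variable (k L M) in
/-- The chains of degree `p` as a subspace of `⋀ L ⊗ M`. -/
noncomputable def chainSpace (p : ℕ) : Submodule k (ExteriorAlgebra k L ⊗[k] M) :=
  LinearMap.range (incl k L M p)

lemma ιMulti_tmul_mem_chainSpace {p : ℕ} (x : Fin p → L) (m : M) :
    ExteriorAlgebra.ιMulti k p x ⊗ₜ m ∈ chainSpace k L M p :=
  ⟨chain k x m, incl_chain x m⟩

lemma chainSpace_le {p : ℕ} {N : Submodule k (ExteriorAlgebra k L ⊗[k] M)}
    (h : ∀ (x : Fin p → L) (m : M), ExteriorAlgebra.ιMulti k p x ⊗ₜ m ∈ N) : chainSpace k L M p ≤ N := by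
  rintro _ ⟨c, rfl⟩
  have h1 : ∀ (ω : ⋀[k]^p L) (m : M), (ω : ExteriorAlgebra k L) ⊗ₜ[k] m ∈ N := by
    intro ω m
    have hω : ω ∈ Submodule.span k (Set.range (exteriorPower.ιMulti k p (M := L))) := by
      rw [exteriorPower.ιMulti_span]; trivial
    induction hω using Submodule.span_induction with
    | mem ω hω => obtain ⟨x, rfl⟩ := hω; exact h x m
    | zero => rw [ZeroMemClass.coe_zero, TensorProduct.zero_tmul]; exact zero_mem _
    | add a b _ _ ha hb => rw [Submodule.coe_add, TensorProduct.add_tmul]; exact add_mem ha hb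
    | smul a b _ hb => rw [Submodule.coe_smul, ← TensorProduct.smul_tmul']; exact N.smul_mem _ hb
  change (⋀[k]^p L) ⊗[k] M at c
  change LinearMap.rTensor M _ c ∈ N
  induction c with
  | zero => rw [map_zero]; exact zero_mem _
  | add a b ha hb => rw [map_add]; exact add_mem ha hb
  | tmul ω m => exact h1 ω m

lemma wedge_mem_chainSpace (x : L) {p : ℕ} {c : ExteriorAlgebra k L ⊗[k] M}
    (hc : c ∈ chainSpace k L M p) : wedge x c ∈ chainSpace k L M (p + 1) := by
  refine chainSpace_le (N := (chainSpace k L M (p + 1)).comap (wedge x)) (fun v m => ?_) hc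
  rw [Submodule.mem_comap, wedge_tmul, ← ιMulti_cons]
  exact ιMulti_tmul_mem_chainSpace _ _

lemma one_tmul_mem_chainSpace (m : M) :
    (1 : ExteriorAlgebra k L) ⊗ₜ m ∈ chainSpace k L M 0 := by
  have := ιMulti_tmul_mem_chainSpace (k := k) (Fin.elim0 : Fin 0 → L) m
  rwa [ExteriorAlgebra.ιMulti_zero_apply] at this

variable (k L M) in
/-- The inclusion of the coefficients as the chains of degree zero. -/
noncomputable def coeffMap : M →ₗ[k] chainSpace k L M 0 :=
  LinearMap.codRestrict _ (TensorProduct.mk k (ExteriorAlgebra k L) M 1) one_tmul_mem_chainSpace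

lemma coeffMap_surjective : Function.Surjective (coeffMap k L M) := by
  have h : chainSpace k L M 0 ≤ LinearMap.range (TensorProduct.mk k (ExteriorAlgebra k L) M 1) :=
    chainSpace_le fun x m => ⟨m, by rw [ExteriorAlgebra.ιMulti_zero_apply]; rfl⟩
  rintro ⟨c, hc⟩
  obtain ⟨m, hm⟩ := h hc
  exact ⟨m, Subtype.ext hm⟩

variable (k L M) in
/-- The exterior product with elements of `L` on chains. -/
noncomputable def wedgeMap (p : ℕ) :
    L ⊗[k] chainSpace k L M p →ₗ[k] chainSpace k L M (p + 1) :=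
  TensorProduct.lift <| LinearMap.mk₂ k (fun x c => ⟨wedge x c.1, wedge_mem_chainSpace x c.2⟩)
    (fun _ _ _ => Subtype.ext (wedge_add _ _ _)) (fun _ _ _ => Subtype.ext (wedge_smul _ _ _))
    (fun _ _ _ => Subtype.ext (map_add _ _ _)) (fun _ _ _ => Subtype.ext (map_smul _ _ _))

lemma coe_wedgeMap_tmul {p : ℕ} (x : L) (c : chainSpace k L M p) :
    (wedgeMap k L M p (x ⊗ₜ c) : ExteriorAlgebra k L ⊗[k] M) = wedge x c.1 := rfl

lemma wedgeMap_surjective (p : ℕ) : Function.Surjective (wedgeMap k L M p) := by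
  have h : chainSpace k L M (p + 1) ≤
      LinearMap.range ((chainSpace k L M (p + 1)).subtype ∘ₗ wedgeMap k L M p) := by
    refine chainSpace_le fun x m => ?_
    obtain ⟨a, v, rfl⟩ := exists_cons x
    refine ⟨a ⊗ₜ ⟨_, ιMulti_tmul_mem_chainSpace v m⟩, ?_⟩
    rw [ιMulti_cons]
    rfl
  rintro ⟨c, hc⟩
  obtain ⟨m, hm⟩ := h hc
  exact ⟨m, Subtype.ext hm⟩

lemma theta_mem_chainSpace (ρ : L →ₗ⁅k⁆ Module.End k M) (x : L) {p : ℕ}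
    {c : ExteriorAlgebra k L ⊗[k] M} (hc : c ∈ chainSpace k L M p) :
    theta ρ x c ∈ chainSpace k L M p := by
  refine chainSpace_le (N := (chainSpace k L M p).comap (theta ρ x)) (fun v m => ?_) hc
  rw [Submodule.mem_comap, theta_tmul, adExt_ιMulti, TensorProduct.sum_tmul]
  exact add_mem (Submodule.sum_mem _ fun j _ => ιMulti_tmul_mem_chainSpace _ _)
    (ιMulti_tmul_mem_chainSpace _ _)

/-- The action of `L` on chains. -/
noncomputable def chainAct (ρ : L →ₗ⁅k⁆ Module.End k M) (p : ℕ) (x : L) :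
    Module.End k (chainSpace k L M p) :=
  (theta ρ x).restrict fun _ => theta_mem_chainSpace ρ x

lemma coe_chainAct (ρ : L →ₗ⁅k⁆ Module.End k M) (p : ℕ) (x : L) (c : chainSpace k L M p) :
    (chainAct ρ p x c : ExteriorAlgebra k L ⊗[k] M) = theta ρ x c := rfl

lemma coeffMap_chainAct (ρ : L →ₗ⁅k⁆ Module.End k M) (x : L) (m : M) :
    coeffMap k L M (ρ x m) = chainAct ρ 0 x (coeffMap k L M m) := by
  refine Subtype.ext ?_
  change (1 : ExteriorAlgebra k L) ⊗ₜ[k] ρ x m = theta ρ x (1 ⊗ₜ m)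
  rw [theta_tmul, adExt_one, LinearMap.zero_apply, TensorProduct.zero_tmul, zero_add]

lemma wedgeMap_chainAct (ρ : L →ₗ⁅k⁆ Module.End k M) (p : ℕ) (x : L)
    (t : L ⊗[k] chainSpace k L M p) :
    wedgeMap k L M p (MultiPoly.tensorOp (LieModule.toEnd k L L x) (chainAct ρ p x) t) =
      chainAct ρ (p + 1) x (wedgeMap k L M p t) := by
  induction t with
  | zero => simp
  | add t s ht hs => simp only [map_add, ht, hs]
  | tmul y c =>
    refine Subtype.ext ?_
    rw [MultiPoly.tensorOp_tmul, map_add, Submodule.coe_add, coe_wedgeMap_tmul, coe_wedgeMap_tmul,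
      coe_chainAct]
    exact (theta_wedge ρ x y c.1).symm

lemma mem_cycles_iff (ρ : L →ₗ⁅k⁆ Module.End k M) (p : ℕ) (c : Chains k L M p) :
    c ∈ cycles ρ p ↔ totalD ρ (incl k L M p c) = 0 := by
  cases p with
  | zero =>
    refine ⟨fun _ => ?_, fun _ => trivial⟩
    obtain ⟨m, hm⟩ := coeffMap_surjective (k := k) (L := L) ⟨_, c, rfl⟩
    have h : (1 : ExteriorAlgebra k L) ⊗ₜ[k] m = incl k L M 0 c := congrArg Subtype.val hm
    rw [← h]
    exact totalD_one_tmul ρ m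
  | succ p =>
    rw [← incl_d, ← map_zero (incl k L M p), (incl_injective p).eq_iff]
    rfl

/-- If the chains are noetherian under the action of a family of elements of the Lie algebra, then
the homology is finite-dimensional. -/
theorem finiteDimensional_homology {I : Type*} (ρ : L →ₗ⁅k⁆ Module.End k M) (p : ℕ) (y : I → L)
    (h : Noeth fun i => chainAct ρ p (y i)) : FiniteDimensional k (Homology ρ p) := by
  classical
  let N : Submodule k (chainSpace k L M p) :=
    LinearMap.ker (totalD ρ ∘ₗ (chainSpace k L M p).subtype)
  have hN : ∀ c, c ∈ N ↔ totalD ρ c.1 = 0 := fun c => Iff.rfl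
  have hst : Stable (fun i => chainAct ρ p (y i)) N := by
    intro i c hc
    rw [hN] at hc ⊢
    rw [coe_chainAct, totalD_theta, hc, map_zero]
  obtain ⟨S, hS, hNS⟩ := h N hst le_top
  rw [bot_sup_eq] at hNS
  let κ : cycles ρ p →ₗ[k] chainSpace k L M p := (incl k L M p).rangeRestrict ∘ₗ (cycles ρ p).subtype
  have hκ : ∀ z, (κ z : ExteriorAlgebra k L ⊗[k] M) = incl k L M p z := fun z => rfl
  have hκi : Function.Injective κ := fun z z' hz =>
    Subtype.ext (incl_injective p (congrArg Subtype.val hz))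
  have hκN : ∀ c ∈ N, ∃ z, κ z = c := by
    rintro ⟨_, c, rfl⟩ hc
    exact ⟨⟨c, (mem_cycles_iff ρ p c).2 hc⟩, rfl⟩
  have hNκ : ∀ z, κ z ∈ N := fun z => (mem_cycles_iff ρ p z).1 z.2
  let mk : cycles ρ p →ₗ[k] Homology ρ p := ((boundaries ρ p).submoduleOf (cycles ρ p)).mkQ
  have hS' : ∀ s : S, ∃ z, κ z = s := fun s => hκN s (hS s.2)
  choose f hf using hS'
  let Q : Submodule k (Homology ρ p) := Submodule.span k (Set.range fun s => mk (f s))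
  -- The cycles with class in `Q` form a stable subspace, since the action takes every cycle to a
  -- boundary.
  have hgen : gen (fun i => chainAct ρ p (y i)) (S : Set (chainSpace k L M p)) ≤ (Q.comap mk).map κ := by
    refine gen_le (fun i c hc => ?_) fun s hs => ?_
    · obtain ⟨z, hz, rfl⟩ := hc
      -- This is Cartan's formula on a cycle, where the term containing the differential of the
      -- cycle vanishes.
      have h1 : theta ρ (y i) (κ z) = totalD ρ (wedge (y i) (κ z)) := by
        rw [totalD_wedge, (hN _).1 (hNκ z), map_zero, sub_zero]
      obtain ⟨b, hb⟩ := wedge_mem_chainSpace (y i) (κ z).2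
      have h2 : incl k L M p (d ρ p b) = theta ρ (y i) (κ z) := by rw [h1, ← hb, incl_d]
      obtain ⟨z', hz'⟩ := hκN _ (hst i _ (hNκ z))
      refine ⟨z', ?_, hz'⟩
      have h3 : (z' : Chains k L M p) = d ρ p b := by
        refine incl_injective p ?_
        rw [h2, ← hκ, hz']
        rfl
      have h4 : mk z' = 0 := by
        refine (Submodule.Quotient.mk_eq_zero _).2 ?_
        change (z' : Chains k L M p) ∈ boundaries ρ p
        exact ⟨b, h3.symm⟩
      change mk z' ∈ Q
      rw [h4]
      exact Q.zero_mem
    · exact ⟨f ⟨s, hs⟩, Submodule.subset_span ⟨⟨s, hs⟩, rfl⟩, hf ⟨s, hs⟩⟩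
  have hQ : Q = ⊤ := by
    rw [eq_top_iff]
    rintro q -
    obtain ⟨z, rfl⟩ := Submodule.mkQ_surjective _ q
    obtain ⟨z', hz', h5⟩ := hgen (hNS (hNκ z))
    rwa [hκi h5] at hz'
  exact ⟨Submodule.fg_def.2 ⟨_, Set.finite_range _, hQ⟩⟩

end Chains

end ChevalleyEilenberg

/-! ### Graded subalgebras of finite codimension and the category `𝒪` -/

namespace PolyVectorField

open MvPolynomial MultiPoly ChevalleyEilenberg

universe u

variable {k : Type u} [Field k] {n : ℕ}

variable (k n) in
/-- The homogeneous component of a vector field. -/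
noncomputable def component (j : ℕ) : W k n →ₗ[k] W k n where
  toFun D := mkDerivation k fun i => homogeneousComponent j (D (X i))
  map_add' D E := derivation_ext fun i => by simp [mkDerivation_X]
  map_smul' c D := derivation_ext fun i => by simp [mkDerivation_X]

lemma component_X (j : ℕ) (D : W k n) (i : Fin n) :
    component k n j D (X i) = homogeneousComponent j (D (X i)) := mkDerivation_X _ _ _

lemma component_of_mem {j l : ℕ} {D : W k n} (hD : D ∈ homogeneousFields k n l) :
    component k n j D = if j = l then D else 0 := by
  refine derivation_ext fun i => ?_
  rw [component_X, homogeneousComponent_of_mem (hD i)]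
  split_ifs <;> simp_all

lemma component_mem {g : LieSubalgebra k (W k n)} (hg : IsGradedSubalgebra g) (j : ℕ) {D : W k n}
    (hD : D ∈ g) : component k n j D ∈ g := by
  have h1 : (⨆ j : ℕ, g.toSubmodule ⊓ homogeneousFields k n j) ≤ g.toSubmodule.comap (component k n j) := by
    refine iSup_le fun l D hD => ?_
    rw [Submodule.mem_comap, component_of_mem hD.2]
    split_ifs
    · exact hD.1
    · exact zero_mem _
  exact h1 (hg hD)

/-- A graded subalgebra of finite codimension contains the homogeneous fields of large degree. -/
lemma exists_homogeneousFields_le {g : LieSubalgebra k (W k n)} (hg : IsGradedSubalgebra g)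
    (hcodim : FiniteDimensional k (W k n ⧸ g.toSubmodule)) :
    ∃ e, ∀ j, e ≤ j → homogeneousFields k n j ≤ g.toSubmodule := by
  -- The images of the fields of degree less than `m` form an increasing chain in a
  -- finite-dimensional quotient, which stabilizes at some `e`.
  let U : ℕ →o Submodule k (W k n ⧸ g.toSubmodule) :=
    ⟨fun m => (⨆ l : Fin m, homogeneousFields k n l).map g.toSubmodule.mkQ, fun a b hab =>
      Submodule.map_mono (iSup_le fun l => le_iSup_of_le (Fin.castLE hab l) le_rfl)⟩
  obtain ⟨e, he⟩ := monotone_stabilizes_iff_noetherian.2 (inferInstance :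
    IsNoetherian k (W k n ⧸ g.toSubmodule)) U
  refine ⟨e, fun j hj D hD => ?_⟩
  have h1 : g.toSubmodule.mkQ D ∈ U (j + 1) :=
    ⟨D, Submodule.mem_iSup_of_mem (Fin.last j) hD, rfl⟩
  rw [← he (j + 1) (by omega)] at h1
  obtain ⟨E, hE, hED⟩ := h1
  -- Here `E` has only components of degree less than `e ≤ j`, so the component of degree `j` of `D
  -- - E`, which lies in `g` because `g` is graded, is `D`.
  have h2 : D - E ∈ g := (Submodule.Quotient.eq g.toSubmodule).1 hED.symm
  have h3 : component k n j E = 0 := by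
    have : (⨆ l : Fin e, homogeneousFields k n l) ≤ LinearMap.ker (component k n j) := by
      refine iSup_le fun l D hD => ?_
      rw [LinearMap.mem_ker, component_of_mem hD, if_neg (by omega)]
    exact this hE
  have h4 := component_mem hg j h2
  rwa [map_sub, h3, sub_zero, component_of_mem hD, if_pos rfl] at h4

lemma eulerField_mem_homogeneousFields (β : Fin n →₀ ℕ) :
    (eulerField β : W k n) ∈ homogeneousFields k n (β.degree + 1) := fun i => by
  rw [eulerField_X]
  exact (isHomogeneous_monomial _ rfl).mul (isHomogeneous_X _ _)

lemma eulerField_mem_fieldsOfOrder {d : ℕ} (β : Fin n →₀ ℕ) (h : d ≤ β.degree) :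
    (eulerField β : W k n) ∈ fieldsOfOrder k n d := fun i => by
  rw [eulerField_X]
  exact Ideal.mul_mem_right _ _ ((monomial_mem_pow_idealOfVars_iff d β one_ne_zero).2 h)

/-- The modules of the category `𝒪` are subquotients of modules of tensor fields on products. -/
lemma IsInCategoryO.isSubquotient {M : Type*} [AddCommGroup M] [Module k M] {d : ℕ}
    {ρ : fieldsOfOrder k n d →ₗ⁅k⁆ Module.End k M} (h : IsInCategoryO d ρ) {e : ℕ} (he : d ≤ e) :
    IsSubquotient e fun β : {β : Fin n →₀ ℕ // e ≤ β.degree} =>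
      ρ ⟨eulerField β.1, eulerField_mem_fieldsOfOrder β.1 (he.trans β.2)⟩ := by
  obtain ⟨_, 𝓜, -, -, T, A, hA, φ, -, hφ, -, h⟩ := h
  let D : {β : Fin n →₀ ℕ // e ≤ β.degree} → fieldsOfOrder k n d := fun β =>
    ⟨eulerField β.1, eulerField_mem_fieldsOfOrder β.1 (he.trans β.2)⟩
  refine ⟨T.Space, A, inferInstance, inferInstance, inferInstance, inferInstance,
    fun β => T.act (eulerField β), fun β => (T.act (D β)).restrict (hA (D β)), A.subtype, φ,
    ⟨T.size, fun s => TensorProd (T.factor s), inferInstance, inferInstance,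
      fun s β => TensorProd.rep (T.factor s) (eulerField β), LinearMap.id,
      fun s => isTensorQuotient_tensorProd (T.factor s), Function.surjective_id, fun β t => rfl⟩,
    A.subtype_injective, hφ, fun β x => rfl, fun β x => h (D β) x⟩

end PolyVectorField

/-! ### The chains as a subquotient, and the theorem -/

namespace ChevalleyEilenberg

open MultiPoly PolyVectorField

universe u v

/-- The exterior product makes the `(p + 1)`-chains an equivariant quotient of `g ⊗` the `p`-chains,
and `g` is a subspace of `W` under the adjoint action. -/
lemma isSubquotient_chainAct {k : Type u} [Field k] {n e : ℕ} {M : Type v} [AddCommGroup M] [Module k M]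
    {g : LieSubalgebra k (W k n)} (ρ : g →ₗ⁅k⁆ Module.End k M)
    (y : {β : Fin n →₀ ℕ // e ≤ β.degree} → g) (hy : ∀ β, (y β : W k n) = eulerField β.1)
    (h : IsSubquotient e fun β => ρ (y β)) (p : ℕ) :
    IsSubquotient e fun β => chainAct ρ p (y β) := by
  induction p with
  | zero => exact h.of_surjective _ coeffMap_surjective fun β m => coeffMap_chainAct ρ (y β) m
  | succ p ih =>
    refine (ih.tensor (fun β => LieModule.toEnd k g g (y β)) g.toSubmodule.subtype
      g.toSubmodule.subtype_injective fun β x => ?_).of_surjective _ (wedgeMap_surjective p)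
      fun β t => wedgeMap_chainAct ρ p (y β) t
    change ⁅(y β : W k n), (x : W k n)⁆ = _
    rw [hy]
    rfl

end ChevalleyEilenberg

theorem mainTheorem2 (k : Type*) [Field k] [CharZero k] (n d : ℕ)
    (g h : LieSubalgebra k (PolyVectorField.W k n))
    (hg : PolyVectorField.IsGradedSubalgebra g)
    (hcodim : FiniteDimensional k (PolyVectorField.W k n ⧸ g.toSubmodule))
    (hgh : g ≤ h) (hdh : PolyVectorField.fieldsOfOrder k n d ≤ h)
    {M : Type*} [AddCommGroup M] [Module k M] (ρ : h →ₗ⁅k⁆ Module.End k M)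
    (hM : PolyVectorField.IsInCategoryO d (ρ.comp (LieSubalgebra.inclusion hdh))) (p : ℕ) :
    FiniteDimensional k
      (ChevalleyEilenberg.Homology (ρ.comp (LieSubalgebra.inclusion hgh)) p) := by
  obtain ⟨e₀, he₀⟩ := PolyVectorField.exists_homogeneousFields_le hg hcodim
  -- The bound `e₀` puts the fields in `g`, the bound `d` puts them in `L_d`, and the bound `1`
  -- makes `x ^ β` vanish at the origin, as noetherianity requires.
  let e := max (max e₀ d) 1
  have hde : d ≤ e := (le_max_right _ _).trans (le_max_left _ _)
  let y : {β : Fin n →₀ ℕ // e ≤ β.degree} → g := fun β => ⟨MultiPoly.eulerField β.1,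
    he₀ (β.1.degree + 1) (((le_max_left _ _).trans (le_max_left _ _)).trans (β.2.trans (Nat.le_succ _)))
      (PolyVectorField.eulerField_mem_homogeneousFields β.1)⟩
  refine ChevalleyEilenberg.finiteDimensional_homology _ p y ?_
  refine MultiPoly.IsSubquotient.noeth ?_ (le_max_right _ _ : 1 ≤ e)
  -- The fields lie in both `g` and `L_d`, and both actions on `M` are restrictions of the action of
  -- `h`, so they agree on these fields.
  exact ChevalleyEilenberg.isSubquotient_chainAct _ y (fun _ => rfl) (hM.isSubquotient hde) p
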